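/- Let $M$ be a smooth manifold and let $E$ be an exact real Courant algebroid over $M$: a smooth real vector bundle with a symmetric nondegenerate pairing $\langle\cdot,\cdot\rangle$, a bracket $[\cdot,\cdot]$ on its sheaf of sections, and an exact sequence $0\to T^*M\xrightarrow{\iota}E\xrightarrow{\pi}TM\to 0$, such that locally there is a splitting of $\pi$ identifying $E$ with $TM\oplus T^*M$ equipped with the pairing $\langle X+\xi,Y+\eta\rangle=\tfrac12(\xi(Y)+\eta(X))$ and the bracket $[X+\xi,Y+\eta]=[X,Y]+L_X\eta-i_Yd\xi$. An almost generalized Kähler structure on $E$ is a pair $(J_+,J_-)$ of commuting smooth orthogonal bundle endomorphisms of $E$ with $J_\pm^2=-1$ such that $\langle J_+x,J_-y\rangle$ is positive-definite. It is called integrable (a generalized Kähler structure) if the $+i$-eigenbundles of $J_+$ and of $J_-$ in $E\otimes\mathbb C$ are both involutive for the Courant bracket. Let $C_\pm\subset E$ be the $\pm1$-eigenbundles of $G=-J_+J_-$. Then $\pi$ restricts to isomorphisms $C_\pm\to TM$; let $s_\pm:TM\to C_\pm$ be their inverses. The associated almost bi-Hermitian data are the isotropic splitting $s=\tfrac12(s_++s_-)$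 of $\pi$, the Riemannian metric $g(X,Y)=\langle s_+X,s_+Y\rangle$, and the $g$-orthogonal almost complex structures $I_\pm=\pi J_+s_\pm$. Put $\omega_\pm=gI_\pm$, that is, $\omega_\pm(X,Y)=g(I_\pm X,Y)$, and let $d^c_\pm=i(\bar\partial_\pm-\partial_\pm)$, where $\partial_\pm$ and $\bar\partial_\pm$ are the components of bidegree $(1,0)$ and $(0,1)$ of $d$ with respect to $I_\pm$. An almost complex structure $I$ is called integrable if its $+i$-eigenbundle $T^{1,0}\subset TM\otimes\mathbb C$ is involutive for the Lie bracket. Theorem. There is a unique 3-form $H$ on $M$ such that $$[s(X),s(Y)]=s([X,Y])+\iota(i_Xi_YH)$$ for all local vector fields $X,Y$ (where $i_Xi_YH=H(Y,X,\cdot)$), and $H$ is smooth and closed. Moreover $(J_+,J_-)$ is integrable if and only if $I_+$ and $I_-$ are both integrable and $$d^c_+\omega_+=H=-d^c_-\omega_-.$$ -/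

import Mathlib

open Bundle Set Topology
open scoped Manifold ContDiff TensorProduct

set_option linter.unusedSectionVars false

noncomputable section

namespace GenKahler

/-! ### Complexifications and involutive complex subbundles -/

section Complexified

/-- The element `a + i b` of the complexification `W ⊗ ℂ` of a real vector space. -/
def cplx {W : Type*} [AddCommGroup W] [Module ℝ W] (a b : W) : ℂ ⊗[ℝ] W :=
  (1 : ℂ) ⊗ₜ[ℝ] a + Complex.I ⊗ₜ[ℝ] b

/-- The `+i`-eigenspace, in `W ⊗ ℂ`, of a real endomorphism `J` of `W`. -/
def eigenI {W : Type*} [AddCommGroup W] [Module ℝ W] (J : W →ₗ[ℝ] W) :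
    Submodule ℂ (ℂ ⊗[ℝ] W) :=
  Module.End.eigenspace (J.baseChange ℂ) Complex.I

variable {V : Type*} [NormedAddCommGroup V] [NormedSpace ℝ V]
  {M : Type*} [TopologicalSpace M] [ChartedSpace V M]
  (F : Type*) [NormedAddCommGroup F] [NormedSpace ℝ F]
  {E : M → Type*} [TopologicalSpace (TotalSpace F E)] [∀ x, AddCommGroup (E x)]
  [∀ x, Module ℝ (E x)] [∀ x, TopologicalSpace (E x)] [FiberBundle F E]

variable (V) in
/-- `σ` is a smooth section over the set `U` of the bundle `E` with model fibre `F`, over a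
manifold modelled on `V`. -/
def SmoothSectionOn (σ : ∀ x, E x) (U : Set M) : Prop :=
  ContMDiffOn 𝓘(ℝ, V) (𝓘(ℝ, V).prod 𝓘(ℝ, F)) ∞ (fun x ↦ TotalSpace.mk' F x (σ x)) U

variable (V) in
/-- A complex subbundle `L ⊆ E ⊗ ℂ` is involutive for a real bracket `br` on (local) sections of
`E` when, for all smooth sections `a + i b` and `c + i d` of `L` over an open set `U`, the complex
bilinear extension of the bracket,
`[a + i b, c + i d] = ([a, c] - [b, d]) + i ([a, d] + [b, c])`, is a section of `L` over `U`. -/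
def IsInvolutive (br : (∀ x, E x) → (∀ x, E x) → ∀ x, E x)
    (L : ∀ x, Submodule ℂ (ℂ ⊗[ℝ] E x)) : Prop :=
  ∀ U : Set M, IsOpen U → ∀ a b c d : ∀ x, E x,
    SmoothSectionOn V F a U → SmoothSectionOn V F b U →
    SmoothSectionOn V F c U → SmoothSectionOn V F d U →
    (∀ x ∈ U, cplx (a x) (b x) ∈ L x) → (∀ x ∈ U, cplx (c x) (d x) ∈ L x) →
    ∀ x ∈ U, cplx (br a c x - br b d x) (br a d x + br b c x) ∈ L x

end Complexified

/-! ### Differential forms on a manifold -/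

section Forms

variable {V : Type*} [NormedAddCommGroup V] [NormedSpace ℝ V]
  {M : Type*} [TopologicalSpace M] [ChartedSpace V M]
  [IsManifold 𝓘(ℝ, V) ∞ M]
  {A : Type*} [NormedAddCommGroup A] [NormedSpace ℝ A]

/-- The exterior derivative of an `A`-valued `k`-form on `M`: the value at `x₀` is computed in the
chart at `x₀` (push the form forward to the chart, differentiate there, pull the result back). -/
def extD {k : ℕ} (α : ∀ x : M, TangentSpace 𝓘(ℝ, V) x [⋀^Fin k]→L[ℝ] A) (x₀ : M) :
    TangentSpace 𝓘(ℝ, V) x₀ [⋀^Fin (k + 1)]→L[ℝ] A :=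
  let φ := extChartAt 𝓘(ℝ, V) x₀
  let α' : V → V [⋀^Fin k]→L[ℝ] A := fun y ↦
    (α (φ.symm y)).compContinuousLinearMap (mfderiv 𝓘(ℝ, V) 𝓘(ℝ, V) φ.symm y)
  (extDeriv α' (φ x₀) : V [⋀^Fin (k + 1)]→L[ℝ] A).compContinuousLinearMap
    (mfderiv 𝓘(ℝ, V) 𝓘(ℝ, V) φ x₀)

/-- A differential form is smooth when it takes smooth values on smooth local vector fields. -/
def IsSmoothForm {k : ℕ} (α : ∀ x : M, TangentSpace 𝓘(ℝ, V) x [⋀^Fin k]→L[ℝ] A) : Prop :=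
  ∀ U : Set M, IsOpen U → ∀ X : Fin k → ∀ x : M, TangentSpace 𝓘(ℝ, V) x,
    (∀ i, SmoothSectionOn V V (X i) U) →
    ContMDiffOn 𝓘(ℝ, V) 𝓘(ℝ, A) ∞ (fun x ↦ α x (fun i ↦ X i x)) U

/-- A covector field viewed as a `1`-form. -/
def oneForm (ξ : ∀ x : M, TangentSpace 𝓘(ℝ, V) x →L[ℝ] ℝ) (x : M) :
    TangentSpace 𝓘(ℝ, V) x [⋀^Fin 1]→L[ℝ] ℝ :=
  ContinuousAlternatingMap.ofSubsingleton ℝ (TangentSpace 𝓘(ℝ, V) x) ℝ (0 : Fin 1) (ξ x)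

/-- The covector `i_Y dξ = dξ(Y, ·)` at `x`. -/
def contractD (ξ : ∀ x : M, TangentSpace 𝓘(ℝ, V) x →L[ℝ] ℝ) (Y : ∀ x : M, TangentSpace 𝓘(ℝ, V) x)
    (x : M) : TangentSpace 𝓘(ℝ, V) x →L[ℝ] ℝ :=
  (extD (oneForm ξ) x).toContinuousMultilinearMap.toContinuousLinearMap ![Y x, 0] 1

/-- The Lie derivative `L_X η = i_X dη + d(η(X))` of a `1`-form. -/
def lieD (X : ∀ x : M, TangentSpace 𝓘(ℝ, V) x) (η : ∀ x : M, TangentSpace 𝓘(ℝ, V) x →L[ℝ] ℝ)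
    (x : M) : TangentSpace 𝓘(ℝ, V) x →L[ℝ] ℝ :=
  contractD η X x + mvfderiv 𝓘(ℝ, V) (fun y ↦ η y (X y)) x

end Forms

/-! ### Types of complex-valued forms and Dolbeault operators -/

section Types

variable {W : Type*} [AddCommGroup W] [Module ℝ W] [TopologicalSpace W]
  [IsTopologicalAddGroup W] [ContinuousSMul ℝ W]

/-- For real vectors `a j`, `b j` depending real-linearly on `v j`, this is (as a function of `v`)
the value of the complex multilinear extension of `α` at the complex vectors `a j + i b j`, namely
`∑ T, i ^ |T| α(b on T, a off T)`. -/
def evalCplx {k : ℕ} (α : W [⋀^Fin k]→L[ℝ] ℂ) (a b : Fin k → W →L[ℝ] W) :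
    ContinuousMultilinearMap ℝ (fun _ : Fin k ↦ W) ℂ :=
  ∑ T : Finset (Fin k), Complex.I ^ T.card •
    α.toContinuousMultilinearMap.compContinuousLinearMap (fun j ↦ if j ∈ T then b j else a j)

/-- The multilinear map underlying the `(p, k - p)`-part of `α`: the sum over all `p`-element sets
`S` of slots of `α(P_S v)`, where the projection `P^{1,0} = (1 - i I) / 2` is inserted in the slots
in `S` and `P^{0,1} = (1 + i I) / 2` in the others. -/
def typePartMul {k : ℕ} (I : W →L[ℝ] W) (p : ℕ) (α : W [⋀^Fin k]→L[ℝ] ℂ) :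
    ContinuousMultilinearMap ℝ (fun _ : Fin k ↦ W) ℂ :=
  ∑ S ∈ Finset.powersetCard p (Finset.univ : Finset (Fin k)),
    evalCplx α (fun _ ↦ (2⁻¹ : ℝ) • ContinuousLinearMap.id ℝ W)
      (fun j ↦ if j ∈ S then -((2⁻¹ : ℝ) • I) else (2⁻¹ : ℝ) • I)

lemma typePartMul_swap {k : ℕ} (I : W →L[ℝ] W) (p : ℕ) (α : W [⋀^Fin k]→L[ℝ] ℂ)
    (v : Fin k → W) (i j : Fin k) (hij : i ≠ j) :
    typePartMul I p α (v ∘ Equiv.swap i j) = - typePartMul I p α v := by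
  simp only [typePartMul, evalCplx, sum_apply,
    smul_apply,
    ContinuousMultilinearMap.compContinuousLinearMap_apply]
  rw [← Finset.sum_neg_distrib]
  let e : Finset (Fin k) ≃ Finset (Fin k) := Equiv.finsetCongr (Equiv.swap i j)
  have he : ∀ (S : Finset (Fin k)) l, l ∈ e S ↔ Equiv.swap i j l ∈ S := by
    intro S l
    simp [e, Equiv.finsetCongr_apply, Finset.mem_map_equiv]
  refine Finset.sum_bij' (fun S _ ↦ e S) (fun S _ ↦ e S) ?_ ?_ ?_ ?_ ?_
  · intro S hS
    simpa [e, Finset.mem_powersetCard] using hS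
  · intro S hS
    simpa [e, Finset.mem_powersetCard] using hS
  · intro S _
    ext l
    simp [he]
  · intro S _
    ext l
    simp [he]
  · intro S _
    rw [← Finset.sum_neg_distrib]
    refine Finset.sum_bij' (fun T _ ↦ e T) (fun T _ ↦ e T) (fun _ _ ↦ Finset.mem_univ _)
      (fun _ _ ↦ Finset.mem_univ _) ?_ ?_ ?_
    · intro T _
      ext l
      simp [he]
    · intro T _
      ext l
      simp [he]
    · intro T _
      have hc : (e T).card = T.card := by simp [e]
      rw [hc]
      have h := α.toAlternatingMap.map_swap (fun l ↦ (if l ∈ e T then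
          (if l ∈ e S then -((2⁻¹ : ℝ) • I) else (2⁻¹ : ℝ) • I)
          else (2⁻¹ : ℝ) • ContinuousLinearMap.id ℝ W) (v l)) hij
      refine Eq.trans ?_ ((congrArg (fun z : ℂ ↦ Complex.I ^ T.card • z) h).trans (smul_neg _ _))
      refine congrArg (fun z : ℂ ↦ Complex.I ^ T.card • z) ?_
      change α _ = α _
      congr 1
      funext l
      simp [he, Function.comp]

/-- The `(p, k - p)`-part of a complex-valued `k`-form `α` on a real vector space with complex
structure `I`. -/
def typePart {k : ℕ} (I : W →L[ℝ] W) (p : ℕ) (α : W [⋀^Fin k]→L[ℝ] ℂ) :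
    W [⋀^Fin k]→L[ℝ] ℂ :=
  { typePartMul I p α with
    map_eq_zero_of_eq' := by
      intro v i j hv hij
      have h := typePartMul_swap I p α v i j hij
      have hs : v ∘ Equiv.swap i j = v := by
        funext l
        simp only [Function.comp]
        rcases eq_or_ne l i with rfl | h1
        · rw [Equiv.swap_apply_left, hv]
        · rcases eq_or_ne l j with rfl | h2
          · rw [Equiv.swap_apply_right, hv]
          · rw [Equiv.swap_apply_of_ne_of_ne h1 h2]
      rw [hs] at h
      change typePartMul I p α v = 0
      exact self_eq_neg.mp h }

end Types

section Dolbeault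

variable {V : Type*} [NormedAddCommGroup V] [NormedSpace ℝ V]
  {M : Type*} [TopologicalSpace M] [ChartedSpace V M]
  [IsManifold 𝓘(ℝ, V) ∞ M]

/-- `∂ : Ω^k(M, ℂ) → Ω^{k+1}(M, ℂ)`, the sum over `p + q = k` of `π^{p+1,q} ∘ d ∘ π^{p,q}`, for an
almost complex structure `I`. -/
def del {k : ℕ} (I : ∀ x : M, TangentSpace 𝓘(ℝ, V) x →L[ℝ] TangentSpace 𝓘(ℝ, V) x)
    (α : ∀ x : M, TangentSpace 𝓘(ℝ, V) x [⋀^Fin k]→L[ℝ] ℂ) (x : M) :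
    TangentSpace 𝓘(ℝ, V) x [⋀^Fin (k + 1)]→L[ℝ] ℂ :=
  ∑ p ∈ Finset.range (k + 1),
    typePart (I x) (p + 1) (extD (fun y ↦ typePart (I y) p (α y)) x)

/-- `∂̄ : Ω^k(M, ℂ) → Ω^{k+1}(M, ℂ)`, the sum over `p + q = k` of `π^{p,q+1} ∘ d ∘ π^{p,q}`, for an
almost complex structure `I`. -/
def delbar {k : ℕ} (I : ∀ x : M, TangentSpace 𝓘(ℝ, V) x →L[ℝ] TangentSpace 𝓘(ℝ, V) x)
    (α : ∀ x : M, TangentSpace 𝓘(ℝ, V) x [⋀^Fin k]→L[ℝ] ℂ) (x : M) :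
    TangentSpace 𝓘(ℝ, V) x [⋀^Fin (k + 1)]→L[ℝ] ℂ :=
  ∑ p ∈ Finset.range (k + 1),
    typePart (I x) p (extD (fun y ↦ typePart (I y) p (α y)) x)

/-- A real form viewed as a complex-valued form. -/
def toComplexForm {k : ℕ} (α : ∀ x : M, TangentSpace 𝓘(ℝ, V) x [⋀^Fin k]→L[ℝ] ℝ) (x : M) :
    TangentSpace 𝓘(ℝ, V) x [⋀^Fin k]→L[ℝ] ℂ :=
  Complex.ofRealCLM.compContinuousAlternatingMap (α x)

/-- The operator `d^c = i (∂̄ - ∂)`, applied to a real form; as a complex-valued form. -/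
def dc {k : ℕ} (I : ∀ x : M, TangentSpace 𝓘(ℝ, V) x →L[ℝ] TangentSpace 𝓘(ℝ, V) x)
    (α : ∀ x : M, TangentSpace 𝓘(ℝ, V) x [⋀^Fin k]→L[ℝ] ℝ) (x : M) :
    TangentSpace 𝓘(ℝ, V) x [⋀^Fin (k + 1)]→L[ℝ] ℂ :=
  Complex.I • (delbar I (toComplexForm α) x - del I (toComplexForm α) x)

/-- An almost complex structure `I` is integrable when the bundle `T^{1,0}`, its `+i`-eigenbundle in
`TM ⊗ ℂ`, is involutive for the Lie bracket of vector fields. -/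
def IsIntegrableComplexStructure
    (I : ∀ x : M, TangentSpace 𝓘(ℝ, V) x →L[ℝ] TangentSpace 𝓘(ℝ, V) x) : Prop :=
  IsInvolutive V V (VectorField.mlieBracket 𝓘(ℝ, V)) (fun x ↦ eigenI (I x).toLinearMap)

end Dolbeault

/-! ### Exact Courant algebroids -/

section Courant

/-- An exact real Courant algebroid on the vector bundle `E` over the manifold `M`.

The bracket on the sheaf of sections of `E` is recorded as an operation on all set-theoretic
sections whose value at a point depends only on the germs of its arguments there (`bracket_congr`);
nothing is required of its values on sections which are not smooth near the point. -/
structure CourantAlgebroid (V : Type*) [NormedAddCommGroup V] [NormedSpace ℝ V]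
    (M : Type*) [TopologicalSpace M] [ChartedSpace V M] [IsManifold 𝓘(ℝ, V) ∞ M]
    (F : Type*) [NormedAddCommGroup F] [NormedSpace ℝ F]
    (E : M → Type*) [TopologicalSpace (TotalSpace F E)] [∀ x, AddCommGroup (E x)]
    [∀ x, Module ℝ (E x)] [∀ x, TopologicalSpace (E x)]
    [∀ x, IsTopologicalAddGroup (E x)] [∀ x, ContinuousSMul ℝ (E x)]
    [FiberBundle F E] [VectorBundle ℝ F E] where
  /-- the projection `π : E → TM` -/
  anchor : ∀ x, E x →L[ℝ] TangentSpace 𝓘(ℝ, V) x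
  /-- the inclusion `ι : T^*M → E` -/
  coanchor : ∀ x, (TangentSpace 𝓘(ℝ, V) x →L[ℝ] ℝ) →L[ℝ] E x
  /-- the symmetric pairing `⟨·, ·⟩` on `E` -/
  pairing : ∀ x, E x →L[ℝ] E x →L[ℝ] ℝ
  /-- the Courant bracket on the sheaf of sections of `E` -/
  bracket : (∀ x, E x) → (∀ x, E x) → ∀ x, E x
  anchor_smooth : ContMDiff 𝓘(ℝ, V) (𝓘(ℝ, V).prod 𝓘(ℝ, F →L[ℝ] V)) ∞
    (fun x ↦ TotalSpace.mk' (F →L[ℝ] V) (E := fun x ↦ E x →L[ℝ] TangentSpace 𝓘(ℝ, V) x)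
      x (anchor x))
  coanchor_smooth : ContMDiff 𝓘(ℝ, V) (𝓘(ℝ, V).prod 𝓘(ℝ, (V →L[ℝ] ℝ) →L[ℝ] F)) ∞
    (fun x ↦ TotalSpace.mk' ((V →L[ℝ] ℝ) →L[ℝ] F)
      (E := fun x ↦ (TangentSpace 𝓘(ℝ, V) x →L[ℝ] ℝ) →L[ℝ] E x) x (coanchor x))
  pairing_smooth : ContMDiff 𝓘(ℝ, V) (𝓘(ℝ, V).prod 𝓘(ℝ, F →L[ℝ] F →L[ℝ] ℝ)) ∞
    (fun x ↦ TotalSpace.mk' (F →L[ℝ] F →L[ℝ] ℝ) (E := fun x ↦ E x →L[ℝ] E x →L[ℝ] ℝ)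
      x (pairing x))
  anchor_surjective : ∀ x, Function.Surjective (anchor x)
  coanchor_injective : ∀ x, Function.Injective (coanchor x)
  exact : ∀ x a, anchor x a = 0 ↔ ∃ ξ, coanchor x ξ = a
  pairing_symm : ∀ x a b, pairing x a b = pairing x b a
  pairing_nondegenerate : ∀ x a, (∀ b, pairing x a b = 0) → a = 0
  pairing_coanchor : ∀ x ξ a, pairing x (coanchor x ξ) a = 2⁻¹ * ξ (anchor x a)
  bracket_congr : ∀ x (a a' b b' : ∀ y, E y), (∀ᶠ y in 𝓝 x, a y = a' y) →
    (∀ᶠ y in 𝓝 x, b y = b' y) →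
    bracket a b x = bracket a' b' x
  /-- Locally there is a splitting `t` of `π` which identifies `E` with `TM ⊕ T^*M` equipped with
  the pairing `⟨X + ξ, Y + η⟩ = (ξ(Y) + η(X)) / 2` and the bracket
  `[X + ξ, Y + η] = [X, Y] + L_X η - i_Y dξ`. -/
  locally_trivial : ∀ x₀ : M, ∃ U : Set M, IsOpen U ∧ x₀ ∈ U ∧
    ∃ t : ∀ x, TangentSpace 𝓘(ℝ, V) x →L[ℝ] E x,
      ContMDiffOn 𝓘(ℝ, V) (𝓘(ℝ, V).prod 𝓘(ℝ, V →L[ℝ] F)) ∞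
        (fun x ↦ TotalSpace.mk' (V →L[ℝ] F) (E := fun x ↦ TangentSpace 𝓘(ℝ, V) x →L[ℝ] E x)
          x (t x)) U ∧
      (∀ x ∈ U, ∀ X, anchor x (t x X) = X) ∧
      (∀ x ∈ U, ∀ X Y ξ η, pairing x (t x X + coanchor x ξ) (t x Y + coanchor x η) =
        2⁻¹ * (ξ Y + η X)) ∧
      ∀ U' ⊆ U, IsOpen U' → ∀ (X Y : ∀ x, TangentSpace 𝓘(ℝ, V) x)
        (ξ η : ∀ x, TangentSpace 𝓘(ℝ, V) x →L[ℝ] ℝ),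
        SmoothSectionOn V V X U' → SmoothSectionOn V V Y U' →
        SmoothSectionOn V (V →L[ℝ] ℝ) ξ U' → SmoothSectionOn V (V →L[ℝ] ℝ) η U' →
        ∀ x ∈ U', bracket (fun y ↦ t y (X y) + coanchor y (ξ y))
            (fun y ↦ t y (Y y) + coanchor y (η y)) x =
          t x (VectorField.mlieBracket 𝓘(ℝ, V) X Y x) +
            coanchor x (lieD X η x - contractD ξ Y x)

variable {V : Type*} [NormedAddCommGroup V] [NormedSpace ℝ V] [FiniteDimensional ℝ V]
  {M : Type*} [TopologicalSpace M] [ChartedSpace V M] [IsManifold 𝓘(ℝ, V) ∞ M]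
  {F : Type*} [NormedAddCommGroup F] [NormedSpace ℝ F]
  {E : M → Type*} [TopologicalSpace (TotalSpace F E)] [∀ x, AddCommGroup (E x)]
  [∀ x, Module ℝ (E x)] [∀ x, TopologicalSpace (E x)]
  [∀ x, IsTopologicalAddGroup (E x)] [∀ x, ContinuousSMul ℝ (E x)]
  [FiberBundle F E] [VectorBundle ℝ F E]

/-- `H` is the `3`-form of the splitting `s` of `π : E → TM`, measuring its failure to be
involutive: `[s(X), s(Y)] = s([X, Y]) + i_X i_Y H`, where `i_X i_Y H = H(Y, X, ·)`. -/
def CourantAlgebroid.IsTorsionForm (𝓔 : CourantAlgebroid V M F E)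
    (s : ∀ x, TangentSpace 𝓘(ℝ, V) x →ₗ[ℝ] E x)
    (H : ∀ x : M, TangentSpace 𝓘(ℝ, V) x [⋀^Fin 3]→L[ℝ] ℝ) : Prop :=
  ∀ U : Set M, IsOpen U → ∀ X Y : ∀ x, TangentSpace 𝓘(ℝ, V) x,
    SmoothSectionOn V V X U → SmoothSectionOn V V Y U →
    ∀ x ∈ U, 𝓔.bracket (fun y ↦ s y (X y)) (fun y ↦ s y (Y y)) x =
      s x (VectorField.mlieBracket 𝓘(ℝ, V) X Y x) +
        𝓔.coanchor x
          ((H x).toContinuousMultilinearMap.toContinuousLinearMap ![Y x, X x, 0] 2)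

/-! ### Almost generalized Kähler structures -/

/-- An almost generalized complex structure: an orthogonal bundle endomorphism `J` of `E` with
`J ^ 2 = -1`. -/
structure AlmostGeneralizedComplex (𝓔 : CourantAlgebroid V M F E) where
  /-- the endomorphism -/
  J : ∀ x, E x →L[ℝ] E x
  smooth : ContMDiff 𝓘(ℝ, V) (𝓘(ℝ, V).prod 𝓘(ℝ, F →L[ℝ] F)) ∞
    (fun x ↦ TotalSpace.mk' (F →L[ℝ] F) (E := fun x ↦ E x →L[ℝ] E x) x (J x))
  sq : ∀ x a, J x (J x a) = -a
  orthogonal : ∀ x a b, 𝓔.pairing x (J x a) (J x b) = 𝓔.pairing x a b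

/-- An almost generalized complex structure is integrable, that is, a generalized complex
structure, when its `+i`-eigenbundle in `E ⊗ ℂ` is involutive for the Courant bracket. -/
def AlmostGeneralizedComplex.IsIntegrable {𝓔 : CourantAlgebroid V M F E}
    (𝓙 : AlmostGeneralizedComplex 𝓔) : Prop :=
  IsInvolutive V F 𝓔.bracket (fun x ↦ eigenI (𝓙.J x).toLinearMap)

/-- An almost generalized Kähler structure: a commuting pair `(J₊, J₋)` of almost generalized
complex structures such that `G(a, b) = ⟨J₊ a, J₋ b⟩` is positive-definite. -/
structure AlmostGeneralizedKahler (𝓔 : CourantAlgebroid V M F E) where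
  /-- the structure `J₊` -/
  plus : AlmostGeneralizedComplex 𝓔
  /-- the structure `J₋` -/
  minus : AlmostGeneralizedComplex 𝓔
  comm : ∀ x a, plus.J x (minus.J x a) = minus.J x (plus.J x a)
  pos : ∀ x a, a ≠ 0 → 0 < 𝓔.pairing x (plus.J x a) (minus.J x a)

namespace AlmostGeneralizedKahler

variable {𝓔 : CourantAlgebroid V M F E} (𝓙 : AlmostGeneralizedKahler 𝓔)

/-- `(J₊, J₋)` is integrable, that is, a generalized Kähler structure, when both `J₊` and `J₋` are
integrable. -/
def IsIntegrable : Prop := 𝓙.plus.IsIntegrable ∧ 𝓙.minus.IsIntegrable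

/-- The generalized metric viewed as the endomorphism `G = -J₊ J₋` of `E`. -/
def G (x : M) : E x →ₗ[ℝ] E x := -((𝓙.plus.J x).toLinearMap ∘ₗ (𝓙.minus.J x).toLinearMap)

/-- The bundles `C₊` (for `ε = 1`) and `C₋` (for `ε = -1`), the `ε`-eigenbundles of `G`. -/
def C (ε : ℤˣ) (x : M) : Submodule ℝ (E x) := Module.End.eigenspace (𝓙.G x) ((ε : ℤ) : ℝ)

lemma mem_C {ε : ℤˣ} {x : M} {a : E x} :
    a ∈ 𝓙.C ε x ↔ 𝓙.G x a = ((ε : ℤ) : ℝ) • a := Module.End.mem_eigenspace_iff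

lemma G_apply (x : M) (a : E x) : 𝓙.G x a = -(𝓙.plus.J x (𝓙.minus.J x a)) := rfl

lemma G_G (x : M) (a : E x) : 𝓙.G x (𝓙.G x a) = a := by
  simp only [G_apply, map_neg, neg_neg]
  rw [← 𝓙.comm, 𝓙.plus.sq, 𝓙.minus.sq, neg_neg]

lemma pairing_J_left (𝓐 : AlmostGeneralizedComplex 𝓔) (x : M) (a b : E x) :
    𝓔.pairing x (𝓐.J x a) b = -𝓔.pairing x a (𝓐.J x b) := by
  rw [← 𝓐.orthogonal x a (𝓐.J x b), 𝓐.sq, map_neg, neg_neg]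

lemma pairing_G (x : M) (a b : E x) :
    𝓔.pairing x a (𝓙.G x b) = 𝓔.pairing x (𝓙.plus.J x a) (𝓙.minus.J x b) := by
  rw [G_apply, map_neg, pairing_J_left]

lemma pairing_G_symm (x : M) (a b : E x) :
    𝓔.pairing x (𝓙.G x a) b = 𝓔.pairing x a (𝓙.G x b) := by
  rw [G_apply, G_apply, map_neg, map_neg, neg_apply, pairing_J_left,
    pairing_J_left, 𝓙.comm, neg_neg]

lemma pairing_G_pos (x : M) (a : E x) (ha : a ≠ 0) : 0 < 𝓔.pairing x a (𝓙.G x a) := by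
  rw [pairing_G]
  exact 𝓙.pos x a ha

lemma unit_sq (ε : ℤˣ) : ((ε : ℤ) : ℝ) * ((ε : ℤ) : ℝ) = 1 := by
  rcases Int.units_eq_one_or ε with rfl | rfl <;> norm_num

lemma coanchor_anchor (x : M) (ξ) : 𝓔.anchor x (𝓔.coanchor x ξ) = 0 := (𝓔.exact x _).2 ⟨ξ, rfl⟩

/-- The projection `π` restricts to an isomorphism from `C_±` to `TM`. -/
lemma anchor_bijective (ε : ℤˣ) (x : M) :
    Function.Bijective ((𝓔.anchor x).toLinearMap ∘ₗ (𝓙.C ε x).subtype) := by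
  have : FiniteDimensional ℝ (TangentSpace 𝓘(ℝ, V) x) := inferInstanceAs (FiniteDimensional ℝ V)
  constructor
  · rw [injective_iff_map_eq_zero]
    rintro ⟨a, ha⟩ h
    change 𝓔.anchor x a = 0 at h
    obtain ⟨ξ, rfl⟩ := (𝓔.exact x a).1 h
    rw [Submodule.mk_eq_zero]
    by_contra hne
    have h1 := 𝓙.pairing_G_pos x _ hne
    rw [𝓙.mem_C.1 ha, map_smul, 𝓔.pairing_coanchor, coanchor_anchor] at h1
    simp at h1
  · let φ : (TangentSpace 𝓘(ℝ, V) x →L[ℝ] ℝ) →ₗ[ℝ] TangentSpace 𝓘(ℝ, V) x :=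
      (𝓔.anchor x).toLinearMap ∘ₗ 𝓙.G x ∘ₗ (𝓔.coanchor x).toLinearMap
    have hφ : Function.Injective φ := by
      rw [injective_iff_map_eq_zero]
      intro ξ hξ
      change 𝓔.anchor x (𝓙.G x (𝓔.coanchor x ξ)) = 0 at hξ
      by_contra hne
      have h0 : 𝓔.coanchor x ξ ≠ 0 := fun h ↦ hne (𝓔.coanchor_injective x (by simpa using h))
      have h1 := 𝓙.pairing_G_pos x _ h0
      rw [𝓔.pairing_coanchor, hξ] at h1
      simp at h1
    have hdim : Module.finrank ℝ (TangentSpace 𝓘(ℝ, V) x →L[ℝ] ℝ) =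
        Module.finrank ℝ (TangentSpace 𝓘(ℝ, V) x) := by
      change Module.finrank ℝ (V →L[ℝ] ℝ) = Module.finrank ℝ V
      rw [← (LinearMap.toContinuousLinearMap (𝕜 := ℝ) (E := V) (F' := ℝ)).finrank_eq]
      exact Subspace.dual_finrank_eq
    have : FiniteDimensional ℝ (TangentSpace 𝓘(ℝ, V) x →L[ℝ] ℝ) :=
      inferInstanceAs (FiniteDimensional ℝ (V →L[ℝ] ℝ))
    have hs := (LinearMap.injective_iff_surjective_of_finrank_eq_finrank hdim).1 hφ
    intro X
    obtain ⟨ξ, hξ⟩ := hs X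
    refine ⟨⟨𝓙.G x (𝓔.coanchor x ξ) + ((ε : ℤ) : ℝ) • 𝓔.coanchor x ξ, ?_⟩, ?_⟩
    · rw [𝓙.mem_C, map_add, map_smul, G_G, smul_add, smul_smul, unit_sq, one_smul, add_comm]
    · change 𝓔.anchor x (𝓙.G x (𝓔.coanchor x ξ) + ((ε : ℤ) : ℝ) • 𝓔.coanchor x ξ) = X
      rw [map_add, map_smul, coanchor_anchor, smul_zero, add_zero]
      exact hξ

/-- The splittings `s₊`, `s₋` of `π` with images `C₊`, `C₋`, the inverses of `π|_{C_±}`. -/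
def sC (ε : ℤˣ) (x : M) : TangentSpace 𝓘(ℝ, V) x →ₗ[ℝ] E x :=
  (𝓙.C ε x).subtype ∘ₗ (LinearEquiv.ofBijective _ (𝓙.anchor_bijective ε x)).symm.toLinearMap

/-- The isotropic splitting `s = (s₊ + s₋) / 2`. -/
def s (x : M) : TangentSpace 𝓘(ℝ, V) x →ₗ[ℝ] E x :=
  (2⁻¹ : ℝ) • (𝓙.sC 1 x + 𝓙.sC (-1) x)

/-- The Riemannian metric `g(X, Y) = ⟨s₊ X, s₊ Y⟩`. -/
def g (x : M) (X Y : TangentSpace 𝓘(ℝ, V) x) : ℝ :=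
  𝓔.pairing x (𝓙.sC 1 x X) (𝓙.sC 1 x Y)

/-- The almost complex structures `I₊`, `I₋` on `M`, obtained by transporting `J₊|_{C_±}` to `TM`
along `s_±`. -/
def I (ε : ℤˣ) (x : M) : TangentSpace 𝓘(ℝ, V) x →L[ℝ] TangentSpace 𝓘(ℝ, V) x :=
  haveI : FiniteDimensional ℝ (TangentSpace 𝓘(ℝ, V) x) := inferInstanceAs (FiniteDimensional ℝ V)
  haveI : T2Space (TangentSpace 𝓘(ℝ, V) x) := inferInstanceAs (T2Space V)
  LinearMap.toContinuousLinearMap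
    ((𝓔.anchor x).toLinearMap ∘ₗ (𝓙.plus.J x).toLinearMap ∘ₗ 𝓙.sC ε x)

lemma sC_mem (ε : ℤˣ) (x : M) (X) : 𝓙.sC ε x X ∈ 𝓙.C ε x :=
  ((LinearEquiv.ofBijective _ (𝓙.anchor_bijective ε x)).symm X).2

lemma anchor_sC (ε : ℤˣ) (x : M) (X) : 𝓔.anchor x (𝓙.sC ε x X) = X :=
  (LinearEquiv.ofBijective _ (𝓙.anchor_bijective ε x)).apply_symm_apply X

lemma sC_anchor {ε : ℤˣ} {x : M} {a : E x} (ha : a ∈ 𝓙.C ε x) :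
    𝓙.sC ε x (𝓔.anchor x a) = a :=
  congrArg Subtype.val
    ((LinearEquiv.ofBijective _ (𝓙.anchor_bijective ε x)).symm_apply_apply ⟨a, ha⟩)

lemma J_mem_C {ε : ℤˣ} {x : M} {a : E x} (ha : a ∈ 𝓙.C ε x) : 𝓙.plus.J x a ∈ 𝓙.C ε x := by
  rw [mem_C] at ha ⊢
  rw [← map_smul, ← ha, G_apply, G_apply, map_neg, 𝓙.comm, 𝓙.comm,
    𝓙.comm]

lemma sC_I (ε : ℤˣ) (x : M) (X) : 𝓙.sC ε x (𝓙.I ε x X) = 𝓙.plus.J x (𝓙.sC ε x X) :=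
  𝓙.sC_anchor (𝓙.J_mem_C (𝓙.sC_mem ε x X))

lemma pairing_sC_sC (x : M) (X Y) : 𝓔.pairing x (𝓙.sC 1 x X) (𝓙.sC (-1) x Y) = 0 := by
  have h := 𝓙.pairing_G_symm x (𝓙.sC 1 x X) (𝓙.sC (-1) x Y)
  rw [𝓙.mem_C.1 (𝓙.sC_mem 1 x X), 𝓙.mem_C.1 (𝓙.sC_mem (-1) x Y)] at h
  simp only [map_smul, smul_apply, smul_eq_mul] at h
  push_cast at h
  linarith

lemma g_eq (ε : ℤˣ) (x : M) (X Y) :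
    𝓙.g x X Y = ((ε : ℤ) : ℝ) * 𝓔.pairing x (𝓙.sC ε x X) (𝓙.sC ε x Y) := by
  rcases Int.units_eq_one_or ε with rfl | rfl
  · simp [g]
  · have key : ∀ Z, ∃ ξ, 𝓙.sC 1 x Z = 𝓙.sC (-1) x Z + 𝓔.coanchor x ξ := by
      intro Z
      obtain ⟨ξ, hξ⟩ := (𝓔.exact x (𝓙.sC 1 x Z - 𝓙.sC (-1) x Z)).1
        (by rw [map_sub, anchor_sC, anchor_sC, sub_self])
      exact ⟨ξ, by rw [hξ]; abel⟩
    obtain ⟨ξ, hξ⟩ := key Y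
    have h1 : 𝓙.g x X Y = 2⁻¹ * ξ X := by
      rw [g, hξ, map_add, pairing_sC_sC, zero_add, 𝓔.pairing_symm, 𝓔.pairing_coanchor, anchor_sC]
    have h2 : 𝓔.pairing x (𝓙.sC (-1) x X) (𝓙.sC (-1) x Y) = -(2⁻¹ * ξ X) := by
      have h3 : 𝓙.sC (-1) x Y = 𝓙.sC 1 x Y - 𝓔.coanchor x ξ := by rw [hξ]; abel
      rw [h3, map_sub, 𝓔.pairing_symm x (𝓙.sC (-1) x X) (𝓙.sC 1 x Y), pairing_sC_sC, zero_sub,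
        𝓔.pairing_symm, 𝓔.pairing_coanchor, anchor_sC]
    rw [h1, h2]
    simp

lemma g_I_self (ε : ℤˣ) (x : M) (X) : 𝓙.g x (𝓙.I ε x X) X = 0 := by
  rw [𝓙.g_eq ε, sC_I]
  have h := pairing_J_left 𝓙.plus x (𝓙.sC ε x X) (𝓙.sC ε x X)
  rw [𝓔.pairing_symm x (𝓙.sC ε x X)] at h
  have h0 : 𝓔.pairing x (𝓙.plus.J x (𝓙.sC ε x X)) (𝓙.sC ε x X) = 0 := by linarith
  rw [h0, mul_zero]

/-- The `2`-forms `ω_± = g I_±`, that is, `ω_±(X, Y) = g(I_± X, Y)`. -/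
def omega (ε : ℤˣ) (x : M) : TangentSpace 𝓘(ℝ, V) x [⋀^Fin 2]→L[ℝ] ℝ where
  toFun v := 𝓙.g x (𝓙.I ε x (v 0)) (v 1)
  map_update_add' := by
    intro _ v i X Y
    fin_cases i <;> simp [g]
  map_update_smul' := by
    intro _ v i c X
    fin_cases i <;> simp [g]
  cont := by
    have : FiniteDimensional ℝ (TangentSpace 𝓘(ℝ, V) x) := inferInstanceAs (FiniteDimensional ℝ V)
    have : T2Space (TangentSpace 𝓘(ℝ, V) x) := inferInstanceAs (T2Space V)
    let B : TangentSpace 𝓘(ℝ, V) x →ₗ[ℝ] TangentSpace 𝓘(ℝ, V) x →ₗ[ℝ] ℝ :=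
      LinearMap.mk₂ ℝ (fun X Y ↦ 𝓙.g x (𝓙.I ε x X) Y)
        (by intro a b c; simp [g]) (by intro c a b; simp [g]) (by intro a b c; simp [g])
        (by intro c a b; simp [g])
    let B' : V →L[ℝ] V →L[ℝ] ℝ := LinearMap.toContinuousBilinearMap (𝕜 := ℝ) (E := V) (F := V) B
    change Continuous fun v : Fin 2 → V ↦ B' (v 0) (v 1)
    fun_prop
  map_eq_zero_of_eq' := by
    intro v i j hv hij
    have h01 : v 0 = v 1 := by
      fin_cases i <;> fin_cases j <;> simp_all
    rw [h01]
    exact 𝓙.g_I_self ε x (v 1)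

end AlmostGeneralizedKahler

end Courant

end GenKahler

end

set_option linter.unusedSectionVars false

noncomputable section

namespace GenKahler

/-! ### Complexified eigenspaces and Nijenhuis tensors -/

section ComplexLinear

variable {W : Type*} [AddCommGroup W] [Module ℝ W]

/-! A section of the `+i`-eigenbundle of `J` has the form `J b + i b`, so involutivity of that
bundle is the vanishing of the Nijenhuis operator `N_J` of the bracket (`isInvolutive_eigenI_iff`).
The proof rewrites `N_J = 0` on vector fields by means of the identity `s_ε = s + ε g`, where `ε =
±1` (`sC_eq`).

Over a local splitting `t` one has `s = t + B` for a 2-form `B`, and the standard bracket in the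
splitting `t` becomes the bracket twisted by `dB` in the splitting `s`. Hence `H = -dB`. It does not
depend on `t` because the bracket does not, and it is smooth and closed because it is locally exact.
The same computation gives `2⟨[s_ε X, s_δ Y], s_γ Z⟩` in terms of `g`, `H` and Lie brackets
(`two_mul_pairing_bracket`).

The expression `⟨N_J(s_ε X, s_δ Y), s_γ Z⟩` is skew when two arguments are exchanged together with
their signs, so only the sign patterns `(ε, ε, ε)` and `(ε, ε, -ε)` matter
(`isIntegrable_iff_nijenhuisForm`). Since `J₋ = ε J₊` on `C_ε`, the first pattern is the same for
both structures, while in the second the terms involving `J Z` change sign. Both structures are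
therefore integrable exactly when the first pattern and `mixedForm` vanish
(`isIntegrable_iff_mixedForm`). Modulo `mixedForm`, the first pattern is `2 ε g(Z, N_I(X, Y))`, with
`N_I` the Nijenhuis tensor of `I_ε` (`nijenhuisForm_self`).

By Koszul's formula `bracketForm ε ε (-ε)` equals `2 ε g(∇_Z X, Y) - H(X, Y, Z)` with `∇` the
Levi-Civita connection, so `mixedForm ε = 0` says that `I_ε` is parallel for `∇ - (ε/2) g⁻¹H`. The
proof uses no connection: when `N_I = 0`, `mixedForm_eq` turns this condition into a linear relation
between `dω_ε` and `H`. As `dω_ε` then has no `(3,0)`- or `(0,3)`-part, the relation can be solved: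
`H = -ε dω_ε(I·, I·, I·) = ε d^c ω_ε` (`forall_add_eq_iff`, `typePart_three_sub`). -/

lemma cplx_inj {a b c d : W} : cplx a b = cplx c d ↔ a = c ∧ b = d := by
  refine ⟨fun h ↦ ?_, fun h ↦ by rw [h.1, h.2]⟩
  -- Contract the factor `ℂ` with a real functional; the real and imaginary parts then recover the
  -- two components.
  have key : ∀ f : ℂ →ₗ[ℝ] ℝ, f 1 • a + f Complex.I • b = f 1 • c + f Complex.I • d := by
    intro f
    have := congrArg (fun z ↦ TensorProduct.lid ℝ W (LinearMap.rTensor W f z)) h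
    simpa [cplx] using this
  exact ⟨by simpa using key Complex.reLm, by simpa using key Complex.imLm⟩

/-- The eigenvalue equation `J a + i J b = i (a + i b)` has two components, `J a = -b` and `J b =
a`. The second implies the first because `J² = -1`. -/
lemma cplx_mem_eigenI {J : W →ₗ[ℝ] W} (hJ : ∀ a, J (J a) = -a) {a b : W} :
    cplx a b ∈ eigenI J ↔ J b = a := by
  have h1 : J.baseChange ℂ (cplx a b) = cplx (J a) (J b) := by simp [cplx]
  have h2 : Complex.I • cplx a b = cplx (-b) a := by
    simp only [cplx, smul_add, TensorProduct.smul_tmul', smul_eq_mul, mul_one, Complex.I_mul_I,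
      TensorProduct.neg_tmul, TensorProduct.tmul_neg]
    abel
  rw [eigenI, Module.End.mem_eigenspace_iff, h1, h2, cplx_inj]
  refine ⟨fun h ↦ h.2, fun h ↦ ⟨?_, h⟩⟩
  rw [← h, hJ]

end ComplexLinear

section Nijenhuis

variable {V : Type*} [NormedAddCommGroup V] [NormedSpace ℝ V]
  {M : Type*} [TopologicalSpace M] [ChartedSpace V M]
  (F : Type*) [NormedAddCommGroup F] [NormedSpace ℝ F]
  {E : M → Type*} [TopologicalSpace (TotalSpace F E)] [∀ x, AddCommGroup (E x)]
  [∀ x, Module ℝ (E x)] [∀ x, TopologicalSpace (E x)] [FiberBundle F E]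

/-- The Nijenhuis expression `[a, c] - [J a, J c] + J ([J a, c] + [a, J c])` of an endomorphism `J`
with respect to a bracket `br`. -/
def nijenhuis (br : (∀ x, E x) → (∀ x, E x) → ∀ x, E x) (J : ∀ x, E x →ₗ[ℝ] E x)
    (a c : ∀ x, E x) (x : M) : E x :=
  br a c x - br (fun y ↦ J y (a y)) (fun y ↦ J y (c y)) x +
    J x (br (fun y ↦ J y (a y)) c x + br a (fun y ↦ J y (c y)) x)

/-- The real and imaginary parts of `[J a + i a, J c + i c]` are `[J a, J c] - [a, c]` and `[J a, c]
+ [a, J c]`; membership in the eigenbundle is one equation between them, namely `N_J(a, c) = 0`.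
Locality of the bracket permits replacing a section known to be `J b` only on `U` by `J b` itself.
-/
lemma isInvolutive_eigenI_iff {br : (∀ x, E x) → (∀ x, E x) → ∀ x, E x}
    (hbr : ∀ x (a a' b b' : ∀ y, E y), (∀ᶠ y in 𝓝 x, a y = a' y) →
      (∀ᶠ y in 𝓝 x, b y = b' y) → br a b x = br a' b' x)
    {J : ∀ x, E x →ₗ[ℝ] E x} (hJ : ∀ x a, J x (J x a) = -a)
    (hs : ∀ U : Set M, IsOpen U → ∀ a : ∀ x, E x, SmoothSectionOn V F a U →
      SmoothSectionOn V F (fun x ↦ J x (a x)) U) :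
    IsInvolutive V F br (fun x ↦ eigenI (J x)) ↔
      ∀ U : Set M, IsOpen U → ∀ a c : ∀ x, E x, SmoothSectionOn V F a U →
        SmoothSectionOn V F c U → ∀ x ∈ U, nijenhuis br J a c x = 0 := by
  constructor
  · intro h U hU a c ha hc x hx
    have := h U hU _ a _ c (hs U hU a ha) ha (hs U hU c hc) hc
      (fun y _ ↦ (cplx_mem_eigenI (hJ y)).2 rfl) (fun y _ ↦ (cplx_mem_eigenI (hJ y)).2 rfl) x hx
    rw [cplx_mem_eigenI (hJ x)] at this
    rw [nijenhuis, this]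
    abel
  · intro h U hU a b c d ha hb hc hd hab hcd x hx
    have h1 : ∀ y ∈ U, a y = J y (b y) := fun y hy ↦ ((cplx_mem_eigenI (hJ y)).1 (hab y hy)).symm
    have h2 : ∀ y ∈ U, c y = J y (d y) := fun y hy ↦ ((cplx_mem_eigenI (hJ y)).1 (hcd y hy)).symm
    have e1 : ∀ᶠ y in 𝓝 x, a y = J y (b y) := Filter.eventually_of_mem (hU.mem_nhds hx) h1
    have e2 : ∀ᶠ y in 𝓝 x, c y = J y (d y) := Filter.eventually_of_mem (hU.mem_nhds hx) h2
    have e3 : ∀ e : ∀ y, E y, ∀ᶠ y in 𝓝 x, e y = e y := fun _ ↦ Filter.Eventually.of_forall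
      fun _ ↦ rfl
    have := h U hU b d hb hd x hx
    rw [nijenhuis] at this
    rw [cplx_mem_eigenI (hJ x), hbr x _ _ _ _ e1 e2, hbr x _ _ _ _ e1 (e3 d),
      hbr x _ _ _ _ (e3 b) e2]
    rw [← sub_eq_zero, ← this]
    abel

end Nijenhuis

/-! ### Smooth functions and vector fields -/

section VectorFields

variable {V : Type*} [NormedAddCommGroup V] [NormedSpace ℝ V] [FiniteDimensional ℝ V]
  {M : Type*} [TopologicalSpace M] [ChartedSpace V M] [IsManifold 𝓘(ℝ, V) ∞ M]
  {X Y Z : ∀ x : M, TangentSpace 𝓘(ℝ, V) x} {U : Set M}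

variable (V) in
/-- `f` is a smooth real function on `U`. -/
def SmoothFunOn (f : M → ℝ) (U : Set M) : Prop := ContMDiffOn 𝓘(ℝ, V) 𝓘(ℝ, ℝ) ∞ f U

lemma SmoothFunOn.mdifferentiableAt {f : M → ℝ} (hf : SmoothFunOn V f U) (hU : IsOpen U) {x : M}
    (hx : x ∈ U) : MDifferentiableAt 𝓘(ℝ, V) 𝓘(ℝ, ℝ) f x :=
  (hf.contMDiffAt (hU.mem_nhds hx)).mdifferentiableAt (by simp)

lemma SmoothSectionOn.mdifferentiableAt (hX : SmoothSectionOn V V X U) (hU : IsOpen U) {x : M}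
    (hx : x ∈ U) : MDifferentiableAt 𝓘(ℝ, V) (𝓘(ℝ, V).prod 𝓘(ℝ, V))
      (fun x ↦ TotalSpace.mk' V (E := TangentSpace 𝓘(ℝ, V)) x (X x)) x :=
  (hX.contMDiffAt (hU.mem_nhds hx)).mdifferentiableAt (by simp)

lemma SmoothSectionOn.mlieBracket (hU : IsOpen U) (hX : SmoothSectionOn V V X U)
    (hY : SmoothSectionOn V V Y U) :
    SmoothSectionOn V V (VectorField.mlieBracket 𝓘(ℝ, V) X Y) U := by
  intro x hx
  have : IsManifold 𝓘(ℝ, V) (((⊤ : ℕ∞) : WithTop ℕ∞) + 1) M := by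
    simpa using (inferInstance : IsManifold 𝓘(ℝ, V) ∞ M)
  have : IsManifold 𝓘(ℝ, V) (minSmoothness ℝ 2) M := by
    rw [minSmoothness_of_isRCLikeNormedField]
    infer_instance
  exact (ContMDiffAt.mlieBracket_vectorField (m := ⊤) (n := ⊤) (hX.contMDiffAt (hU.mem_nhds hx))
    (hY.contMDiffAt (hU.mem_nhds hx)) (by simp)).contMDiffWithinAt

/-- The derivative `X f` of a function along a vector field. -/
def dirD (X : ∀ x : M, TangentSpace 𝓘(ℝ, V) x) (f : M → ℝ) (x : M) : ℝ :=
  mvfderiv 𝓘(ℝ, V) f x (X x)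

/-- The constant vector field `v` in the chart at `x₀`. -/
def coordField (x₀ : M) (v : V) (x : M) : TangentSpace 𝓘(ℝ, V) x :=
  (trivializationAt V (TangentSpace 𝓘(ℝ, V)) x₀).symmL ℝ x v

lemma smooth_coordField (x₀ : M) (v : V) :
    SmoothSectionOn V V (coordField x₀ v) (chartAt V x₀).source := by
  have h := (trivializationAt V (TangentSpace 𝓘(ℝ, V)) x₀).contMDiffOn_symmL (n := ∞)
    (IB := 𝓘(ℝ, V)) (𝕜 := ℝ)
  have hv : ContMDiffOn 𝓘(ℝ, V) (𝓘(ℝ, V).prod 𝓘(ℝ, V)) ∞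
      (fun x ↦ TotalSpace.mk' V (E := Bundle.Trivial M V) x v) (chartAt V x₀).source := by
    intro x _
    rw [Bundle.contMDiffWithinAt_section]
    exact contMDiffWithinAt_const
  exact ContMDiffOn.clm_bundle_apply (E₁ := Bundle.Trivial M V) h hv

lemma coordField_self (x₀ : M) (v : V) : coordField x₀ v x₀ = v := by
  rw [coordField, TangentBundle.symmL_trivializationAt_eq_core (by simp)]
  exact (tangentBundleCore 𝓘(ℝ, V) M).coordChange_self (achart V x₀) x₀ (mem_chart_source V x₀) v

end VectorFields

/-! ### The exterior derivative of a smooth form -/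

section Exterior

variable {V : Type*} [NormedAddCommGroup V] [NormedSpace ℝ V] [FiniteDimensional ℝ V]
  {M : Type*} [TopologicalSpace M] [ChartedSpace V M] [IsManifold 𝓘(ℝ, V) ∞ M] {U : Set M}

/-- A form is smooth on `U` when it takes smooth values on vector fields smooth on open subsets of
`U`. -/
def SmoothFormOn {k : ℕ} (α : ∀ x : M, TangentSpace 𝓘(ℝ, V) x [⋀^Fin k]→L[ℝ] ℝ)
    (U : Set M) : Prop :=
  ∀ U' ⊆ U, IsOpen U' → ∀ X : Fin k → ∀ x : M, TangentSpace 𝓘(ℝ, V) x,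
    (∀ i, SmoothSectionOn V V (X i) U') → SmoothFunOn V (fun x ↦ α x (fun i ↦ X i x)) U'

/-- The representation of a form in the chart at `x₀`. -/
def chartForm {A : Type*} [NormedAddCommGroup A] [NormedSpace ℝ A] {k : ℕ}
    (α : ∀ x : M, TangentSpace 𝓘(ℝ, V) x [⋀^Fin k]→L[ℝ] A) (x₀ : M) (y : V) :
    V [⋀^Fin k]→L[ℝ] A :=
  (α ((extChartAt 𝓘(ℝ, V) x₀).symm y)).compContinuousLinearMap
    (mfderiv 𝓘(ℝ, V) 𝓘(ℝ, V) (extChartAt 𝓘(ℝ, V) x₀).symm y)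

lemma finiteDimensional_alternating (k : ℕ) : FiniteDimensional ℝ (V [⋀^Fin k]→L[ℝ] ℝ) := by
  let b := Module.finBasis ℝ V
  let L : (V [⋀^Fin k]→L[ℝ] ℝ) →ₗ[ℝ] ((Fin k → Fin (Module.finrank ℝ V)) → ℝ) :=
    { toFun := fun α v ↦ α (fun i ↦ b (v i))
      map_add' := fun _ _ ↦ rfl
      map_smul' := fun _ _ ↦ rfl }
  refine FiniteDimensional.of_injective L fun α β h ↦ ?_
  apply ContinuousAlternatingMap.toAlternatingMap_injective
  apply AlternatingMap.coe_multilinearMap_injective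
  exact Module.Basis.ext_multilinear (fun _ ↦ b) fun v ↦ congrFun h v

/-- Evaluation on tuples of basis vectors embeds the alternating forms in a finite-dimensional space
of functions. A linear left inverse of this embedding recovers `f` smoothly from its evaluations. -/
lemma contDiffAt_alternating {k : ℕ} {f : V → V [⋀^Fin k]→L[ℝ] ℝ} {y : V}
    (hf : ∀ v : Fin k → V, ContDiffAt ℝ ∞ (fun z ↦ f z v) y) : ContDiffAt ℝ ∞ f y := by
  have := finiteDimensional_alternating (V := V) k
  let b := Module.finBasis ℝ V
  let L : (V [⋀^Fin k]→L[ℝ] ℝ) →ₗ[ℝ] ((Fin k → Fin (Module.finrank ℝ V)) → ℝ) :=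
    { toFun := fun α v ↦ α (fun i ↦ b (v i))
      map_add' := fun _ _ ↦ rfl
      map_smul' := fun _ _ ↦ rfl }
  have hL : LinearMap.ker L = ⊥ := LinearMap.ker_eq_bot.2 fun α β h ↦ by
    apply ContinuousAlternatingMap.toAlternatingMap_injective
    apply AlternatingMap.coe_multilinearMap_injective
    exact Module.Basis.ext_multilinear (fun _ ↦ b) fun v ↦ congrFun h v
  obtain ⟨g, hg⟩ := L.exists_leftInverse_of_injective hL
  have h1 : ContDiffAt ℝ ∞ (fun z ↦ L (f z)) y := contDiffAt_pi.2 fun v ↦ hf _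
  have h2 : ContDiffAt ℝ ∞ (fun z ↦ LinearMap.toContinuousLinearMap g (L (f z))) y :=
    (LinearMap.toContinuousLinearMap g).contDiff.contDiffAt.comp y h1
  have h3 : (fun z ↦ LinearMap.toContinuousLinearMap g (L (f z))) = f :=
    funext fun z ↦ LinearMap.congr_fun hg (f z)
  rwa [h3] at h2

/-- Constant vectors in the chart correspond to smooth fields on `M`, so `SmoothFormOn`, which
speaks only of fields, controls the chart representative of a form. -/
lemma mfderiv_extChartAt_symm_eq_coordField (x₀ : M) {y : V}
    (hy : y ∈ (extChartAt 𝓘(ℝ, V) x₀).target) (v : V) :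
    mfderiv 𝓘(ℝ, V) 𝓘(ℝ, V) (extChartAt 𝓘(ℝ, V) x₀).symm y v =
      coordField x₀ v ((extChartAt 𝓘(ℝ, V) x₀).symm y) := by
  have h : (extChartAt 𝓘(ℝ, V) x₀).symm y ∈ (chartAt V x₀).source := by
    rw [← extChartAt_source 𝓘(ℝ, V)]
    exact (extChartAt 𝓘(ℝ, V) x₀).map_target hy
  rw [coordField, TangentBundle.symmL_trivializationAt h, PartialEquiv.right_inv _ hy]
  simp only [modelWithCornersSelf_coe, range_id, mfderivWithin_univ]
  rfl

lemma contDiffAt_comp_extChartAt_symm {A : Type*} [NormedAddCommGroup A] [NormedSpace ℝ A]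
    {f : M → A} (hU : IsOpen U) (hf : ContMDiffOn 𝓘(ℝ, V) 𝓘(ℝ, A) ∞ f U) (x₀ : M) {y : V}
    (hy : y ∈ (extChartAt 𝓘(ℝ, V) x₀).target) (hyU : (extChartAt 𝓘(ℝ, V) x₀).symm y ∈ U) :
    ContDiffAt ℝ ∞ (fun z ↦ f ((extChartAt 𝓘(ℝ, V) x₀).symm z)) y := by
  rw [← contMDiffAt_iff_contDiffAt]
  exact (hf.contMDiffAt (hU.mem_nhds hyU)).comp y
    ((contMDiffOn_extChartAt_symm x₀).contMDiffAt ((isOpen_extChartAt_target x₀).mem_nhds hy))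

lemma contDiffAt_chartForm {k : ℕ} {α : ∀ x : M, TangentSpace 𝓘(ℝ, V) x [⋀^Fin k]→L[ℝ] ℝ}
    (hU : IsOpen U) (hα : SmoothFormOn α U) (x₀ : M) {y : V}
    (hy : y ∈ (extChartAt 𝓘(ℝ, V) x₀).target) (hyU : (extChartAt 𝓘(ℝ, V) x₀).symm y ∈ U) :
    ContDiffAt ℝ ∞ (chartForm α x₀) y := by
  refine contDiffAt_alternating fun v ↦ ?_
  have hV : IsOpen (U ∩ (chartAt V x₀).source) := hU.inter (chartAt V x₀).open_source
  have h1 := hα _ inter_subset_left hV (fun i ↦ coordField x₀ (v i))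
    fun i ↦ (smooth_coordField x₀ (v i)).mono inter_subset_right
  have hy' : (extChartAt 𝓘(ℝ, V) x₀).symm y ∈ (chartAt V x₀).source := by
    rw [← extChartAt_source 𝓘(ℝ, V)]
    exact (extChartAt 𝓘(ℝ, V) x₀).map_target hy
  refine (contDiffAt_comp_extChartAt_symm hV h1 x₀ hy ⟨hyU, hy'⟩).congr_of_eventuallyEq ?_
  filter_upwards [(isOpen_extChartAt_target x₀).mem_nhds hy] with z hz
  change α _ _ = α _ _
  congr 1
  funext i
  exact mfderiv_extChartAt_symm_eq_coordField x₀ hz (v i)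

/-- The representation of a vector field in the chart at `x₀`. -/
def chartField (X : ∀ x : M, TangentSpace 𝓘(ℝ, V) x) (x₀ : M) (y : V) : V :=
  VectorField.mpullbackWithin 𝓘(ℝ, V) 𝓘(ℝ, V) (extChartAt 𝓘(ℝ, V) x₀).symm X
    (range 𝓘(ℝ, V)) y

lemma differentiableAt_chartField {X : ∀ x : M, TangentSpace 𝓘(ℝ, V) x} (hU : IsOpen U)
    (hX : SmoothSectionOn V V X U) {x₀ : M} (hx₀ : x₀ ∈ U) :
    DifferentiableAt ℝ (chartField X x₀) (extChartAt 𝓘(ℝ, V) x₀ x₀) := by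
  have h : DifferentiableWithinAt ℝ (chartField X x₀)
      ((extChartAt 𝓘(ℝ, V) x₀).symm ⁻¹' univ ∩ range 𝓘(ℝ, V)) (extChartAt 𝓘(ℝ, V) x₀ x₀) :=
    MDifferentiableWithinAt.differentiableWithinAt_mpullbackWithin_vectorField
      (s := univ) (hX.mdifferentiableAt hU hx₀).mdifferentiableWithinAt
  rwa [preimage_univ, univ_inter, modelWithCornersSelf_coe, range_id,
    differentiableWithinAt_univ] at h

lemma mfderiv_chartField (X : ∀ x : M, TangentSpace 𝓘(ℝ, V) x) (x₀ : M) {y : V}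
    (hy : y ∈ (extChartAt 𝓘(ℝ, V) x₀).target) :
    mfderiv 𝓘(ℝ, V) 𝓘(ℝ, V) (extChartAt 𝓘(ℝ, V) x₀).symm y (chartField (V := V) X x₀ y) =
      X ((extChartAt 𝓘(ℝ, V) x₀).symm y) := by
  have key : ∀ A : V →L[ℝ] V, A.IsInvertible → ∀ w, A (A.inverse w) = w :=
    fun A hA w ↦ hA.self_apply_inverse w
  rw [← mfderivWithin_univ, ← range_id, ← modelWithCornersSelf_coe ℝ V]
  exact key _ (isInvertible_mfderivWithin_extChartAt_symm hy) _

lemma chartField_self (X : ∀ x : M, TangentSpace 𝓘(ℝ, V) x) (x₀ : M) :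
    chartField X x₀ (extChartAt 𝓘(ℝ, V) x₀ x₀) = X x₀ := by
  let A : V →L[ℝ] V := mfderivWithin 𝓘(ℝ, V) 𝓘(ℝ, V) (extChartAt 𝓘(ℝ, V) x₀).symm
    (range 𝓘(ℝ, V)) (extChartAt 𝓘(ℝ, V) x₀ x₀)
  -- The tangent space at `x₀` is modelled on `V` by the preferred chart at `x₀`, so the derivative
  -- of that chart is the identity at the base point.
  have hA : A = ContinuousLinearMap.id ℝ V := mfderivWithin_range_extChartAt_symm
  have hX : ∀ y, y = x₀ → (X y : V) = X x₀ := by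
    rintro _ rfl
    rfl
  change A.inverse (X ((extChartAt 𝓘(ℝ, V) x₀).symm (extChartAt 𝓘(ℝ, V) x₀ x₀)) : V) = X x₀
  rw [hA, ContinuousLinearMap.inverse_id]
  exact hX _ (extChartAt_to_inv x₀)

lemma mlieBracket_eq_chart (X Y : ∀ x : M, TangentSpace 𝓘(ℝ, V) x) (x₀ : M) :
    VectorField.mlieBracket 𝓘(ℝ, V) X Y x₀ =
      VectorField.lieBracket ℝ (chartField X x₀) (chartField Y x₀)
        (extChartAt 𝓘(ℝ, V) x₀ x₀) := by
  let A : V →L[ℝ] V := mfderiv 𝓘(ℝ, V) 𝓘(ℝ, V) (extChartAt 𝓘(ℝ, V) x₀) x₀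
  have hA : A = ContinuousLinearMap.id ℝ V := mfderiv_extChartAt_self
  rw [← VectorField.mlieBracketWithin_univ]
  change A.inverse (VectorField.lieBracketWithin ℝ (chartField X x₀) (chartField Y x₀)
    ((extChartAt 𝓘(ℝ, V) x₀).symm ⁻¹' univ ∩ range 𝓘(ℝ, V)) (extChartAt 𝓘(ℝ, V) x₀ x₀)) = _
  rw [hA, ContinuousLinearMap.inverse_id, ContinuousLinearMap.id_apply, preimage_univ, univ_inter,
    modelWithCornersSelf_coe, range_id, VectorField.lieBracketWithin_univ]

lemma dirD_eq_chart (X : ∀ x : M, TangentSpace 𝓘(ℝ, V) x) {f : M → ℝ} {x₀ : M}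
    (hf : MDifferentiableAt 𝓘(ℝ, V) 𝓘(ℝ, ℝ) f x₀) :
    dirD X f x₀ = fderiv ℝ (fun y ↦ f ((extChartAt 𝓘(ℝ, V) x₀).symm y))
        (extChartAt 𝓘(ℝ, V) x₀ x₀) (X x₀) := by
  let A : V →L[ℝ] ℝ := mfderiv 𝓘(ℝ, V) 𝓘(ℝ, ℝ) f x₀
  have hA : A = fderivWithin ℝ (fun y ↦ f ((extChartAt 𝓘(ℝ, V) x₀).symm y))
      (range 𝓘(ℝ, V)) (extChartAt 𝓘(ℝ, V) x₀ x₀) := MDifferentiableAt.mfderiv hf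
  change A (X x₀) = _
  rw [hA, modelWithCornersSelf_coe, range_id, fderivWithin_univ]

lemma extD_eq_chart {A : Type*} [NormedAddCommGroup A] [NormedSpace ℝ A] {k : ℕ}
    (α : ∀ x : M, TangentSpace 𝓘(ℝ, V) x [⋀^Fin k]→L[ℝ] A) (x₀ : M) :
    extD α x₀ = extDeriv (chartForm α x₀) (extChartAt 𝓘(ℝ, V) x₀ x₀) := by
  ext v
  change extDeriv (chartForm α x₀) (extChartAt 𝓘(ℝ, V) x₀ x₀)
    (fun i ↦ mfderiv 𝓘(ℝ, V) 𝓘(ℝ, V) (extChartAt 𝓘(ℝ, V) x₀) x₀ (v i)) = _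
  rw [mfderiv_extChartAt_self]
  rfl

lemma chartForm_self {A : Type*} [NormedAddCommGroup A] [NormedSpace ℝ A] {k : ℕ}
    (α : ∀ x : M, TangentSpace 𝓘(ℝ, V) x [⋀^Fin k]→L[ℝ] A) (x : M) :
    chartForm α x (extChartAt 𝓘(ℝ, V) x x) = α x := by
  have key : ∀ p, p = x → ∀ v : Fin k → V, α p (fun i ↦ coordField x (v i) p) = α x v := by
    rintro _ rfl v
    simp only [coordField_self]
  ext v
  refine Eq.trans ?_ (key _ (extChartAt_to_inv (I := 𝓘(ℝ, V)) x) v)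
  change α _ _ = α _ _
  congr 1
  funext i
  exact mfderiv_extChartAt_symm_eq_coordField x (mem_extChartAt_target x) (v i)

/-- Cartan's formula for the exterior derivative. -/
theorem extD_apply_fields {k : ℕ} {α : ∀ x : M, TangentSpace 𝓘(ℝ, V) x [⋀^Fin (k + 1)]→L[ℝ] ℝ}
    (hU : IsOpen U) (hα : SmoothFormOn α U) {X : Fin (k + 2) → ∀ x : M, TangentSpace 𝓘(ℝ, V) x}
    (hX : ∀ i, SmoothSectionOn V V (X i) U) {x : M} (hx : x ∈ U) :
    extD α x (fun i ↦ X i x) =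
      (∑ i, (-1) ^ i.val • dirD (X i) (fun y ↦ α y (i.removeNth fun j ↦ X j y)) x) -
        ∑ i : Fin (k + 1), ∑ j ≥ i, (-1) ^ (i + j : ℕ) •
          α x (Matrix.vecCons (VectorField.mlieBracket 𝓘(ℝ, V) (X i.castSucc) (X j.succ) x)
            (j.removeNth <| i.castSucc.removeNth fun l ↦ X l x)) := by
  have hy := mem_extChartAt_target (I := 𝓘(ℝ, V)) x
  have hxU : (extChartAt 𝓘(ℝ, V) x).symm (extChartAt 𝓘(ℝ, V) x x) ∈ U := by
    rwa [extChartAt_to_inv]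
  -- Cartan's formula on the vector space `V`, applied in the chart at `x`. At the base point each
  -- of its terms agrees with the intrinsic one.
  have h := extDeriv_apply_vectorField (V := fun i ↦ chartField (X i) x)
    ((contDiffAt_chartForm hU hα x hy hxU).differentiableAt (by simp))
    fun i ↦ differentiableAt_chartField hU (hX i) hx
  simp only [chartField_self] at h
  rw [extD_eq_chart]
  refine h.trans ?_
  rw [chartForm_self]
  congr 1
  · refine Finset.sum_congr rfl fun i _ ↦ ?_
    congr 1
    have hs : SmoothFunOn V (fun y ↦ α y (i.removeNth fun j ↦ X j y)) U :=
      hα U subset_rfl hU (fun j ↦ X (i.succAbove j)) fun j ↦ hX _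
    rw [dirD_eq_chart _ (hs.mdifferentiableAt hU hx)]
    congr 1
    refine Filter.EventuallyEq.fderiv_eq ?_
    filter_upwards [(isOpen_extChartAt_target x).mem_nhds hy] with z hz
    change α _ _ = α _ _
    congr 1
    funext j
    exact mfderiv_chartField _ x hz
  · refine Finset.sum_congr rfl fun i _ ↦ Finset.sum_congr rfl fun j _ ↦ ?_
    rw [mlieBracket_eq_chart]
    rfl

end Exterior

section Exterior

variable {V : Type*} [NormedAddCommGroup V] [NormedSpace ℝ V] [FiniteDimensional ℝ V]
  {M : Type*} [TopologicalSpace M] [ChartedSpace V M] [IsManifold 𝓘(ℝ, V) ∞ M] {U : Set M}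
  {X Y Z : ∀ x : M, TangentSpace 𝓘(ℝ, V) x}

lemma two_le_infty : (2 : WithTop ℕ∞) ≤ ∞ := by
  have h : ((2 : ℕ∞) : WithTop ℕ∞) ≤ ((⊤ : ℕ∞) : WithTop ℕ∞) := WithTop.coe_le_coe.2 le_top
  exact h

lemma extD_congr {A : Type*} [NormedAddCommGroup A] [NormedSpace ℝ A] {k : ℕ}
    {α β : ∀ x : M, TangentSpace 𝓘(ℝ, V) x [⋀^Fin k]→L[ℝ] A} {x : M}
    (h : ∀ᶠ y in 𝓝 x, α y = β y) : extD α x = extD β x := by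
  rw [extD_eq_chart, extD_eq_chart]
  refine Filter.EventuallyEq.extDeriv_eq ?_
  have hc : Filter.Tendsto (extChartAt 𝓘(ℝ, V) x).symm (𝓝 (extChartAt 𝓘(ℝ, V) x x)) (𝓝 x) := by
    have := continuousAt_extChartAt_symm (I := 𝓘(ℝ, V)) x
    rwa [ContinuousAt, extChartAt_to_inv] at this
  filter_upwards [hc.eventually h] with y hy
  rw [chartForm, chartForm, hy]

lemma extD_neg {A : Type*} [NormedAddCommGroup A] [NormedSpace ℝ A] {k : ℕ}
    (α : ∀ x : M, TangentSpace 𝓘(ℝ, V) x [⋀^Fin k]→L[ℝ] A) (x : M) :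
    extD (fun y ↦ -α y) x = -extD α x := by
  rw [extD_eq_chart, extD_eq_chart]
  have h : chartForm (fun y ↦ -α y) x = (-1 : ℝ) • chartForm α x := by
    funext y
    ext v
    change -(α _ _) = (-1 : ℝ) • α _ _
    rw [neg_one_smul]
  rw [h, extDeriv_smul, neg_one_smul]
  rfl

lemma extD_zero {A : Type*} [NormedAddCommGroup A] [NormedSpace ℝ A] {k : ℕ} (x : M) :
    extD (fun y : M ↦ (0 : TangentSpace 𝓘(ℝ, V) y [⋀^Fin k]→L[ℝ] A)) x = 0 := by
  rw [extD_eq_chart]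
  have h : chartForm (fun y : M ↦ (0 : TangentSpace 𝓘(ℝ, V) y [⋀^Fin k]→L[ℝ] A)) x =
      (0 : ℝ) • fun _ ↦ 0 := by
    funext y
    ext v
    rw [zero_smul]
    rfl
  rw [h, extDeriv_smul, zero_smul]
  rfl

lemma extD_toComplexForm {k : ℕ} {α : ∀ x : M, TangentSpace 𝓘(ℝ, V) x [⋀^Fin k]→L[ℝ] ℝ}
    (hU : IsOpen U) (hα : SmoothFormOn α U) {x : M} (hx : x ∈ U) :
    extD (toComplexForm α) x = toComplexForm (extD α) x := by
  have hd : DifferentiableAt ℝ (chartForm α x) (extChartAt 𝓘(ℝ, V) x x) :=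
    (contDiffAt_chartForm hU hα x (mem_extChartAt_target x)
      (by rwa [extChartAt_to_inv])).differentiableAt (by simp)
  have hc : chartForm (toComplexForm α) x = fun y ↦
      Complex.ofRealCLM.compContinuousAlternatingMap (chartForm α x y) := rfl
  have hd' : DifferentiableAt ℝ (chartForm (toComplexForm α) x) (extChartAt 𝓘(ℝ, V) x x) := by
    rw [hc]
    exact (ContinuousLinearMap.compContinuousAlternatingMapCLM ℝ V ℝ ℂ (Fin k)
      Complex.ofRealCLM).differentiableAt.comp _ hd
  ext v
  change _ = Complex.ofRealCLM (extD α x v)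
  rw [extD_eq_chart, extD_eq_chart]
  refine (extDeriv_apply hd' v).trans ?_
  refine Eq.trans ?_ (congrArg Complex.ofRealCLM (extDeriv_apply hd v).symm)
  rw [map_sum]
  refine Finset.sum_congr rfl fun i _ ↦ ?_
  rw [map_zsmul]
  congr 1
  rw [hc]
  have hdi : DifferentiableAt ℝ (fun z ↦ chartForm α x z (i.removeNth v))
      (extChartAt 𝓘(ℝ, V) x x) :=
    (ContinuousAlternatingMap.apply ℝ V ℝ (i.removeNth v : Fin k → V)).differentiableAt.comp _ hd
  have h := Complex.ofRealCLM.hasFDerivAt.comp (extChartAt 𝓘(ℝ, V) x x) hdi.hasFDerivAt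
  exact DFunLike.congr_fun h.fderiv (v i)

/-- The chart representation of the exterior derivative. -/
lemma chartForm_extD {k : ℕ} {α : ∀ x : M, TangentSpace 𝓘(ℝ, V) x [⋀^Fin k]→L[ℝ] ℝ}
    (hU : IsOpen U) (hα : SmoothFormOn α U) (x₀ : M) {y : V}
    (hy : y ∈ (extChartAt 𝓘(ℝ, V) x₀).target) (hyU : (extChartAt 𝓘(ℝ, V) x₀).symm y ∈ U) :
    chartForm (extD α) x₀ y = extDeriv (chartForm α x₀) y := by
  set φ := extChartAt 𝓘(ℝ, V) x₀ with hφ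
  set p : M := φ.symm y with hp
  set ψ := extChartAt 𝓘(ℝ, V) p with hψ
  have hφd : MDifferentiableAt 𝓘(ℝ, V) 𝓘(ℝ, V) φ.symm y :=
    ((contMDiffOn_extChartAt_symm (n := ∞) x₀).contMDiffAt
      ((isOpen_extChartAt_target x₀).mem_nhds hy)).mdifferentiableAt (by simp)
  have hψ0 : MDifferentiableAt 𝓘(ℝ, V) 𝓘(ℝ, V) ψ p :=
    mdifferentiableAt_extChartAt (mem_chart_source V p)
  -- The value of `extD` at `p` is computed in the chart at `p`, not in the one at `x₀`. The two are
  -- compared through the transition map `ψ ∘ φ.symm` and the compatibility of `d` with pullback.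
  have hf : ContDiffAt ℝ ∞ (fun z ↦ ψ (φ.symm z)) y := by
    rw [← contMDiffAt_iff_contDiffAt]
    exact (contMDiffAt_extChartAt (n := ∞) (I := 𝓘(ℝ, V)) (x := p)).comp y
      ((contMDiffOn_extChartAt_symm (n := ∞) x₀).contMDiffAt
        ((isOpen_extChartAt_target x₀).mem_nhds hy))
  have hω : DifferentiableAt ℝ (chartForm α p) (ψ (φ.symm y)) :=
    (contDiffAt_chartForm hU hα p (mem_extChartAt_target p)
      (by rwa [extChartAt_to_inv])).differentiableAt (by simp)
  have h := extDeriv_pullback (f := fun z ↦ ψ (φ.symm z)) hω hf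
    (by rw [minSmoothness_of_isRCLikeNormedField]; exact two_le_infty)
  have hder : (fderiv ℝ (fun z ↦ ψ (φ.symm z)) y : V →L[ℝ] V) =
      mfderiv 𝓘(ℝ, V) 𝓘(ℝ, V) φ.symm y := by
    have h1 : mfderiv 𝓘(ℝ, V) 𝓘(ℝ, V) (ψ ∘ φ.symm) y =
        (mfderiv 𝓘(ℝ, V) 𝓘(ℝ, V) ψ p).comp (mfderiv 𝓘(ℝ, V) 𝓘(ℝ, V) φ.symm y) :=
      mfderiv_comp y hψ0 hφd
    have h2 : (mfderiv 𝓘(ℝ, V) 𝓘(ℝ, V) ψ p : V →L[ℝ] V) = ContinuousLinearMap.id ℝ V :=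
      mfderiv_extChartAt_self
    have h3 : ∀ A B : V →L[ℝ] V, A = ContinuousLinearMap.id ℝ V → A.comp B = B := by
      rintro _ B rfl
      rfl
    rw [← mfderiv_eq_fderiv]
    exact h1.trans (h3 _ _ h2)
  have hform : chartForm α x₀ =ᶠ[𝓝 y] fun z ↦ (chartForm α p (ψ (φ.symm z))).compContinuousLinearMap
      (fderiv ℝ (fun z ↦ ψ (φ.symm z)) z) := by
    have hn : φ.symm ⁻¹' (chartAt V p).source ∈ 𝓝 y :=
      hφd.continuousAt.preimage_mem_nhds
        ((chartAt V p).open_source.mem_nhds (mem_chart_source V p))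
    filter_upwards [(isOpen_extChartAt_target x₀).mem_nhds hy, hn] with z hz hzp
    have hzs : φ.symm z ∈ ψ.source := by rwa [hψ, extChartAt_source]
    have h1 : mfderiv 𝓘(ℝ, V) 𝓘(ℝ, V) (ψ ∘ φ.symm) z =
        (mfderiv 𝓘(ℝ, V) 𝓘(ℝ, V) ψ (φ.symm z)).comp (mfderiv 𝓘(ℝ, V) 𝓘(ℝ, V) φ.symm z) :=
      mfderiv_comp z (mdifferentiableAt_extChartAt hzp)
        (((contMDiffOn_extChartAt_symm (n := ∞) x₀).contMDiffAt
          ((isOpen_extChartAt_target x₀).mem_nhds hz)).mdifferentiableAt (by simp))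
    have h2 := mfderivWithin_extChartAt_symm_comp_mfderiv_extChartAt' (I := 𝓘(ℝ, V)) (x := p)
      (y := φ.symm z) hzs
    rw [modelWithCornersSelf_coe, range_id, mfderivWithin_univ] at h2
    have h3 : ∀ A B C D : V →L[ℝ] V, D = B.comp C → A.comp B = ContinuousLinearMap.id ℝ V →
        ∀ v, C v = A (D v) := by
      rintro A B C _ rfl h v
      exact (DFunLike.congr_fun h (C v)).symm
    -- The fibre of `α` depends on the base point, so the equality `ψ.symm (ψ (φ.symm z)) = φ.symm
    -- z` is applied by substitution.
    have key : ∀ r, r = φ.symm z → ∀ w : Fin k → V, α (φ.symm z) w = α r w := by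
      rintro _ rfl w
      rfl
    ext v
    refine Eq.trans ?_ (key _ (ψ.left_inv hzs) _)
    change α _ _ = α _ _
    congr 1
    funext i
    rw [← mfderiv_eq_fderiv]
    exact h3 _ _ _ _ h1 h2 (v i)
  rw [hform.extDeriv_eq, h, hder, chartForm, ← hφ, ← hp, extD_eq_chart]
  rfl

/-- A second derivative needs the chart representative of `extD α` on a neighbourhood of the base
point, which `chartForm_extD` supplies; there `d² = 0` is the statement on `V`. -/
lemma extD_extD {k : ℕ} {α : ∀ x : M, TangentSpace 𝓘(ℝ, V) x [⋀^Fin k]→L[ℝ] ℝ}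
    (hU : IsOpen U) (hα : SmoothFormOn α U) {x : M} (hx : x ∈ U) : extD (extD α) x = 0 := by
  have hy := mem_extChartAt_target (I := 𝓘(ℝ, V)) x
  have hxU : (extChartAt 𝓘(ℝ, V) x).symm (extChartAt 𝓘(ℝ, V) x x) ∈ U := by
    rwa [extChartAt_to_inv]
  have hn : (extChartAt 𝓘(ℝ, V) x).symm ⁻¹' U ∈ 𝓝 (extChartAt 𝓘(ℝ, V) x x) :=
    (continuousAt_extChartAt_symm (I := 𝓘(ℝ, V)) x).preimage_mem_nhds (hU.mem_nhds hxU)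
  have he : chartForm (extD α) x =ᶠ[𝓝 (extChartAt 𝓘(ℝ, V) x x)] extDeriv (chartForm α x) := by
    filter_upwards [(isOpen_extChartAt_target x).mem_nhds hy, hn] with z hz hzU
    exact chartForm_extD hU hα x hz hzU
  rw [extD_eq_chart, he.extDeriv_eq]
  exact extDeriv_extDeriv_apply (contDiffAt_chartForm hU hα x hy hxU)
    (by rw [minSmoothness_of_isRCLikeNormedField]; exact two_le_infty)

/-- The function `X f` is the fibre component of the tangent map of `f` composed with `X`. -/
lemma SmoothFunOn.dirD {f : M → ℝ} (hU : IsOpen U) (hX : SmoothSectionOn V V X U)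
    (hf : SmoothFunOn V f U) : SmoothFunOn V (dirD X f) U := by
  have h1 := ContMDiffOn.contMDiffOn_tangentMapWithin (m := ∞) hf (by simp) hU.uniqueMDiffOn
  have h2 := h1.comp hX fun x hx ↦ hx
  have h3 := (contMDiff_snd_tangentBundle_modelSpace ℝ 𝓘(ℝ, ℝ) (n := ∞)).comp_contMDiffOn h2
  refine h3.congr fun x hx ↦ ?_
  change _ = mfderivWithin 𝓘(ℝ, V) 𝓘(ℝ, ℝ) f U x (X x)
  rw [mfderivWithin_of_isOpen hU hx]
  rfl

lemma extD_two_apply {β : ∀ x : M, TangentSpace 𝓘(ℝ, V) x [⋀^Fin 2]→L[ℝ] ℝ}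
    (hU : IsOpen U) (hβ : SmoothFormOn β U) (hX : SmoothSectionOn V V X U)
    (hY : SmoothSectionOn V V Y U) (hZ : SmoothSectionOn V V Z U) {x : M} (hx : x ∈ U) :
    extD β x ![X x, Y x, Z x] =
      dirD X (fun y ↦ β y ![Y y, Z y]) x - dirD Y (fun y ↦ β y ![X y, Z y]) x
        + dirD Z (fun y ↦ β y ![X y, Y y]) x
        - β x ![VectorField.mlieBracket 𝓘(ℝ, V) X Y x, Z x]
        + β x ![VectorField.mlieBracket 𝓘(ℝ, V) X Z x, Y x]
        - β x ![VectorField.mlieBracket 𝓘(ℝ, V) Y Z x, X x] := by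
  have h : _ = (∑ i : Fin 3, (-1) ^ i.val • dirD ((![X, Y, Z] : Fin 3 → ∀ x : M, TangentSpace 𝓘(ℝ, V) x) i)
      (fun y ↦ β y (i.removeNth fun j ↦ (![X, Y, Z] : Fin 3 → ∀ x : M, TangentSpace 𝓘(ℝ, V) x) j y)) x) -
        ∑ i : Fin 2, ∑ j ≥ i, (-1) ^ (i + j : ℕ) • _ := extD_apply_fields hU hβ (X := ![X, Y, Z]) (by
    intro i; fin_cases i <;> assumption) hx
  have e1 : (fun i ↦ (![X, Y, Z] : Fin 3 → ∀ x : M, TangentSpace 𝓘(ℝ, V) x) i x) =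
      ![X x, Y x, Z x] := by
    funext i; fin_cases i <;> rfl
  have e2 : ∀ y, ((0 : Fin 3).removeNth fun j ↦ (![X, Y, Z] : Fin 3 → ∀ x : M, TangentSpace 𝓘(ℝ, V) x) j y) =
      ![Y y, Z y] := by
    intro y; funext i; fin_cases i <;> rfl
  have e3 : ∀ y, ((1 : Fin 3).removeNth fun j ↦ (![X, Y, Z] : Fin 3 → ∀ x : M, TangentSpace 𝓘(ℝ, V) x) j y) =
      ![X y, Z y] := by
    intro y; funext i; fin_cases i <;> rfl
  have e4 : ∀ y, ((2 : Fin 3).removeNth fun j ↦ (![X, Y, Z] : Fin 3 → ∀ x : M, TangentSpace 𝓘(ℝ, V) x) j y) =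
      ![X y, Y y] := by
    intro y; funext i; fin_cases i <;> rfl
  rw [e1] at h
  rw [h]
  simp only [Fin.sum_univ_three, Fin.sum_univ_two, e2, e3, e4]
  have e5 : ∀ f : Fin 2 → ℝ, ∑ j ≥ (1 : Fin 2), f j = f 1 := fun f ↦ by
    rw [show Finset.Ici (1 : Fin 2) = {1} by decide, Finset.sum_singleton]
  have e6 : ∀ a b c : TangentSpace 𝓘(ℝ, V) x,
      Matrix.vecCons a ((1 : Fin 2).removeNth ![b, c]) = ![a, b] := by
    intro a b c; funext i; fin_cases i <;> rfl
  have e7 : ∀ a b c d : TangentSpace 𝓘(ℝ, V) x,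
      Matrix.vecCons a ((1 : Fin 2).removeNth ((1 : Fin 3).removeNth ![b, c, d])) = ![a, b] := by
    intro a b c d; funext i; fin_cases i <;> rfl
  rw [e5]
  simp [e6, e7]
  ring

lemma smoothFormOn_oneForm {ξ : ∀ x : M, TangentSpace 𝓘(ℝ, V) x →L[ℝ] ℝ}
    (hξ : SmoothSectionOn V (V →L[ℝ] ℝ) ξ U) : SmoothFormOn (oneForm ξ) U := by
  intro U' hU' _ X hX
  have h := ContMDiffOn.clm_bundle_apply (E₂ := Bundle.Trivial M ℝ) (hξ.mono hU') (hX 0)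
  intro x hx
  exact (Bundle.contMDiffWithinAt_section).1 (h x hx)

lemma extD_one_apply {ξ : ∀ x : M, TangentSpace 𝓘(ℝ, V) x →L[ℝ] ℝ}
    (hU : IsOpen U) (hξ : SmoothSectionOn V (V →L[ℝ] ℝ) ξ U) (hX : SmoothSectionOn V V X U)
    (hY : SmoothSectionOn V V Y U) {x : M} (hx : x ∈ U) :
    contractD ξ X x (Y x) = dirD X (fun y ↦ ξ y (Y y)) x - dirD Y (fun y ↦ ξ y (X y)) x
      - ξ x (VectorField.mlieBracket 𝓘(ℝ, V) X Y x) := by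
  have h := extD_apply_fields hU (smoothFormOn_oneForm hξ) (X := ![X, Y]) (by
    intro i; fin_cases i <;> assumption) hx
  have e1 : contractD ξ X x (Y x) =
      extD (oneForm ξ) x fun i ↦ (![X, Y] : Fin 2 → ∀ x : M, TangentSpace 𝓘(ℝ, V) x) i x := by
    change extD (oneForm ξ) x _ = _
    congr 1
    funext i; fin_cases i <;> rfl
  rw [e1, h]
  simp [Fin.sum_univ_two]
  rfl

end Exterior

section Exterior

variable {V : Type*} [NormedAddCommGroup V] [NormedSpace ℝ V] [FiniteDimensional ℝ V]
  {M : Type*} [TopologicalSpace M] [ChartedSpace V M] [IsManifold 𝓘(ℝ, V) ∞ M] {U : Set M}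
  {X Y Z : ∀ x : M, TangentSpace 𝓘(ℝ, V) x}

/-- On smooth fields, Cartan's formula writes `dβ` through derivatives of smooth functions and
values of `β` on smooth fields and their brackets. -/
lemma SmoothFormOn.extD_two {β : ∀ x : M, TangentSpace 𝓘(ℝ, V) x [⋀^Fin 2]→L[ℝ] ℝ}
    (hβ : SmoothFormOn β U) : SmoothFormOn (extD β) U := by
  intro U' hU' ho X hX
  have hβ' : SmoothFormOn β U' := fun W hW ↦ hβ W (hW.trans hU')
  have h2 : ∀ {A B : ∀ x : M, TangentSpace 𝓘(ℝ, V) x}, SmoothSectionOn V V A U' →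
      SmoothSectionOn V V B U' → SmoothFunOn V (fun x ↦ β x ![A x, B x]) U' := by
    intro A B hA hB
    refine (hβ' U' subset_rfl ho ![A, B] ?_).congr fun x _ ↦ ?_
    · intro i; fin_cases i <;> assumption
    · congr 1
      funext i; fin_cases i <;> rfl
  have b := fun i j ↦ SmoothSectionOn.mlieBracket ho (hX i) (hX j)
  refine ContMDiffOn.congr (((((((h2 (hX 1) (hX 2)).dirD ho (hX 0)).sub
    ((h2 (hX 0) (hX 2)).dirD ho (hX 1))).add ((h2 (hX 0) (hX 1)).dirD ho (hX 2))).sub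
    (h2 (b 0 1) (hX 2))).add (h2 (b 0 2) (hX 1))).sub (h2 (b 1 2) (hX 0))) fun x hx ↦ ?_
  have e1 : (fun i ↦ X i x) = ![X 0 x, X 1 x, X 2 x] := by
    funext i; fin_cases i <;> rfl
  rw [e1]
  exact extD_two_apply ho hβ' (hX 0) (hX 1) (hX 2) hx

end Exterior

/-! ### Smoothness of bundle maps tested on sections -/

section Bundles

variable {V : Type*} [NormedAddCommGroup V] [NormedSpace ℝ V] [FiniteDimensional ℝ V]
  {M : Type*} [TopologicalSpace M] [ChartedSpace V M] [IsManifold 𝓘(ℝ, V) ∞ M] {U : Set M}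
  {F : Type*} [NormedAddCommGroup F] [NormedSpace ℝ F]
  {E : M → Type*} [TopologicalSpace (TotalSpace F E)] [∀ x, AddCommGroup (E x)]
  [∀ x, Module ℝ (E x)] [∀ x, TopologicalSpace (E x)]
  [∀ x, IsTopologicalAddGroup (E x)] [∀ x, ContinuousSMul ℝ (E x)]
  [FiberBundle F E] [VectorBundle ℝ F E]

lemma contMDiffAt_clm_of_apply {f : M → V →L[ℝ] F} {x : M}
    (hf : ∀ v, ContMDiffAt 𝓘(ℝ, V) 𝓘(ℝ, F) ∞ (fun y ↦ f y v) x) :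
    ContMDiffAt 𝓘(ℝ, V) 𝓘(ℝ, V →L[ℝ] F) ∞ f x := by
  let b := Module.finBasis ℝ V
  -- Expansion in a basis of `V`: a linear map is the sum of its values on the basis times the dual
  -- coordinates.
  have e : f = fun y ↦ ∑ i, ContinuousLinearMap.smulRightL ℝ V F
      (LinearMap.toContinuousLinearMap (b.coord i)) (f y (b i)) := by
    funext y
    ext v
    calc f y v = f y (∑ i, b.repr v i • b i) := by rw [b.sum_repr]
      _ = ∑ i, b.repr v i • f y (b i) := by simp only [map_sum, map_smul]
      _ = _ := by simp
  rw [e]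
  refine ContMDiffAt.sum fun i _ ↦ ?_
  exact (ContinuousLinearMap.contMDiff _).contMDiffAt.comp x (hf (b i))

/-- In local trivializations, the columns of the matrix of `φ` are the images of the coordinate
fields, to which the hypothesis applies. -/
lemma smooth_hom_of_apply {φ : ∀ x : M, TangentSpace 𝓘(ℝ, V) x →L[ℝ] E x} (hU : IsOpen U)
    (h : ∀ U' ⊆ U, IsOpen U' → ∀ X : ∀ x : M, TangentSpace 𝓘(ℝ, V) x, SmoothSectionOn V V X U' →
      SmoothSectionOn V F (fun x ↦ φ x (X x)) U') :
    ContMDiffOn 𝓘(ℝ, V) (𝓘(ℝ, V).prod 𝓘(ℝ, V →L[ℝ] F)) ∞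
      (fun x ↦ TotalSpace.mk' (V →L[ℝ] F) (E := fun x ↦ TangentSpace 𝓘(ℝ, V) x →L[ℝ] E x)
        x (φ x)) U := by
  intro x₀ hx₀
  apply ContMDiffAt.contMDiffWithinAt
  rw [contMDiffAt_hom_bundle]
  refine ⟨contMDiffAt_id, contMDiffAt_clm_of_apply fun v ↦ ?_⟩
  have hO : IsOpen (U ∩ (chartAt V x₀).source) := hU.inter (chartAt V x₀).open_source
  have hx : x₀ ∈ U ∩ (chartAt V x₀).source := ⟨hx₀, mem_chart_source V x₀⟩
  have h1 := (h _ inter_subset_left hO (coordField x₀ v)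
    ((smooth_coordField x₀ v).mono inter_subset_right)).contMDiffAt (hO.mem_nhds hx)
  rw [contMDiffAt_section] at h1
  refine h1.congr_of_eventuallyEq ?_
  filter_upwards [(trivializationAt F E x₀).open_baseSet.mem_nhds
    (mem_baseSet_trivializationAt F E x₀)] with y hy
  change (trivializationAt F E x₀).continuousLinearMapAt ℝ y _ = _
  rw [Trivialization.continuousLinearMapAt_apply, Trivialization.coe_linearMapAt_of_mem _ hy]
  rfl

/-- An injective endomorphism of a finite-dimensional fibre is invertible and inversion is smooth,
so `Y = A⁻¹ (A Y)` is smooth. This is how smoothness of `s_±` is obtained from that of `π`, `G` and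
a local splitting. -/
lemma smooth_of_hom_apply {A : ∀ x : M, TangentSpace 𝓘(ℝ, V) x →L[ℝ] TangentSpace 𝓘(ℝ, V) x}
    (hU : IsOpen U)
    (h : ∀ U' ⊆ U, IsOpen U' → ∀ X : ∀ x : M, TangentSpace 𝓘(ℝ, V) x, SmoothSectionOn V V X U' →
      SmoothSectionOn V V (fun x ↦ A x (X x)) U')
    (hA : ∀ x ∈ U, Function.Injective (A x)) {Y : ∀ x : M, TangentSpace 𝓘(ℝ, V) x}
    (hY : SmoothSectionOn V V (fun x ↦ A x (Y x)) U) : SmoothSectionOn V V Y U := by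
  intro x₀ hx₀
  have hs := (smooth_hom_of_apply hU h).contMDiffAt (hU.mem_nhds hx₀)
  rw [contMDiffAt_hom_bundle] at hs
  have hs2 := hs.2
  have hY0 := hY.contMDiffAt (hU.mem_nhds hx₀)
  rw [contMDiffAt_section] at hY0
  apply ContMDiffAt.contMDiffWithinAt
  rw [contMDiffAt_section]
  set e := trivializationAt V (TangentSpace 𝓘(ℝ, V) : M → Type _) x₀ with he
  let a : M → V →L[ℝ] V := fun x ↦ ContinuousLinearMap.inCoordinates V (TangentSpace 𝓘(ℝ, V)) V
    (TangentSpace 𝓘(ℝ, V)) x₀ x x₀ x (A x)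
  have hinv : ∀ x ∈ U ∩ e.baseSet, ∃ a' : V ≃L[ℝ] V, (a' : V →L[ℝ] V) = a x := by
    intro x hx
    have hi : Function.Injective (a x) := by
      have h1 : Function.Injective (e.continuousLinearMapAt ℝ x) :=
        Function.LeftInverse.injective (g := e.symmL ℝ x) (e.symmL_continuousLinearMapAt hx.2)
      have h2 : Function.Injective (e.symmL ℝ x) :=
        Function.LeftInverse.injective (g := e.continuousLinearMapAt ℝ x)
          (e.continuousLinearMapAt_symmL hx.2)
      exact h1.comp ((hA x hx.1).comp h2)
    exact ⟨(LinearEquiv.ofInjectiveEndo (a x).toLinearMap hi).toContinuousLinearEquiv, by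
      ext v; rfl⟩
  have hmem := mem_baseSet_trivializationAt V (TangentSpace 𝓘(ℝ, V) : M → Type _) x₀
  obtain ⟨a₀, ha₀⟩ := hinv x₀ ⟨hx₀, hmem⟩
  have h1 : ContMDiffAt 𝓘(ℝ, V) 𝓘(ℝ, V →L[ℝ] V) ∞ (fun x ↦ (a x).inverse) x₀ := by
    have h0 : ContDiffAt ℝ ∞ ContinuousLinearMap.inverse (a x₀) := by
      rw [← ha₀]
      exact contDiffAt_map_inverse a₀
    exact h0.contMDiffAt.comp x₀ hs2
  refine (h1.clm_apply hY0).congr_of_eventuallyEq ?_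
  filter_upwards [e.open_baseSet.mem_nhds hmem, hU.mem_nhds hx₀] with x hxe hxU
  obtain ⟨a', ha'⟩ := hinv x ⟨hxU, hxe⟩
  have h2 : (e ⟨x, A x (Y x)⟩).2 = a x (e ⟨x, Y x⟩).2 := by
    change _ = e.continuousLinearMapAt ℝ x (A x (e.symmL ℝ x _))
    rw [Trivialization.continuousLinearMapAt_apply, Trivialization.coe_linearMapAt_of_mem _ hxe,
      Trivialization.symmL_apply _ hxe, Trivialization.symm_apply_apply_mk _ hxe]
  rw [h2, ← ha', ContinuousLinearMap.inverse_equiv]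
  exact (a'.symm_apply_apply _).symm

lemma smooth_covector {ξ : ∀ x : M, TangentSpace 𝓘(ℝ, V) x →L[ℝ] ℝ} (hU : IsOpen U)
    (h : ∀ U' ⊆ U, IsOpen U' → ∀ X : ∀ x : M, TangentSpace 𝓘(ℝ, V) x, SmoothSectionOn V V X U' →
      SmoothFunOn V (fun x ↦ ξ x (X x)) U') : SmoothSectionOn V (V →L[ℝ] ℝ) ξ U :=
  smooth_hom_of_apply (E := Bundle.Trivial M ℝ) hU fun U' hU' hO X hX x hx ↦
    Bundle.contMDiffWithinAt_section.2 (h U' hU' hO X hX x hx)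

lemma SmoothSectionOn.covector_apply {ξ : ∀ x : M, TangentSpace 𝓘(ℝ, V) x →L[ℝ] ℝ}
    {X : ∀ x : M, TangentSpace 𝓘(ℝ, V) x}
    (hξ : SmoothSectionOn V (V →L[ℝ] ℝ) ξ U) (hX : SmoothSectionOn V V X U) :
    SmoothFunOn V (fun x ↦ ξ x (X x)) U := by
  have h := ContMDiffOn.clm_bundle_apply (E₂ := Bundle.Trivial M ℝ) hξ hX
  intro x hx
  exact Bundle.contMDiffWithinAt_section.1 (h x hx)

end Bundles

/-! ### Smooth sections of a Courant algebroid -/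

section CourantSections

variable {V : Type*} [NormedAddCommGroup V] [NormedSpace ℝ V] [FiniteDimensional ℝ V]
  {M : Type*} [TopologicalSpace M] [ChartedSpace V M] [IsManifold 𝓘(ℝ, V) ∞ M] {U : Set M}
  {F : Type*} [NormedAddCommGroup F] [NormedSpace ℝ F]
  {E : M → Type*} [TopologicalSpace (TotalSpace F E)] [∀ x, AddCommGroup (E x)]
  [∀ x, Module ℝ (E x)] [∀ x, TopologicalSpace (E x)]
  [∀ x, IsTopologicalAddGroup (E x)] [∀ x, ContinuousSMul ℝ (E x)]
  [FiberBundle F E] [VectorBundle ℝ F E] [ContMDiffVectorBundle ∞ F E 𝓘(ℝ, V)]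
  {𝓔 : CourantAlgebroid V M F E} {a b : ∀ x, E x} {X Y : ∀ x : M, TangentSpace 𝓘(ℝ, V) x}

lemma SmoothSectionOn.add (ha : SmoothSectionOn V F a U) (hb : SmoothSectionOn V F b U) :
    SmoothSectionOn V F (fun x ↦ a x + b x) U := ContMDiffOn.add_section ha hb

lemma SmoothSectionOn.const_smul (c : ℝ) (ha : SmoothSectionOn V F a U) :
    SmoothSectionOn V F (fun x ↦ c • a x) U := ContMDiffOn.const_smul_section ha

lemma CourantAlgebroid.smooth_anchor (ha : SmoothSectionOn V F a U) :
    SmoothSectionOn V V (fun x ↦ 𝓔.anchor x (a x)) U :=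
  ContMDiffOn.clm_bundle_apply 𝓔.anchor_smooth.contMDiffOn ha

lemma CourantAlgebroid.smooth_pairing (ha : SmoothSectionOn V F a U)
    (hb : SmoothSectionOn V F b U) :
    SmoothFunOn V (fun x ↦ 𝓔.pairing x (a x) (b x)) U := by
  have h := ContMDiffOn.clm_bundle_apply₂ (E₃ := Bundle.Trivial M ℝ)
    𝓔.pairing_smooth.contMDiffOn ha hb
  intro x hx
  exact Bundle.contMDiffWithinAt_section.1 (h x hx)

lemma AlmostGeneralizedComplex.smooth_apply (𝓐 : AlmostGeneralizedComplex 𝓔)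
    (ha : SmoothSectionOn V F a U) : SmoothSectionOn V F (fun x ↦ 𝓐.J x (a x)) U :=
  ContMDiffOn.clm_bundle_apply 𝓐.smooth.contMDiffOn ha

end CourantSections

/-! ### Local splittings onto the standard model -/

section LocalSplittings

variable {V : Type*} [NormedAddCommGroup V] [NormedSpace ℝ V] [FiniteDimensional ℝ V]
  {M : Type*} [TopologicalSpace M] [ChartedSpace V M] [IsManifold 𝓘(ℝ, V) ∞ M] {U : Set M}
  {F : Type*} [NormedAddCommGroup F] [NormedSpace ℝ F]
  {E : M → Type*} [TopologicalSpace (TotalSpace F E)] [∀ x, AddCommGroup (E x)]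
  [∀ x, Module ℝ (E x)] [∀ x, TopologicalSpace (E x)]
  [∀ x, IsTopologicalAddGroup (E x)] [∀ x, ContinuousSMul ℝ (E x)]
  [FiberBundle F E] [VectorBundle ℝ F E] [ContMDiffVectorBundle ∞ F E 𝓘(ℝ, V)]
  {X Y Z : ∀ x : M, TangentSpace 𝓘(ℝ, V) x}

/-- `t` is a splitting of `π` over `U` which identifies `E` with `TM ⊕ T^*M` with its standard
pairing and bracket. -/
structure CourantAlgebroid.IsLocalSplitting (𝓔 : CourantAlgebroid V M F E) (U : Set M)
    (t : ∀ x, TangentSpace 𝓘(ℝ, V) x →L[ℝ] E x) : Prop where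
  isOpen : IsOpen U
  smooth : ContMDiffOn 𝓘(ℝ, V) (𝓘(ℝ, V).prod 𝓘(ℝ, V →L[ℝ] F)) ∞
        (fun x ↦ TotalSpace.mk' (V →L[ℝ] F) (E := fun x ↦ TangentSpace 𝓘(ℝ, V) x →L[ℝ] E x)
          x (t x)) U
  anchor : ∀ x ∈ U, ∀ X, 𝓔.anchor x (t x X) = X
  pairing : ∀ x ∈ U, ∀ X Y ξ η, 𝓔.pairing x (t x X + 𝓔.coanchor x ξ) (t x Y + 𝓔.coanchor x η) =
        2⁻¹ * (ξ Y + η X)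
  bracket : ∀ U' ⊆ U, IsOpen U' → ∀ (X Y : ∀ x, TangentSpace 𝓘(ℝ, V) x)
        (ξ η : ∀ x, TangentSpace 𝓘(ℝ, V) x →L[ℝ] ℝ),
        SmoothSectionOn V V X U' → SmoothSectionOn V V Y U' →
        SmoothSectionOn V (V →L[ℝ] ℝ) ξ U' → SmoothSectionOn V (V →L[ℝ] ℝ) η U' →
        ∀ x ∈ U', 𝓔.bracket (fun y ↦ t y (X y) + 𝓔.coanchor y (ξ y))
            (fun y ↦ t y (Y y) + 𝓔.coanchor y (η y)) x =
          t x (VectorField.mlieBracket 𝓘(ℝ, V) X Y x) +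
            𝓔.coanchor x (lieD X η x - contractD ξ Y x)

lemma CourantAlgebroid.exists_isLocalSplitting (𝓔 : CourantAlgebroid V M F E) (x : M) :
    ∃ U t, x ∈ U ∧ 𝓔.IsLocalSplitting U t := by
  obtain ⟨U, h1, h2, t, h3, h4, h5, h6⟩ := 𝓔.locally_trivial x
  exact ⟨U, t, h2, h1, h3, h4, h5, h6⟩

variable {𝓔 : CourantAlgebroid V M F E} {t : ∀ x, TangentSpace 𝓘(ℝ, V) x →L[ℝ] E x}

lemma CourantAlgebroid.anchor_coanchor (𝓔 : CourantAlgebroid V M F E) (x : M) (ξ) :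
    𝓔.anchor x (𝓔.coanchor x ξ) = 0 := (𝓔.exact x _).2 ⟨ξ, rfl⟩

lemma CourantAlgebroid.pairing_coanchor_right (𝓔 : CourantAlgebroid V M F E) (x : M) (a ξ) :
    𝓔.pairing x a (𝓔.coanchor x ξ) = 2⁻¹ * ξ (𝓔.anchor x a) := by
  rw [𝓔.pairing_symm, 𝓔.pairing_coanchor]

lemma CourantAlgebroid.IsLocalSplitting.pairing_self (ht : 𝓔.IsLocalSplitting U t) {x : M}
    (hx : x ∈ U) (v w) : 𝓔.pairing x (t x v) (t x w) = 0 := by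
  simpa using ht.pairing x hx v w 0 0

lemma CourantAlgebroid.IsLocalSplitting.smooth_apply (ht : 𝓔.IsLocalSplitting U t) {U' : Set M}
    (hU' : U' ⊆ U) (hX : SmoothSectionOn V V X U') :
    SmoothSectionOn V F (fun x ↦ t x (X x)) U' :=
  ContMDiffOn.clm_bundle_apply (ht.smooth.mono hU') hX

lemma SmoothSectionOn.congr_section {a b : ∀ x, E x} (ha : SmoothSectionOn V F a U)
    (h : ∀ x ∈ U, b x = a x) : SmoothSectionOn V F b U :=
  ContMDiffOn.congr ha fun x hx ↦ by rw [h x hx]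

end LocalSplittings

/-! ### The almost bi-Hermitian data and their smoothness -/

namespace AlmostGeneralizedKahler

section Data

variable {V : Type*} [NormedAddCommGroup V] [NormedSpace ℝ V] [FiniteDimensional ℝ V]
  {M : Type*} [TopologicalSpace M] [ChartedSpace V M] [IsManifold 𝓘(ℝ, V) ∞ M] {U : Set M}
  {F : Type*} [NormedAddCommGroup F] [NormedSpace ℝ F]
  {E : M → Type*} [TopologicalSpace (TotalSpace F E)] [∀ x, AddCommGroup (E x)]
  [∀ x, Module ℝ (E x)] [∀ x, TopologicalSpace (E x)]
  [∀ x, IsTopologicalAddGroup (E x)] [∀ x, ContinuousSMul ℝ (E x)]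
  [FiberBundle F E] [VectorBundle ℝ F E] [ContMDiffVectorBundle ∞ F E 𝓘(ℝ, V)]
  {𝓔 : CourantAlgebroid V M F E} (𝓙 : AlmostGeneralizedKahler 𝓔)
  {X Y Z : ∀ x : M, TangentSpace 𝓘(ℝ, V) x}

/-- Apply `J₊` to `-J₊ J₋ a = ε a`. This sign is the only difference between the two structures once
they are restricted to `C_±`. -/
lemma J_minus_of_mem_C {ε : ℤˣ} {x : M} {a : E x} (ha : a ∈ 𝓙.C ε x) :
    𝓙.minus.J x a = ((ε : ℤ) : ℝ) • 𝓙.plus.J x a := by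
  have h := 𝓙.mem_C.1 ha
  rw [G_apply] at h
  rw [← map_smul, ← h, map_neg, 𝓙.plus.sq, neg_neg]

lemma sC_I_minus (ε : ℤˣ) (x : M) (v) :
    𝓙.sC ε x (((ε : ℤ) : ℝ) • 𝓙.I ε x v) = 𝓙.minus.J x (𝓙.sC ε x v) := by
  rw [map_smul, sC_I, 𝓙.J_minus_of_mem_C (𝓙.sC_mem ε x v)]

lemma sC_injective (ε : ℤˣ) (x : M) : Function.Injective (𝓙.sC ε x) :=
  Function.LeftInverse.injective (g := 𝓔.anchor x) (𝓙.anchor_sC ε x)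

lemma I_I (ε : ℤˣ) (x : M) (v) : 𝓙.I ε x (𝓙.I ε x v) = -v := by
  apply 𝓙.sC_injective ε x
  rw [sC_I, sC_I, 𝓙.plus.sq, map_neg]

lemma g_symm (x : M) (v w) : 𝓙.g x v w = 𝓙.g x w v := 𝓔.pairing_symm _ _ _

lemma g_I_I (ε : ℤˣ) (x : M) (v w) : 𝓙.g x (𝓙.I ε x v) (𝓙.I ε x w) = 𝓙.g x v w := by
  rw [𝓙.g_eq ε, 𝓙.g_eq ε, sC_I, sC_I, 𝓙.plus.orthogonal]

/-- The metric as a bilinear form. -/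
def gBilin (x : M) : TangentSpace 𝓘(ℝ, V) x →ₗ[ℝ] TangentSpace 𝓘(ℝ, V) x →ₗ[ℝ] ℝ :=
  LinearMap.mk₂ ℝ (fun v w ↦ 𝓙.g x v w)
    (by intro a b c; simp [g]) (by intro c a b; simp [g]) (by intro a b c; simp [g])
    (by intro c a b; simp [g])

/-- The covector `g(v, ·)`. -/
def gFlat (x : M) (v : TangentSpace 𝓘(ℝ, V) x) : TangentSpace 𝓘(ℝ, V) x →L[ℝ] ℝ :=
  haveI : FiniteDimensional ℝ (TangentSpace 𝓘(ℝ, V) x) := inferInstanceAs (FiniteDimensional ℝ V)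
  haveI : T2Space (TangentSpace 𝓘(ℝ, V) x) := inferInstanceAs (T2Space V)
  LinearMap.toContinuousLinearMap (𝓙.gBilin x v)

lemma gFlat_apply (x : M) (v w) : 𝓙.gFlat x v w = 𝓙.g x v w := rfl

lemma g_eq_zero {x : M} {v : TangentSpace 𝓘(ℝ, V) x} (h : ∀ w, 𝓙.g x v w = 0) : v = 0 := by
  by_contra hv
  have h0 : 𝓙.sC 1 x v ≠ 0 := fun h' ↦ hv (𝓙.sC_injective 1 x (by rw [h', map_zero]))
  have h1 := 𝓙.pairing_G_pos x _ h0
  rw [𝓙.mem_C.1 (𝓙.sC_mem 1 x v)] at h1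
  have h2 := h v
  rw [g] at h2
  simp [h2] at h1

/-- The difference `s₊ v - s₋ v` is killed by `π`, hence is a covector. Pairing it with `s₊ w` and
using `C₊ ⟂ C₋` identifies it as `2 g(v, ·)`, the `2` compensating the factor `1/2` in the pairing.
Since `s` is the mean of `s₊` and `s₋`, each of them lies at `± g(v, ·)` from it. -/
lemma sC_eq (ε : ℤˣ) (x : M) (v) :
    𝓙.sC ε x v = 𝓙.s x v + 𝓔.coanchor x (((ε : ℤ) : ℝ) • 𝓙.gFlat x v) := by
  obtain ⟨ξ, hξ⟩ := (𝓔.exact x (𝓙.sC 1 x v - 𝓙.sC (-1) x v)).1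
    (by rw [map_sub, anchor_sC, anchor_sC, sub_self])
  have h1 : ξ = (2 : ℝ) • 𝓙.gFlat x v := by
    ext w
    have h2 : 𝓔.pairing x (𝓙.sC 1 x w) (𝓔.coanchor x ξ) = 𝓙.g x v w := by
      rw [hξ, map_sub, pairing_sC_sC, sub_zero, g_symm]
      rfl
    rw [𝓔.pairing_coanchor_right, anchor_sC] at h2
    change ξ w = 2 * 𝓙.g x v w
    linarith
  rw [h1] at hξ
  have h3 : 𝓔.coanchor x (𝓙.gFlat x v) = (2⁻¹ : ℝ) • (𝓙.sC 1 x v - 𝓙.sC (-1) x v) := by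
    rw [← hξ, map_smul, smul_smul]
    norm_num
  rcases Int.units_eq_one_or ε with rfl | rfl
  all_goals
    rw [map_smul, h3, s]
    simp only [LinearMap.smul_apply, LinearMap.add_apply, Units.val_one, Units.val_neg,
      Int.cast_one, Int.cast_neg]
    module

lemma anchor_s (x : M) (v) : 𝓔.anchor x (𝓙.s x v) = v := by
  simp only [s, LinearMap.smul_apply, LinearMap.add_apply, map_smul, map_add, anchor_sC]
  module

/-- The cross terms vanish because `C₊ ⟂ C₋`, and the pairing restricts to `g` on `C₊` and to `-g`
on `C₋`, so the two remaining terms cancel. -/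
lemma pairing_s_s (x : M) (v w) : 𝓔.pairing x (𝓙.s x v) (𝓙.s x w) = 0 := by
  have h1 := 𝓙.g_eq 1 x v w
  have h2 := 𝓙.g_eq (-1) x v w
  have h3 := 𝓙.pairing_sC_sC x v w
  have h4 := 𝓙.pairing_sC_sC x w v
  rw [𝓔.pairing_symm] at h4
  simp only [Units.val_one, Units.val_neg, Int.cast_one, Int.cast_neg] at h1 h2
  simp only [s, LinearMap.smul_apply, LinearMap.add_apply, map_smul, map_add,
    smul_apply, add_apply, smul_eq_mul, h3, h4]
  linarith

/-- The pairing of `s v + ξ` and `s w + η`. -/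
lemma pairing_s_add (x : M) (v w ξ η) :
    𝓔.pairing x (𝓙.s x v + 𝓔.coanchor x ξ) (𝓙.s x w + 𝓔.coanchor x η) = 2⁻¹ * (ξ w + η v) := by
  simp only [map_add, add_apply, pairing_s_s, 𝓔.pairing_coanchor, 𝓔.pairing_coanchor_right,
    anchor_s, 𝓔.anchor_coanchor, map_zero]
  ring

lemma smooth_G {a : ∀ x, E x} (ha : SmoothSectionOn V F a U) :
    SmoothSectionOn V F (fun x ↦ 𝓙.G x (a x)) U :=
  ((𝓙.plus.smooth_apply (𝓙.minus.smooth_apply ha)).const_smul (-1)).congr_section fun x _ ↦ by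
    rw [neg_one_smul]
    rfl

/-- With `P = 1 + ε G` and a local splitting `t`, the endomorphism `A = π P t` of the tangent bundle
is smooth and invertible, and `s_ε X = P t A⁻¹ X`. -/
lemma smooth_sC (ε : ℤˣ) (hU : IsOpen U) (hX : SmoothSectionOn V V X U) :
    SmoothSectionOn V F (fun x ↦ 𝓙.sC ε x (X x)) U := by
  intro x₀ hx₀
  obtain ⟨U₀, t, hxU₀, ht⟩ := 𝓔.exists_isLocalSplitting x₀
  have hT2 : ∀ x : M, T2Space (TangentSpace 𝓘(ℝ, V) x) := fun x ↦ inferInstanceAs (T2Space V)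
  have hfin : ∀ x : M, FiniteDimensional ℝ (TangentSpace 𝓘(ℝ, V) x) :=
    fun x ↦ inferInstanceAs (FiniteDimensional ℝ V)
  have hW : IsOpen (U ∩ U₀) := hU.inter ht.isOpen
  -- Twice the projection onto `C_ε`, by `G² = 1`.
  let P : ∀ x, E x →ₗ[ℝ] E x := fun x ↦ LinearMap.id + ((ε : ℤ) : ℝ) • 𝓙.G x
  have hP : ∀ x a, P x a ∈ 𝓙.C ε x := by
    intro x a
    rw [mem_C]
    simp only [P, LinearMap.add_apply, LinearMap.smul_apply, LinearMap.id_apply, map_add, map_smul,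
      G_G, smul_add, smul_smul, unit_sq, one_smul]
    rw [add_comm]
  let A : ∀ x : M, TangentSpace 𝓘(ℝ, V) x →L[ℝ] TangentSpace 𝓘(ℝ, V) x := fun x ↦
    LinearMap.toContinuousLinearMap
      ((𝓔.anchor x).toLinearMap ∘ₗ P x ∘ₗ (t x).toLinearMap)
  have hA : ∀ x ∈ U₀, Function.Injective (A x) := by
    intro x hx
    rw [injective_iff_map_eq_zero]
    intro v hv
    change 𝓔.anchor x (P x (t x v)) = 0 at hv
    have h1 : P x (t x v) = 0 := by
      rw [← 𝓙.sC_anchor (hP x (t x v)), hv, map_zero]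
    -- As `t` is isotropic, pairing `P (t v) = 0` with `t v` leaves only `ε ⟨t v, G (t v)⟩`, and
    -- positivity of `G` then forces `t v = 0`.
    have h2 : 𝓔.pairing x (t x v) (𝓙.G x (t x v)) = 0 := by
      have h3 := congrArg (𝓔.pairing x (t x v)) h1
      simp only [P, LinearMap.add_apply, LinearMap.smul_apply, LinearMap.id_apply, map_add,
        map_smul, ht.pairing_self hx, zero_add, map_zero, smul_eq_mul] at h3
      rcases mul_eq_zero.1 h3 with h | h
      · have := unit_sq ε
        rw [h] at this
        norm_num at this
      · exact h
    have h4 : t x v = 0 := by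
      by_contra h
      exact (𝓙.pairing_G_pos x _ h).ne' h2
    rw [← ht.anchor x hx v, h4, map_zero]
  have hPs : ∀ U' ⊆ U₀, ∀ Y : ∀ x : M, TangentSpace 𝓘(ℝ, V) x, SmoothSectionOn V V Y U' →
      SmoothSectionOn V F (fun x ↦ P x (t x (Y x))) U' := fun U' hU' Y hY ↦
    (ht.smooth_apply hU' hY).add ((𝓙.smooth_G (ht.smooth_apply hU' hY)).const_smul _)
  -- Outside `U₀` the preimage is irrelevant and is set to `0`.
  have hex : ∀ x : M, ∃ v, x ∈ U₀ → A x v = X x := by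
    intro x
    by_cases hx : x ∈ U₀
    · obtain ⟨v, hv⟩ :=
        (LinearMap.injective_iff_surjective (f := (A x).toLinearMap)).1 (hA x hx) (X x)
      exact ⟨v, fun _ ↦ hv⟩
    · exact ⟨0, fun h ↦ absurd h hx⟩
  choose Y hY using hex
  have hYs : SmoothSectionOn V V Y (U ∩ U₀) := by
    refine smooth_of_hom_apply (A := A) hW ?_ (fun x hx ↦ hA x hx.2) ?_
    · intro U' hU' _ Z hZ
      exact 𝓔.smooth_anchor (hPs U' (hU'.trans inter_subset_right) Z hZ)
    · exact SmoothSectionOn.congr_section (hX.mono inter_subset_left) fun x hx ↦ hY x hx.2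
  have hs : SmoothSectionOn V F (fun x ↦ 𝓙.sC ε x (X x)) (U ∩ U₀) := by
    refine (hPs _ inter_subset_right Y hYs).congr_section fun x hx ↦ ?_
    rw [← 𝓙.sC_anchor (hP x (t x (Y x))), ← hY x hx.2]
    rfl
  exact (hs.contMDiffAt (hW.mem_nhds ⟨hx₀, hxU₀⟩)).contMDiffWithinAt

lemma smooth_I (ε : ℤˣ) (hU : IsOpen U) (hX : SmoothSectionOn V V X U) :
    SmoothSectionOn V V (fun x ↦ 𝓙.I ε x (X x)) U :=
  𝓔.smooth_anchor (𝓙.plus.smooth_apply (𝓙.smooth_sC ε hU hX))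

lemma smooth_s (hU : IsOpen U) (hX : SmoothSectionOn V V X U) :
    SmoothSectionOn V F (fun x ↦ 𝓙.s x (X x)) U :=
  ((𝓙.smooth_sC 1 hU hX).add (𝓙.smooth_sC (-1) hU hX)).const_smul 2⁻¹

lemma smooth_g (hU : IsOpen U) (hX : SmoothSectionOn V V X U) (hY : SmoothSectionOn V V Y U) :
    SmoothFunOn V (fun x ↦ 𝓙.g x (X x) (Y x)) U :=
  𝓔.smooth_pairing (𝓙.smooth_sC 1 hU hX) (𝓙.smooth_sC 1 hU hY)

lemma smooth_gFlat (hU : IsOpen U) (hX : SmoothSectionOn V V X U) :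
    SmoothSectionOn V (V →L[ℝ] ℝ) (fun x ↦ 𝓙.gFlat x (X x)) U :=
  smooth_covector hU fun _ hU' hO _ hY ↦ 𝓙.smooth_g hO (hX.mono hU') hY

end Data

end AlmostGeneralizedKahler

/-! ### Rules for directional derivatives -/

section Derivations

variable {V : Type*} [NormedAddCommGroup V] [NormedSpace ℝ V]
  {M : Type*} [TopologicalSpace M] [ChartedSpace V M]
  {X Y : ∀ x : M, TangentSpace 𝓘(ℝ, V) x} {f g : M → ℝ} {x : M}

lemma dirD_add (hf : MDifferentiableAt 𝓘(ℝ, V) 𝓘(ℝ, ℝ) f x)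
    (hg : MDifferentiableAt 𝓘(ℝ, V) 𝓘(ℝ, ℝ) g x) :
    dirD X (fun y ↦ f y + g y) x = dirD X f x + dirD X g x := by
  have := mvfderiv_add hf hg
  exact congrArg (fun L : TangentSpace 𝓘(ℝ, V) x →L[ℝ] ℝ ↦ L (X x)) this

lemma dirD_const_mul (c : ℝ) (hf : MDifferentiableAt 𝓘(ℝ, V) 𝓘(ℝ, ℝ) f x) :
    dirD X (fun y ↦ c * f y) x = c * dirD X f x := by
  have h := mvfderiv_mul (I := 𝓘(ℝ, V)) (f := fun _ : M ↦ c) mdifferentiableAt_const hf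
  have h2 := congrArg (fun L : TangentSpace 𝓘(ℝ, V) x →L[ℝ] ℝ ↦ L (X x)) h
  refine h2.trans ?_
  simp [dirD, mvfderiv_const]

lemma dirD_zero : dirD X (fun _ : M ↦ (0 : ℝ)) x = 0 := by
  simp [dirD, mvfderiv_const]

end Derivations

section Extension

variable {V : Type*} [NormedAddCommGroup V] [NormedSpace ℝ V] [FiniteDimensional ℝ V]
  {M : Type*} [TopologicalSpace M] [ChartedSpace V M] [IsManifold 𝓘(ℝ, V) ∞ M]

/-- Identities proved for smooth local fields become pointwise identities by extending the tangent
vectors involved. -/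
lemma exists_smoothSection_eq (x : M) (v : TangentSpace 𝓘(ℝ, V) x) :
    ∃ X : ∀ x : M, TangentSpace 𝓘(ℝ, V) x,
      SmoothSectionOn V V X (chartAt V x).source ∧ X x = v :=
  ⟨coordField (V := V) x v, smooth_coordField (V := V) x v, coordField_self (V := V) x v⟩

end Extension

/-! ### The torsion 3-form of the splitting -/

section Torsion

variable {V : Type*} [NormedAddCommGroup V] [NormedSpace ℝ V] [FiniteDimensional ℝ V]
  {M : Type*} [TopologicalSpace M] [ChartedSpace V M] [IsManifold 𝓘(ℝ, V) ∞ M] {U U' : Set M}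
  {F : Type*} [NormedAddCommGroup F] [NormedSpace ℝ F]
  {E : M → Type*} [TopologicalSpace (TotalSpace F E)] [∀ x, AddCommGroup (E x)]
  [∀ x, Module ℝ (E x)] [∀ x, TopologicalSpace (E x)]
  [∀ x, IsTopologicalAddGroup (E x)] [∀ x, ContinuousSMul ℝ (E x)]
  [FiberBundle F E] [VectorBundle ℝ F E] [ContMDiffVectorBundle ∞ F E 𝓘(ℝ, V)]
  {𝓔 : CourantAlgebroid V M F E} {t t' : ∀ x, TangentSpace 𝓘(ℝ, V) x →L[ℝ] E x}
  {X Y Z : ∀ x : M, TangentSpace 𝓘(ℝ, V) x} {ξ η : ∀ x : M, TangentSpace 𝓘(ℝ, V) x →L[ℝ] ℝ}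

/-- The term `d(η(X))` in the Lie derivative cancels against Cartan's formula for `dη`, leaving
`(L_X η)(Z) = X(η(Z)) - η([X, Z])`. -/
lemma lieD_sub_contractD_apply (hU : IsOpen U) (hX : SmoothSectionOn V V X U)
    (hY : SmoothSectionOn V V Y U) (hZ : SmoothSectionOn V V Z U)
    (hξ : SmoothSectionOn V (V →L[ℝ] ℝ) ξ U) (hη : SmoothSectionOn V (V →L[ℝ] ℝ) η U)
    {x : M} (hx : x ∈ U) :
    (lieD X η x - contractD ξ Y x) (Z x) =
      dirD X (fun y ↦ η y (Z y)) x - η x (VectorField.mlieBracket 𝓘(ℝ, V) X Z x)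
        - (dirD Y (fun y ↦ ξ y (Z y)) x - dirD Z (fun y ↦ ξ y (Y y)) x
          - ξ x (VectorField.mlieBracket 𝓘(ℝ, V) Y Z x)) := by
  have h1 := extD_one_apply hU hη hX hZ hx
  have h2 := extD_one_apply hU hξ hY hZ hx
  have h3 : (lieD X η x - contractD ξ Y x) (Z x) = contractD η X x (Z x)
      + dirD Z (fun y ↦ η y (X y)) x - contractD ξ Y x (Z x) := rfl
  rw [h3, h1, h2]
  ring

/-- The `2`-form `(v, w) ↦ ⟨s v, t w⟩ - ⟨s w, t v⟩` comparing the splitting `s` with a splitting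
`t`. -/
def AlmostGeneralizedKahler.splitForm (𝓙 : AlmostGeneralizedKahler 𝓔)
    (t : ∀ x, TangentSpace 𝓘(ℝ, V) x →L[ℝ] E x) (x : M) :
    TangentSpace 𝓘(ℝ, V) x [⋀^Fin 2]→L[ℝ] ℝ where
  toFun v := 𝓔.pairing x (𝓙.s x (v 0)) (t x (v 1)) - 𝓔.pairing x (𝓙.s x (v 1)) (t x (v 0))
  map_update_add' := by
    intro _ v i X Y
    fin_cases i <;> simp <;> ring
  map_update_smul' := by
    intro _ v i c X
    fin_cases i <;> simp <;> ring
  cont := by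
    have : FiniteDimensional ℝ (TangentSpace 𝓘(ℝ, V) x) := inferInstanceAs (FiniteDimensional ℝ V)
    have : T2Space (TangentSpace 𝓘(ℝ, V) x) := inferInstanceAs (T2Space V)
    let B : TangentSpace 𝓘(ℝ, V) x →ₗ[ℝ] TangentSpace 𝓘(ℝ, V) x →ₗ[ℝ] ℝ :=
      LinearMap.mk₂ ℝ (fun X Y ↦ 𝓔.pairing x (𝓙.s x X) (t x Y) - 𝓔.pairing x (𝓙.s x Y) (t x X))
        (by intro a b c; simp; ring) (by intro c a b; simp; ring) (by intro a b c; simp; ring)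
        (by intro c a b; simp; ring)
    let B' : V →L[ℝ] V →L[ℝ] ℝ := LinearMap.toContinuousBilinearMap (𝕜 := ℝ) (E := V) (F := V) B
    change Continuous fun v : Fin 2 → V ↦ B' (v 0) (v 1)
    fun_prop
  map_eq_zero_of_eq' := by
    intro v i j hv hij
    have h01 : v 0 = v 1 := by
      fin_cases i <;> fin_cases j <;> simp_all
    rw [h01, sub_self]

namespace AlmostGeneralizedKahler

variable (𝓙 : AlmostGeneralizedKahler 𝓔)

/-- The covector `B(v, ·)` for the `2`-form `B = splitForm`. -/
def splitCovector (t : ∀ x, TangentSpace 𝓘(ℝ, V) x →L[ℝ] E x) (x : M)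
    (v : TangentSpace 𝓘(ℝ, V) x) : TangentSpace 𝓘(ℝ, V) x →L[ℝ] ℝ :=
  (𝓙.splitForm t x).toContinuousMultilinearMap.toContinuousLinearMap ![v, 0] 1

lemma splitCovector_apply (x : M) (v w : TangentSpace 𝓘(ℝ, V) x) :
    𝓙.splitCovector t x v w = 𝓙.splitForm t x ![v, w] := by
  change 𝓙.splitForm t x (Function.update ![v, 0] 1 w) = _
  congr 1
  funext i
  fin_cases i <;> rfl

lemma splitForm_apply (x : M) (v w : TangentSpace 𝓘(ℝ, V) x) :
    𝓙.splitForm t x ![v, w] = 𝓔.pairing x (𝓙.s x v) (t x w) - 𝓔.pairing x (𝓙.s x w) (t x v) := rfl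

lemma splitForm_swap (x : M) (v w : TangentSpace 𝓘(ℝ, V) x) :
    𝓙.splitForm t x ![v, w] = -𝓙.splitForm t x ![w, v] := by
  rw [splitForm_apply, splitForm_apply]
  ring

/-- Write `s v = t v + ξ` and `s w = t w + η`. Isotropy of `s` gives `ξ(w) + η(v) = 0`, while
`splitForm` is `(ξ(w) - η(v)) / 2`; hence it equals `ξ(w)`. Taking the difference in `splitForm`
makes it alternating by construction, even where `t` is not a splitting. -/
lemma s_eq_of_isLocalSplitting (ht : 𝓔.IsLocalSplitting U t) {x : M} (hx : x ∈ U) (v) :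
    𝓙.s x v = t x v + 𝓔.coanchor x (𝓙.splitCovector t x v) := by
  have key : ∀ w, ∃ ξ, 𝓙.s x w = t x w + 𝓔.coanchor x ξ := by
    intro w
    obtain ⟨ξ, hξ⟩ := (𝓔.exact x (𝓙.s x w - t x w)).1
      (by rw [map_sub, anchor_s, ht.anchor x hx, sub_self])
    exact ⟨ξ, by rw [hξ]; abel⟩
  obtain ⟨ξ, hξ⟩ := key v
  have h : ξ = 𝓙.splitCovector t x v := by
    ext w
    obtain ⟨η, hη⟩ := key w
    have h1 := 𝓙.pairing_s_s x v w
    rw [splitCovector_apply, splitForm_apply]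
    rw [hξ, hη] at h1 ⊢
    rw [ht.pairing x hx] at h1
    have h2 := ht.pairing x hx v w ξ 0
    have h3 := ht.pairing x hx w v η 0
    simp only [map_zero, add_zero, zero_apply] at h2 h3
    rw [h2, h3]
    linarith
  rw [hξ, h]

lemma smooth_splitForm (ht : 𝓔.IsLocalSplitting U t) : SmoothFormOn (𝓙.splitForm t) U := by
  intro U' hU' ho X hX
  exact (𝓔.smooth_pairing (𝓙.smooth_s ho (hX 0)) (ht.smooth_apply hU' (hX 1))).sub
    (𝓔.smooth_pairing (𝓙.smooth_s ho (hX 1)) (ht.smooth_apply hU' (hX 0)))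

lemma smooth_splitCovector (ht : 𝓔.IsLocalSplitting U t) (hU' : U' ⊆ U) (ho : IsOpen U')
    (hX : SmoothSectionOn V V X U') :
    SmoothSectionOn V (V →L[ℝ] ℝ) (fun x ↦ 𝓙.splitCovector t x (X x)) U' := by
  refine smooth_covector ho fun W hW hO Y hY ↦ ?_
  refine ContMDiffOn.congr (𝓙.smooth_splitForm ht W (hW.trans hU') hO ![X, Y] ?_) fun x _ ↦ ?_
  · intro i
    fin_cases i
    · exact hX.mono hW
    · exact hY
  · rw [splitCovector_apply]
    congr 1
    funext i
    fin_cases i <;> rfl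

/-- The bracket in terms of the splitting `s`, over the domain of a local splitting `t`. -/
lemma bracket_s_add (ht : 𝓔.IsLocalSplitting U t) (hU' : U' ⊆ U) (ho : IsOpen U')
    (hX : SmoothSectionOn V V X U') (hY : SmoothSectionOn V V Y U')
    (hξ : SmoothSectionOn V (V →L[ℝ] ℝ) ξ U') (hη : SmoothSectionOn V (V →L[ℝ] ℝ) η U')
    {x : M} (hx : x ∈ U') :
    ∃ θ, 𝓔.bracket (fun y ↦ 𝓙.s y (X y) + 𝓔.coanchor y (ξ y))
        (fun y ↦ 𝓙.s y (Y y) + 𝓔.coanchor y (η y)) x =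
          𝓙.s x (VectorField.mlieBracket 𝓘(ℝ, V) X Y x) + 𝓔.coanchor x θ ∧
      ∀ Z, SmoothSectionOn V V Z U' → θ (Z x) = extD (𝓙.splitForm t) x ![X x, Y x, Z x] +
        (dirD X (fun y ↦ η y (Z y)) x - η x (VectorField.mlieBracket 𝓘(ℝ, V) X Z x)
        - (dirD Y (fun y ↦ ξ y (Z y)) x - dirD Z (fun y ↦ ξ y (Y y)) x
          - ξ x (VectorField.mlieBracket 𝓘(ℝ, V) Y Z x))) := by
  have hB := 𝓙.smooth_splitCovector ht hU' ho hX
  have hC := 𝓙.smooth_splitCovector ht hU' ho hY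
  have hbr := ht.bracket U' hU' ho X Y _ _ hX hY (hB.add hξ) (hC.add hη) x hx
  have hcongr : ∀ (X : ∀ x : M, TangentSpace 𝓘(ℝ, V) x) (ξ : ∀ x : M, _ →L[ℝ] ℝ), ∀ᶠ y in 𝓝 x,
      𝓙.s y (X y) + 𝓔.coanchor y (ξ y) =
        t y (X y) + 𝓔.coanchor y (𝓙.splitCovector t y (X y) + ξ y) := by
    intro X ξ
    filter_upwards [ho.mem_nhds hx] with y hy
    rw [𝓙.s_eq_of_isLocalSplitting ht (hU' hy), map_add, add_assoc]
  rw [𝓔.bracket_congr x _ _ _ _ (hcongr X ξ) (hcongr Y η), hbr]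
  -- The covector part relative to `t`, corrected by `B([X, Y], ·)` because `t [X, Y] = s [X, Y] -
  -- B([X, Y], ·)`.
  refine ⟨lieD X (fun y ↦ 𝓙.splitCovector t y (Y y) + η y) x
      - contractD (fun y ↦ 𝓙.splitCovector t y (X y) + ξ y) Y x
      - 𝓙.splitCovector t x (VectorField.mlieBracket 𝓘(ℝ, V) X Y x), ?_, ?_⟩
  · rw [𝓙.s_eq_of_isLocalSplitting ht (hU' hx)]
    have e : ∀ θ₀ θ₁ p, p + 𝓔.coanchor x θ₀ = p + 𝓔.coanchor x θ₁ + 𝓔.coanchor x (θ₀ - θ₁) := by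
      intro θ₀ θ₁ p
      rw [map_sub]
      abel
    exact e _ _ _
  · intro Z hZ
    have h := lieD_sub_contractD_apply ho hX hY hZ (hB.add hξ) (hC.add hη) hx
    rw [sub_apply, h]
    have e := fun {ξ : ∀ x : M, TangentSpace 𝓘(ℝ, V) x →L[ℝ] ℝ} {X}
        (h1 : SmoothSectionOn V (V →L[ℝ] ℝ) ξ U') (h2 : SmoothSectionOn V V X U') ↦
      (h1.covector_apply h2).mdifferentiableAt ho hx
    -- The terms containing `B` assemble into Cartan's formula for `dB(X, Y, Z)`; what remains is
    -- the standard bracket of `ξ` and `η`.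
    have h2 := extD_two_apply ho (fun W hW ↦ 𝓙.smooth_splitForm ht W (hW.trans hU')) hX hY hZ hx
    rw [h2]
    simp only [add_apply]
    rw [dirD_add (e hC hZ) (e hη hZ), dirD_add (e hB hZ) (e hξ hZ), dirD_add (e hB hY) (e hξ hY)]
    simp only [splitCovector_apply]
    rw [𝓙.splitForm_swap x (VectorField.mlieBracket 𝓘(ℝ, V) X Z x),
      𝓙.splitForm_swap x (VectorField.mlieBracket 𝓘(ℝ, V) Y Z x)]
    ring

lemma smooth_zero_covector (hU : IsOpen U) :
    SmoothSectionOn V (V →L[ℝ] ℝ) (fun x : M ↦ (0 : TangentSpace 𝓘(ℝ, V) x →L[ℝ] ℝ)) U :=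
  smooth_covector hU fun _ _ _ _ _ ↦ contMDiffOn_const

/-- The case of sections of `s(TM)`. -/
lemma bracket_s (ht : 𝓔.IsLocalSplitting U t) (hU' : U' ⊆ U) (ho : IsOpen U')
    (hX : SmoothSectionOn V V X U') (hY : SmoothSectionOn V V Y U') {x : M} (hx : x ∈ U') :
    ∃ θ, 𝓔.bracket (fun y ↦ 𝓙.s y (X y)) (fun y ↦ 𝓙.s y (Y y)) x =
          𝓙.s x (VectorField.mlieBracket 𝓘(ℝ, V) X Y x) + 𝓔.coanchor x θ ∧
      ∀ w, θ w = extD (𝓙.splitForm t) x ![X x, Y x, w] := by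
  have hX' := hX.mono (inter_subset_left (t := (chartAt V x).source))
  have hY' := hY.mono (inter_subset_left (t := (chartAt V x).source))
  have hO := ho.inter (chartAt V x).open_source
  obtain ⟨θ, h1, h2⟩ := 𝓙.bracket_s_add ht (inter_subset_left.trans hU') hO hX' hY'
    (smooth_zero_covector hO) (smooth_zero_covector hO)
    ⟨hx, mem_chart_source V x⟩
  simp only [map_zero, add_zero] at h1
  refine ⟨θ, h1, fun w ↦ ?_⟩
  obtain ⟨Z, hZ, rfl⟩ := exists_smoothSection_eq x w
  rw [h2 _ (hZ.mono inter_subset_right)]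
  simp [dirD_zero]

/-- The covector part of `[s X, s Y]` is `dB(X, Y, ·)` for any choice of `t`, and neither the
bracket nor `s` depends on that choice. -/
lemma extD_splitForm_eq (ht : 𝓔.IsLocalSplitting U t) (ht' : 𝓔.IsLocalSplitting U' t') {x : M}
    (hx : x ∈ U) (hx' : x ∈ U') : extD (𝓙.splitForm t) x = extD (𝓙.splitForm t') x := by
  ext v
  have e : v = ![v 0, v 1, v 2] := by funext i; fin_cases i <;> rfl
  rw [e]
  obtain ⟨X, hX, hX0⟩ := exists_smoothSection_eq x (v 0)
  obtain ⟨Y, hY, hY0⟩ := exists_smoothSection_eq x (v 1)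
  have ho := (ht.isOpen.inter ht'.isOpen).inter (chartAt V x).open_source
  have hxx : x ∈ (U ∩ U') ∩ (chartAt V x).source := ⟨⟨hx, hx'⟩, mem_chart_source V x⟩
  obtain ⟨θ, h1, h2⟩ := 𝓙.bracket_s ht (inter_subset_left.trans inter_subset_left) ho
    (hX.mono inter_subset_right) (hY.mono inter_subset_right) hxx
  obtain ⟨θ', h1', h2'⟩ := 𝓙.bracket_s ht' (inter_subset_left.trans inter_subset_right) ho
    (hX.mono inter_subset_right) (hY.mono inter_subset_right) hxx
  rw [h1, add_right_inj] at h1'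
  rw [𝓔.coanchor_injective x h1'] at h2
  rw [← hX0, ← hY0]
  exact (h2 (v 2)).symm.trans (h2' (v 2))

/-- The torsion `3`-form of the splitting `s`. -/
def torsionForm (x : M) : TangentSpace 𝓘(ℝ, V) x [⋀^Fin 3]→L[ℝ] ℝ :=
  -extD (𝓙.splitForm (𝓔.exists_isLocalSplitting x).choose_spec.choose) x

/-- The definition chooses a local splitting at each point separately. Independence of the choice
makes `H` equal to `-dB` for one fixed `t` on a whole neighbourhood, as needed for smoothness and
closedness. -/
lemma torsionForm_eq (ht : 𝓔.IsLocalSplitting U t) {x : M} (hx : x ∈ U) :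
    𝓙.torsionForm x = -extD (𝓙.splitForm t) x := by
  have h := (𝓔.exists_isLocalSplitting x).choose_spec.choose_spec
  rw [torsionForm, 𝓙.extD_splitForm_eq h.2 ht h.1 hx]

lemma torsionForm_swap (x : M) (u v w : TangentSpace 𝓘(ℝ, V) x) :
    𝓙.torsionForm x ![u, v, w] = -𝓙.torsionForm x ![v, u, w] := by
  have h := (𝓙.torsionForm x).toAlternatingMap.map_swap ![v, u, w] (i := 0) (j := 1) (by decide)
  have e : ![v, u, w] ∘ Equiv.swap (0 : Fin 3) 1 = ![u, v, w] := by
    funext i; fin_cases i <;> rfl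
  rw [e] at h
  exact h

lemma isSmoothForm_torsionForm : IsSmoothForm 𝓙.torsionForm := by
  intro U hU X hX x hx
  obtain ⟨U₀, t, hxU₀, ht⟩ := 𝓔.exists_isLocalSplitting x
  have h := (𝓙.smooth_splitForm ht).extD_two (U ∩ U₀) inter_subset_right (hU.inter ht.isOpen) X
    fun i ↦ (hX i).mono inter_subset_left
  have hn := (hU.inter ht.isOpen).mem_nhds ⟨hx, hxU₀⟩
  refine ContMDiffAt.contMDiffWithinAt ?_
  refine (h.contMDiffAt hn).neg.congr_of_eventuallyEq ?_
  filter_upwards [hn] with y hy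
  rw [𝓙.torsionForm_eq ht hy.2]
  rfl

lemma extD_torsionForm (x : M) : extD 𝓙.torsionForm x = 0 := by
  obtain ⟨U, t, hx, ht⟩ := 𝓔.exists_isLocalSplitting x
  have h : ∀ᶠ y in 𝓝 x, 𝓙.torsionForm y = -extD (𝓙.splitForm t) y := by
    filter_upwards [ht.isOpen.mem_nhds hx] with y hy
    exact 𝓙.torsionForm_eq ht hy
  rw [extD_congr h, extD_neg, extD_extD ht.isOpen (𝓙.smooth_splitForm ht) hx, neg_zero]

/-- The sign in `H = -dB` comes from the convention `i_X i_Y H = H(Y, X, ·)`: the bracket produces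
`dB(X, Y, ·) = -dB(Y, X, ·)`. -/
lemma isTorsionForm_torsionForm : 𝓔.IsTorsionForm 𝓙.s 𝓙.torsionForm := by
  intro U hU X Y hX hY x hx
  obtain ⟨U₀, t, hxU₀, ht⟩ := 𝓔.exists_isLocalSplitting x
  obtain ⟨θ, h1, h2⟩ := 𝓙.bracket_s ht inter_subset_right (hU.inter ht.isOpen)
    (hX.mono inter_subset_left) (hY.mono inter_subset_left) ⟨hx, hxU₀⟩
  rw [h1]
  congr 2
  ext w
  rw [h2 w]
  have e : Function.update ![Y x, X x, 0] 2 w = ![Y x, X x, w] := by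
    funext i; fin_cases i <;> rfl
  change _ = 𝓙.torsionForm x (Function.update ![Y x, X x, 0] 2 w)
  rw [e, torsionForm_swap, 𝓙.torsionForm_eq ht hxU₀]
  simp

lemma eq_torsionForm {H : ∀ x : M, TangentSpace 𝓘(ℝ, V) x [⋀^Fin 3]→L[ℝ] ℝ}
    (hH : 𝓔.IsTorsionForm 𝓙.s H) : H = 𝓙.torsionForm := by
  funext x
  ext v
  -- The torsion identity for `X`, `Y` evaluates `H` with `Y` in slot `0` and `X` in slot `1`.
  obtain ⟨X, hX, hX0⟩ := exists_smoothSection_eq x (v 1)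
  obtain ⟨Y, hY, hY0⟩ := exists_smoothSection_eq x (v 0)
  have hx : x ∈ (chartAt V x).source := mem_chart_source V x
  have h1 := hH _ (chartAt V x).open_source _ _ hX hY x hx
  have h2 := 𝓙.isTorsionForm_torsionForm _ (chartAt V x).open_source _ _ hX hY x hx
  rw [h1, add_right_inj] at h2
  have h3 := congrArg (fun L ↦ L (v 2)) (𝓔.coanchor_injective x h2)
  have e : Function.update ![Y x, X x, 0] 2 (v 2) = v := by
    rw [hX0, hY0]
    funext i; fin_cases i <;> rfl
  change H x (Function.update _ 2 (v 2)) = 𝓙.torsionForm x (Function.update _ 2 (v 2)) at h3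
  rwa [e] at h3

end AlmostGeneralizedKahler

end Torsion

/-! ### Biadditivity of the Courant bracket -/

section BracketAdd

variable {V : Type*} [NormedAddCommGroup V] [NormedSpace ℝ V] [FiniteDimensional ℝ V]
  {M : Type*} [TopologicalSpace M] [ChartedSpace V M] [IsManifold 𝓘(ℝ, V) ∞ M] {U U' : Set M}
  {F : Type*} [NormedAddCommGroup F] [NormedSpace ℝ F]
  {E : M → Type*} [TopologicalSpace (TotalSpace F E)] [∀ x, AddCommGroup (E x)]
  [∀ x, Module ℝ (E x)] [∀ x, TopologicalSpace (E x)]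
  [∀ x, IsTopologicalAddGroup (E x)] [∀ x, ContinuousSMul ℝ (E x)]
  [FiberBundle F E] [VectorBundle ℝ F E] [ContMDiffVectorBundle ∞ F E 𝓘(ℝ, V)]
  {𝓔 : CourantAlgebroid V M F E} {t : ∀ x, TangentSpace 𝓘(ℝ, V) x →L[ℝ] E x}
  {a a' b b' : ∀ x, E x}

lemma mlieBracket_add_left_of_smooth {X X' Y : ∀ x : M, TangentSpace 𝓘(ℝ, V) x} (hU : IsOpen U)
    (hX : SmoothSectionOn V V X U) (hX' : SmoothSectionOn V V X' U) {x : M} (hx : x ∈ U) :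
    VectorField.mlieBracket 𝓘(ℝ, V) (fun y ↦ X y + X' y) Y x =
      VectorField.mlieBracket 𝓘(ℝ, V) X Y x + VectorField.mlieBracket 𝓘(ℝ, V) X' Y x :=
  VectorField.mlieBracket_add_left (hX.mdifferentiableAt hU hx) (hX'.mdifferentiableAt hU hx)

lemma mlieBracket_add_right_of_smooth {X Y Y' : ∀ x : M, TangentSpace 𝓘(ℝ, V) x} (hU : IsOpen U)
    (hY : SmoothSectionOn V V Y U) (hY' : SmoothSectionOn V V Y' U) {x : M} (hx : x ∈ U) :
    VectorField.mlieBracket 𝓘(ℝ, V) X (fun y ↦ Y y + Y' y) x =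
      VectorField.mlieBracket 𝓘(ℝ, V) X Y x + VectorField.mlieBracket 𝓘(ℝ, V) X Y' x :=
  VectorField.mlieBracket_add_right (hY.mdifferentiableAt hU hx) (hY'.mdifferentiableAt hU hx)

variable (𝓔) in
/-- The covector part `2⟨a, t ·⟩` of an element `a` of `E` with respect to a local splitting. -/
def CourantAlgebroid.covectorPart (t : ∀ x, TangentSpace 𝓘(ℝ, V) x →L[ℝ] E x) (x : M) (a : E x) :
    TangentSpace 𝓘(ℝ, V) x →L[ℝ] ℝ := (2 : ℝ) • (𝓔.pairing x a).comp (t x)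

lemma CourantAlgebroid.covectorPart_add (x : M) (a b : E x) :
    𝓔.covectorPart t x (a + b) = 𝓔.covectorPart t x a + 𝓔.covectorPart t x b := by
  ext v
  simp only [covectorPart, map_add, smul_apply, add_apply, ContinuousLinearMap.comp_apply, smul_eq_mul]
  ring

lemma CourantAlgebroid.IsLocalSplitting.eq_add (ht : 𝓔.IsLocalSplitting U t) {x : M} (hx : x ∈ U)
    (a : E x) : a = t x (𝓔.anchor x a) + 𝓔.coanchor x (𝓔.covectorPart t x a) := by
  obtain ⟨ζ, hζ⟩ := (𝓔.exact x (a - t x (𝓔.anchor x a))).1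
    (by rw [map_sub, ht.anchor x hx, sub_self])
  have ha : a = t x (𝓔.anchor x a) + 𝓔.coanchor x ζ := by rw [hζ]; abel
  have h : ζ = 𝓔.covectorPart t x a := by
    ext v
    have h2 := ht.pairing x hx (𝓔.anchor x a) v ζ 0
    rw [← ha] at h2
    simp only [map_zero, add_zero, zero_apply] at h2
    change ζ v = 2 * 𝓔.pairing x a (t x v)
    rw [h2]
    ring
  rwa [← h]

lemma CourantAlgebroid.IsLocalSplitting.smooth_covectorPart (ht : 𝓔.IsLocalSplitting U t)
    (hU' : U' ⊆ U) (ho : IsOpen U') (ha : SmoothSectionOn V F a U') :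
    SmoothSectionOn V (V →L[ℝ] ℝ) (fun x ↦ 𝓔.covectorPart t x (a x)) U' := by
  refine smooth_covector ho fun W hW hO Y hY ↦ ?_
  exact ContMDiffOn.mul contMDiffOn_const
    (𝓔.smooth_pairing (ha.mono hW) (ht.smooth_apply (hW.trans hU') hY))

lemma CourantAlgebroid.IsLocalSplitting.bracket_eq (ht : 𝓔.IsLocalSplitting U t)
    (hU' : U' ⊆ U) (ho : IsOpen U') (ha : SmoothSectionOn V F a U')
    (hb : SmoothSectionOn V F b U') {x : M} (hx : x ∈ U') :
    𝓔.bracket a b x =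
      t x (VectorField.mlieBracket 𝓘(ℝ, V) (fun y ↦ 𝓔.anchor y (a y)) (fun y ↦ 𝓔.anchor y (b y)) x)
      + 𝓔.coanchor x (lieD (fun y ↦ 𝓔.anchor y (a y)) (fun y ↦ 𝓔.covectorPart t y (b y)) x
        - contractD (fun y ↦ 𝓔.covectorPart t y (a y)) (fun y ↦ 𝓔.anchor y (b y)) x) := by
  have hcongr : ∀ a : ∀ x, E x, ∀ᶠ y in 𝓝 x,
      a y = t y (𝓔.anchor y (a y)) + 𝓔.coanchor y (𝓔.covectorPart t y (a y)) := by
    intro a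
    filter_upwards [ho.mem_nhds hx] with y hy
    exact ht.eq_add (hU' hy) _
  rw [𝓔.bracket_congr x _ _ _ _ (hcongr a) (hcongr b)]
  exact ht.bracket U' hU' ho _ _ _ _ (𝓔.smooth_anchor ha) (𝓔.smooth_anchor hb)
    (ht.smooth_covectorPart hU' ho ha) (ht.smooth_covectorPart hU' ho hb) x hx

/-- Additivity is not among the axioms and is read off from the local model. It is needed to split
arguments into their `C₊` and `C₋` components. -/
lemma CourantAlgebroid.bracket_add_left (hU : IsOpen U) (ha : SmoothSectionOn V F a U)
    (ha' : SmoothSectionOn V F a' U) (hb : SmoothSectionOn V F b U) {x : M} (hx : x ∈ U) :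
    𝓔.bracket (fun y ↦ a y + a' y) b x = 𝓔.bracket a b x + 𝓔.bracket a' b x := by
  obtain ⟨U₀, t, hxU₀, ht⟩ := 𝓔.exists_isLocalSplitting x
  set W := U ∩ U₀ ∩ (chartAt V x).source with hW
  have hWo : IsOpen W := (hU.inter ht.isOpen).inter (chartAt V x).open_source
  have hWx : x ∈ W := ⟨⟨hx, hxU₀⟩, mem_chart_source V x⟩
  have hWU : W ⊆ U := inter_subset_left.trans inter_subset_left
  have hWU₀ : W ⊆ U₀ := inter_subset_left.trans inter_subset_right
  have sa : SmoothSectionOn V F a W := ha.mono hWU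
  have sa' : SmoothSectionOn V F a' W := ha'.mono hWU
  have sb : SmoothSectionOn V F b W := hb.mono hWU
  rw [ht.bracket_eq hWU₀ hWo sa sb hWx, ht.bracket_eq hWU₀ hWo sa' sb hWx,
    ht.bracket_eq hWU₀ hWo (sa.add sa') sb hWx]
  simp only [map_add]
  rw [mlieBracket_add_left_of_smooth hWo (𝓔.smooth_anchor sa) (𝓔.smooth_anchor sa') hWx, map_add]
  -- Two covectors are compared on a vector extended to a field `Z`, where each side becomes
  -- directional derivatives and Lie brackets, both additive on smooth data.
  have key : lieD (fun y ↦ 𝓔.anchor y (a y) + 𝓔.anchor y (a' y))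
        (fun y ↦ 𝓔.covectorPart t y (b y)) x
        - contractD (fun y ↦ 𝓔.covectorPart t y (a y + a' y)) (fun y ↦ 𝓔.anchor y (b y)) x =
      (lieD (fun y ↦ 𝓔.anchor y (a y)) (fun y ↦ 𝓔.covectorPart t y (b y)) x
        - contractD (fun y ↦ 𝓔.covectorPart t y (a y)) (fun y ↦ 𝓔.anchor y (b y)) x) +
      (lieD (fun y ↦ 𝓔.anchor y (a' y)) (fun y ↦ 𝓔.covectorPart t y (b y)) x
        - contractD (fun y ↦ 𝓔.covectorPart t y (a' y)) (fun y ↦ 𝓔.anchor y (b y)) x) := by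
    ext w
    obtain ⟨Z, hZ, rfl⟩ := exists_smoothSection_eq x w
    have sZ : SmoothSectionOn V V Z W := hZ.mono inter_subset_right
    have pa := 𝓔.smooth_anchor sa
    have pa' := 𝓔.smooth_anchor sa'
    have pb := 𝓔.smooth_anchor sb
    have ca := ht.smooth_covectorPart hWU₀ hWo sa
    have ca' := ht.smooth_covectorPart hWU₀ hWo sa'
    have cb := ht.smooth_covectorPart hWU₀ hWo sb
    rw [add_apply, lieD_sub_contractD_apply hWo pa pb sZ ca cb hWx,
      lieD_sub_contractD_apply hWo pa' pb sZ ca' cb hWx,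
      lieD_sub_contractD_apply hWo (pa.add pa') pb sZ
        (ht.smooth_covectorPart hWU₀ hWo (sa.add sa')) cb hWx]
    simp only [𝓔.covectorPart_add, add_apply]
    rw [mlieBracket_add_left_of_smooth hWo pa pa' hWx, map_add,
      dirD_add ((ca.covector_apply sZ).mdifferentiableAt hWo hWx)
        ((ca'.covector_apply sZ).mdifferentiableAt hWo hWx),
      dirD_add ((ca.covector_apply pb).mdifferentiableAt hWo hWx)
        ((ca'.covector_apply pb).mdifferentiableAt hWo hWx)]
    simp only [dirD, map_add]
    ring
  rw [key, map_add]
  abel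

lemma CourantAlgebroid.bracket_add_right (hU : IsOpen U) (ha : SmoothSectionOn V F a U)
    (hb : SmoothSectionOn V F b U) (hb' : SmoothSectionOn V F b' U) {x : M} (hx : x ∈ U) :
    𝓔.bracket a (fun y ↦ b y + b' y) x = 𝓔.bracket a b x + 𝓔.bracket a b' x := by
  obtain ⟨U₀, t, hxU₀, ht⟩ := 𝓔.exists_isLocalSplitting x
  set W := U ∩ U₀ ∩ (chartAt V x).source with hW
  have hWo : IsOpen W := (hU.inter ht.isOpen).inter (chartAt V x).open_source
  have hWx : x ∈ W := ⟨⟨hx, hxU₀⟩, mem_chart_source V x⟩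
  have hWU : W ⊆ U := inter_subset_left.trans inter_subset_left
  have hWU₀ : W ⊆ U₀ := inter_subset_left.trans inter_subset_right
  have sa : SmoothSectionOn V F a W := ha.mono hWU
  have sb : SmoothSectionOn V F b W := hb.mono hWU
  have sb' : SmoothSectionOn V F b' W := hb'.mono hWU
  rw [ht.bracket_eq hWU₀ hWo sa sb hWx, ht.bracket_eq hWU₀ hWo sa sb' hWx,
    ht.bracket_eq hWU₀ hWo sa (sb.add sb') hWx]
  simp only [map_add]
  rw [mlieBracket_add_right_of_smooth hWo (𝓔.smooth_anchor sb) (𝓔.smooth_anchor sb') hWx, map_add]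
  have key : lieD (fun y ↦ 𝓔.anchor y (a y)) (fun y ↦ 𝓔.covectorPart t y (b y + b' y)) x
        - contractD (fun y ↦ 𝓔.covectorPart t y (a y))
          (fun y ↦ 𝓔.anchor y (b y) + 𝓔.anchor y (b' y)) x =
      (lieD (fun y ↦ 𝓔.anchor y (a y)) (fun y ↦ 𝓔.covectorPart t y (b y)) x
        - contractD (fun y ↦ 𝓔.covectorPart t y (a y)) (fun y ↦ 𝓔.anchor y (b y)) x) +
      (lieD (fun y ↦ 𝓔.anchor y (a y)) (fun y ↦ 𝓔.covectorPart t y (b' y)) x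
        - contractD (fun y ↦ 𝓔.covectorPart t y (a y)) (fun y ↦ 𝓔.anchor y (b' y)) x) := by
    ext w
    obtain ⟨Z, hZ, rfl⟩ := exists_smoothSection_eq x w
    have sZ : SmoothSectionOn V V Z W := hZ.mono inter_subset_right
    have pa := 𝓔.smooth_anchor sa
    have pb := 𝓔.smooth_anchor sb
    have pb' := 𝓔.smooth_anchor sb'
    have ca := ht.smooth_covectorPart hWU₀ hWo sa
    have cb := ht.smooth_covectorPart hWU₀ hWo sb
    have cb' := ht.smooth_covectorPart hWU₀ hWo sb'
    rw [add_apply, lieD_sub_contractD_apply hWo pa pb sZ ca cb hWx,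
      lieD_sub_contractD_apply hWo pa pb' sZ ca cb' hWx,
      lieD_sub_contractD_apply hWo pa (pb.add pb') sZ ca
        (ht.smooth_covectorPart hWU₀ hWo (sb.add sb')) hWx]
    simp only [𝓔.covectorPart_add, add_apply, map_add]
    rw [mlieBracket_add_left_of_smooth hWo pb pb' hWx, map_add,
      dirD_add ((cb.covector_apply sZ).mdifferentiableAt hWo hWx)
        ((cb'.covector_apply sZ).mdifferentiableAt hWo hWx),
      dirD_add ((ca.covector_apply pb).mdifferentiableAt hWo hWx)
        ((ca.covector_apply pb').mdifferentiableAt hWo hWx)]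
    simp only [dirD, map_add]
    ring
  rw [key, map_add]
  abel

end BracketAdd

/-! ### The Nijenhuis operator of the Courant bracket -/

section Nijenhuis

variable {V : Type*} [NormedAddCommGroup V] [NormedSpace ℝ V] [FiniteDimensional ℝ V]
  {M : Type*} [TopologicalSpace M] [ChartedSpace V M] [IsManifold 𝓘(ℝ, V) ∞ M] {U : Set M}
  {F : Type*} [NormedAddCommGroup F] [NormedSpace ℝ F]
  {E : M → Type*} [TopologicalSpace (TotalSpace F E)] [∀ x, AddCommGroup (E x)]
  [∀ x, Module ℝ (E x)] [∀ x, TopologicalSpace (E x)]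
  [∀ x, IsTopologicalAddGroup (E x)] [∀ x, ContinuousSMul ℝ (E x)]
  [FiberBundle F E] [VectorBundle ℝ F E] [ContMDiffVectorBundle ∞ F E 𝓘(ℝ, V)]
  {𝓔 : CourantAlgebroid V M F E} {a a' b b' : ∀ x, E x}

namespace AlmostGeneralizedComplex

variable (𝓐 : AlmostGeneralizedComplex 𝓔)

/-- The Nijenhuis operator of `J` for the Courant bracket. -/
def courantNijenhuis (a b : ∀ x, E x) (x : M) : E x :=
  nijenhuis 𝓔.bracket (fun x ↦ (𝓐.J x).toLinearMap) a b x

lemma isIntegrable_iff : 𝓐.IsIntegrable ↔ ∀ U : Set M, IsOpen U → ∀ a b : ∀ x, E x,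
    SmoothSectionOn V F a U → SmoothSectionOn V F b U → ∀ x ∈ U, 𝓐.courantNijenhuis a b x = 0 :=
  isInvolutive_eigenI_iff F 𝓔.bracket_congr 𝓐.sq fun _ _ _ ha ↦ 𝓐.smooth_apply ha

lemma courantNijenhuis_add_left (hU : IsOpen U) (ha : SmoothSectionOn V F a U)
    (ha' : SmoothSectionOn V F a' U) (hb : SmoothSectionOn V F b U) {x : M} (hx : x ∈ U) :
    𝓐.courantNijenhuis (fun y ↦ a y + a' y) b x =
      𝓐.courantNijenhuis a b x + 𝓐.courantNijenhuis a' b x := by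
  simp only [courantNijenhuis, nijenhuis, ContinuousLinearMap.coe_coe, map_add]
  rw [𝓔.bracket_add_left hU ha ha' hb hx,
    𝓔.bracket_add_left hU (𝓐.smooth_apply ha) (𝓐.smooth_apply ha') hb hx,
    𝓔.bracket_add_left hU ha ha' (𝓐.smooth_apply hb) hx,
    𝓔.bracket_add_left hU (𝓐.smooth_apply ha) (𝓐.smooth_apply ha') (𝓐.smooth_apply hb) hx]
  simp only [map_add]
  abel

lemma courantNijenhuis_add_right (hU : IsOpen U) (ha : SmoothSectionOn V F a U)
    (hb : SmoothSectionOn V F b U) (hb' : SmoothSectionOn V F b' U) {x : M} (hx : x ∈ U) :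
    𝓐.courantNijenhuis a (fun y ↦ b y + b' y) x =
      𝓐.courantNijenhuis a b x + 𝓐.courantNijenhuis a b' x := by
  simp only [courantNijenhuis, nijenhuis, ContinuousLinearMap.coe_coe, map_add]
  rw [𝓔.bracket_add_right hU ha hb hb' hx,
    𝓔.bracket_add_right hU (𝓐.smooth_apply ha) hb hb' hx,
    𝓔.bracket_add_right hU ha (𝓐.smooth_apply hb) (𝓐.smooth_apply hb') hx,
    𝓔.bracket_add_right hU (𝓐.smooth_apply ha) (𝓐.smooth_apply hb) (𝓐.smooth_apply hb') hx]
  simp only [map_add]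
  abel

end AlmostGeneralizedComplex

namespace AlmostGeneralizedKahler

variable (𝓙 : AlmostGeneralizedKahler 𝓔)

lemma exists_eq_sC_add (a : ∀ x, E x) : ∃ X Y : ∀ x : M, TangentSpace 𝓘(ℝ, V) x,
    a = (fun x ↦ 𝓙.sC 1 x (X x) + 𝓙.sC (-1) x (Y x)) ∧
    ∀ U, SmoothSectionOn V F a U → SmoothSectionOn V V X U ∧ SmoothSectionOn V V Y U := by
  -- The projection `(1 + ε G) / 2` onto `C_ε`; its composite with `π` gives `X` and `Y`.
  have hmem : ∀ (ε : ℤˣ) x, (2⁻¹ : ℝ) • (a x + ((ε : ℤ) : ℝ) • 𝓙.G x (a x)) ∈ 𝓙.C ε x := by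
    intro ε x
    rw [mem_C]
    simp only [map_add, map_smul, G_G]
    rw [smul_comm, smul_add (((ε : ℤ) : ℝ)), smul_smul (((ε : ℤ) : ℝ)), unit_sq, one_smul, add_comm]
  refine ⟨fun x ↦ 𝓔.anchor x ((2⁻¹ : ℝ) • (a x + (((1 : ℤˣ) : ℤ) : ℝ) • 𝓙.G x (a x))),
    fun x ↦ 𝓔.anchor x ((2⁻¹ : ℝ) • (a x + (((-1 : ℤˣ) : ℤ) : ℝ) • 𝓙.G x (a x))), ?_, ?_⟩
  · funext x
    rw [𝓙.sC_anchor (hmem 1 x), 𝓙.sC_anchor (hmem (-1) x)]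
    simp only [Units.val_one, Units.val_neg, Int.cast_one, Int.cast_neg]
    module
  · intro U ha
    have h := fun c : ℝ ↦
      𝓔.smooth_anchor ((ha.add ((𝓙.smooth_G ha).const_smul c)).const_smul 2⁻¹)
    exact ⟨h _, h _⟩

lemma eq_zero_of_pairing_sC {x : M} {a : E x} (h : ∀ (γ : ℤˣ) w, 𝓔.pairing x a (𝓙.sC γ x w) = 0) :
    a = 0 := by
  classical
  refine 𝓔.pairing_nondegenerate x a fun b ↦ ?_
  -- Only the value at `x` is used, so any section through `b` serves, smooth or not.
  obtain ⟨X, Y, hb, -⟩ := 𝓙.exists_eq_sC_add (Function.update 0 x b)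
  have hb' := congrFun hb x
  rw [Function.update_self] at hb'
  rw [hb', map_add, h, h, add_zero]

/-- `J` is integrable if and only if its Nijenhuis operator vanishes on sections of `C_±`. -/
lemma isIntegrable_iff_sC (𝓐 : AlmostGeneralizedComplex 𝓔) : 𝓐.IsIntegrable ↔
    ∀ (ε δ γ : ℤˣ) (U : Set M), IsOpen U → ∀ X Y Z : ∀ x : M, TangentSpace 𝓘(ℝ, V) x,
      SmoothSectionOn V V X U → SmoothSectionOn V V Y U → SmoothSectionOn V V Z U → ∀ x ∈ U,
      𝓔.pairing x (𝓐.courantNijenhuis (fun y ↦ 𝓙.sC ε y (X y)) (fun y ↦ 𝓙.sC δ y (Y y)) x)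
        (𝓙.sC γ x (Z x)) = 0 := by
  rw [𝓐.isIntegrable_iff]
  constructor
  · intro h ε δ γ U hU X Y Z hX hY _ x hx
    rw [h U hU _ _ (𝓙.smooth_sC ε hU hX) (𝓙.smooth_sC δ hU hY) x hx, map_zero, zero_apply]
  · intro h U hU a b ha hb x hx
    have key : ∀ (ε δ : ℤˣ) (X Y : ∀ x : M, TangentSpace 𝓘(ℝ, V) x), SmoothSectionOn V V X U →
        SmoothSectionOn V V Y U →
        𝓐.courantNijenhuis (fun y ↦ 𝓙.sC ε y (X y)) (fun y ↦ 𝓙.sC δ y (Y y)) x = 0 := by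
      intro ε δ X Y hX hY
      refine 𝓙.eq_zero_of_pairing_sC fun γ w ↦ ?_
      obtain ⟨Z, hZ, rfl⟩ := exists_smoothSection_eq x w
      exact h ε δ γ (U ∩ (chartAt V x).source) (hU.inter (chartAt V x).open_source) X Y Z
        (hX.mono inter_subset_left) (hY.mono inter_subset_left) (hZ.mono inter_subset_right) x
        ⟨hx, mem_chart_source V x⟩
    obtain ⟨X, X', rfl, hX⟩ := 𝓙.exists_eq_sC_add a
    obtain ⟨Y, Y', rfl, hY⟩ := 𝓙.exists_eq_sC_add b
    obtain ⟨hX, hX'⟩ := hX U ha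
    obtain ⟨hY, hY'⟩ := hY U hb
    rw [𝓐.courantNijenhuis_add_left hU (𝓙.smooth_sC _ hU hX) (𝓙.smooth_sC _ hU hX') hb hx,
      𝓐.courantNijenhuis_add_right hU (𝓙.smooth_sC _ hU hX) (𝓙.smooth_sC _ hU hY)
        (𝓙.smooth_sC _ hU hY') hx,
      𝓐.courantNijenhuis_add_right hU (𝓙.smooth_sC _ hU hX') (𝓙.smooth_sC _ hU hY)
        (𝓙.smooth_sC _ hU hY') hx, key _ _ _ _ hX hY, key _ _ _ _ hX hY', key _ _ _ _ hX' hY,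
      key _ _ _ _ hX' hY']
    simp

end AlmostGeneralizedKahler

end Nijenhuis

/-! ### Brackets as trilinear expressions on vector fields -/

section Signs

variable {V : Type*} [NormedAddCommGroup V] [NormedSpace ℝ V]
  {M : Type*} [TopologicalSpace M] [ChartedSpace V M]
  {X Y : ∀ x : M, TangentSpace 𝓘(ℝ, V) x} {f : M → ℝ} {x : M}

lemma dirD_neg : dirD X (fun y ↦ -f y) x = -dirD X f x := by
  have h := mvfderiv_neg (I := 𝓘(ℝ, V)) (g := f) (x := x)
  exact congrArg (fun L : TangentSpace 𝓘(ℝ, V) x →L[ℝ] ℝ ↦ L (X x)) h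

lemma dirD_smul_left (c : ℝ) : dirD (fun y ↦ c • X y) f x = c * dirD X f x := by
  simp [dirD]

end Signs

section Trilinear

variable {V : Type*} [NormedAddCommGroup V] [NormedSpace ℝ V] [FiniteDimensional ℝ V]
  {M : Type*} [TopologicalSpace M] [ChartedSpace V M] [IsManifold 𝓘(ℝ, V) ∞ M] {U : Set M}
  {F : Type*} [NormedAddCommGroup F] [NormedSpace ℝ F]
  {E : M → Type*} [TopologicalSpace (TotalSpace F E)] [∀ x, AddCommGroup (E x)]
  [∀ x, Module ℝ (E x)] [∀ x, TopologicalSpace (E x)]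
  [∀ x, IsTopologicalAddGroup (E x)] [∀ x, ContinuousSMul ℝ (E x)]
  [FiberBundle F E] [VectorBundle ℝ F E] [ContMDiffVectorBundle ∞ F E 𝓘(ℝ, V)]
  {𝓔 : CourantAlgebroid V M F E}
  {X Y Z : ∀ x : M, TangentSpace 𝓘(ℝ, V) x} {x : M}

lemma mlieBracket_smul_left_of_smooth (c : ℝ) (hU : IsOpen U) (hX : SmoothSectionOn V V X U)
    (hx : x ∈ U) : VectorField.mlieBracket 𝓘(ℝ, V) (fun y ↦ c • X y) Y x =
      c • VectorField.mlieBracket 𝓘(ℝ, V) X Y x :=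
  VectorField.mlieBracket_const_smul_left (hX.mdifferentiableAt hU hx)

lemma mlieBracket_smul_right_of_smooth (c : ℝ) (hU : IsOpen U) (hY : SmoothSectionOn V V Y U)
    (hx : x ∈ U) : VectorField.mlieBracket 𝓘(ℝ, V) X (fun y ↦ c • Y y) x =
      c • VectorField.mlieBracket 𝓘(ℝ, V) X Y x :=
  VectorField.mlieBracket_const_smul_right (hY.mdifferentiableAt hU hx)

lemma map_smul_three {W : Type*} [AddCommGroup W] [Module ℝ W] [TopologicalSpace W]
    (α : W [⋀^Fin 3]→L[ℝ] ℝ) (c : ℝ) (u v w : W) :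
    α ![c • u, v, w] = c * α ![u, v, w] ∧ α ![u, c • v, w] = c * α ![u, v, w] ∧
      α ![u, v, c • w] = c * α ![u, v, w] := by
  have h := fun (v' v'' : Fin 3 → W) i z (e : Function.update ![u, v, w] i (c • z) = v')
      (e' : Function.update ![u, v, w] i z = v'') ↦
    (congrArg α e.symm).trans ((α.toAlternatingMap.map_update_smul ![u, v, w] i c z).trans
      (congrArg (fun t ↦ c • α t) e'))
  refine ⟨h _ _ 0 u ?_ ?_, h _ _ 1 v ?_ ?_, h _ _ 2 w ?_ ?_⟩ <;>
    (funext i; fin_cases i <;> rfl)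

lemma map_swap_three {W : Type*} [AddCommGroup W] [Module ℝ W] [TopologicalSpace W]
    (α : W [⋀^Fin 3]→L[ℝ] ℝ) (u v w : W) :
    α ![v, u, w] = -α ![u, v, w] ∧ α ![u, w, v] = -α ![u, v, w] := by
  have h := fun (v' : Fin 3 → W) i j hij (e : ![u, v, w] ∘ Equiv.swap i j = v') ↦
    (congrArg α e.symm).trans (α.toAlternatingMap.map_swap ![u, v, w] (i := i) (j := j) hij)
  refine ⟨h _ 0 1 (by decide) ?_, h _ 1 2 (by decide) ?_⟩ <;>
    (funext i; fin_cases i <;> rfl)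

namespace AlmostGeneralizedKahler

variable (𝓙 : AlmostGeneralizedKahler 𝓔)

lemma g_smul_left (c : ℝ) (x : M) (v w) : 𝓙.g x (c • v) w = c * 𝓙.g x v w := by simp [g]

lemma g_smul_right (c : ℝ) (x : M) (v w) : 𝓙.g x v (c • w) = c * 𝓙.g x v w := by simp [g]

lemma g_neg_left (x : M) (v w) : 𝓙.g x (-v) w = -𝓙.g x v w := by simp [g]

lemma g_neg_right (x : M) (v w) : 𝓙.g x v (-w) = -𝓙.g x v w := by simp [g]

lemma g_I_left (ε : ℤˣ) (x : M) (v w) : 𝓙.g x (𝓙.I ε x v) w = -𝓙.g x v (𝓙.I ε x w) := by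
  rw [← 𝓙.g_I_I ε x (𝓙.I ε x v), I_I, g_neg_left]

/-- The trilinear expression `2⟨[s_ε X, s_δ Y], s_γ Z⟩` in terms of `g` and the torsion. -/
def bracketForm (ε δ γ : ℤˣ) (X Y Z : ∀ x : M, TangentSpace 𝓘(ℝ, V) x) (x : M) : ℝ :=
  𝓙.torsionForm x ![Y x, X x, Z x]
  + ((δ : ℤ) : ℝ) * (dirD X (fun y ↦ 𝓙.g y (Y y) (Z y)) x
    - 𝓙.g x (Y x) (VectorField.mlieBracket 𝓘(ℝ, V) X Z x))
  - ((ε : ℤ) : ℝ) * (dirD Y (fun y ↦ 𝓙.g y (X y) (Z y)) x - dirD Z (fun y ↦ 𝓙.g y (X y) (Y y)) x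
    - 𝓙.g x (X x) (VectorField.mlieBracket 𝓘(ℝ, V) Y Z x))
  + ((γ : ℤ) : ℝ) * 𝓙.g x (Z x) (VectorField.mlieBracket 𝓘(ℝ, V) X Y x)

/-- Insert `s_ε X = s X + ε g(X, ·)` into `bracket_s_add` and pair with `s Z + γ g(Z, ·)`. The
initial `2` cancels the factor `1/2` in the pairing. -/
lemma two_mul_pairing_bracket (ε δ γ : ℤˣ) (hU : IsOpen U) (hX : SmoothSectionOn V V X U)
    (hY : SmoothSectionOn V V Y U) (hZ : SmoothSectionOn V V Z U) (hx : x ∈ U) :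
    2 * 𝓔.pairing x (𝓔.bracket (fun y ↦ 𝓙.sC ε y (X y)) (fun y ↦ 𝓙.sC δ y (Y y)) x)
      (𝓙.sC γ x (Z x)) = 𝓙.bracketForm ε δ γ X Y Z x := by
  obtain ⟨U₀, t, hxU₀, ht⟩ := 𝓔.exists_isLocalSplitting x
  have ho := hU.inter ht.isOpen
  have sX := hX.mono (inter_subset_left (t := U₀))
  have sY := hY.mono (inter_subset_left (t := U₀))
  have sZ := hZ.mono (inter_subset_left (t := U₀))
  have mX := SmoothSectionOn.const_smul ((ε : ℤ) : ℝ) (𝓙.smooth_gFlat ho sX)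
  have mY := SmoothSectionOn.const_smul ((δ : ℤ) : ℝ) (𝓙.smooth_gFlat ho sY)
  obtain ⟨θ, h1, h2⟩ := 𝓙.bracket_s_add ht inter_subset_right ho sX sY mX mY ⟨hx, hxU₀⟩
  simp only [sC_eq]
  rw [h1, pairing_s_add, h2 Z sZ]
  have e1 : 𝓙.torsionForm x ![Y x, X x, Z x] = extD (𝓙.splitForm t) x ![X x, Y x, Z x] := by
    rw [(map_swap_three (𝓙.torsionForm x) (X x) (Y x) (Z x)).1, 𝓙.torsionForm_eq ht hxU₀]
    exact neg_neg _
  rw [bracketForm, e1]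
  have d := fun {X Y} (hX : SmoothSectionOn V V X (U ∩ U₀)) (hY : SmoothSectionOn V V Y (U ∩ U₀)) ↦
    (𝓙.smooth_g ho hX hY).mdifferentiableAt ho ⟨hx, hxU₀⟩
  simp only [smul_apply, gFlat_apply, smul_eq_mul]
  rw [dirD_const_mul _ (d sY sZ), dirD_const_mul _ (d sX sZ), dirD_const_mul _ (d sX sY)]
  ring

lemma bracketForm_smul_fst (ε δ γ : ℤˣ) (c : ℝ) (hU : IsOpen U) (hX : SmoothSectionOn V V X U)
    (hY : SmoothSectionOn V V Y U) (hZ : SmoothSectionOn V V Z U) (hx : x ∈ U) :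
    𝓙.bracketForm ε δ γ (fun y ↦ c • X y) Y Z x = c * 𝓙.bracketForm ε δ γ X Y Z x := by
  have d := fun {X Y} (hX : SmoothSectionOn V V X U) (hY : SmoothSectionOn V V Y U) ↦
    (𝓙.smooth_g hU hX hY).mdifferentiableAt hU hx
  simp only [bracketForm, g_smul_left]
  rw [dirD_const_mul c (d hX hZ), dirD_const_mul c (d hX hY), dirD_smul_left,
    mlieBracket_smul_left_of_smooth c hU hX hx, mlieBracket_smul_left_of_smooth c hU hX hx,
    g_smul_right, g_smul_right, (map_smul_three (𝓙.torsionForm x) c (Y x) (X x) (Z x)).2.1]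
  ring

lemma bracketForm_smul_snd (ε δ γ : ℤˣ) (c : ℝ) (hU : IsOpen U) (hX : SmoothSectionOn V V X U)
    (hY : SmoothSectionOn V V Y U) (hZ : SmoothSectionOn V V Z U) (hx : x ∈ U) :
    𝓙.bracketForm ε δ γ X (fun y ↦ c • Y y) Z x = c * 𝓙.bracketForm ε δ γ X Y Z x := by
  have d := fun {X Y} (hX : SmoothSectionOn V V X U) (hY : SmoothSectionOn V V Y U) ↦
    (𝓙.smooth_g hU hX hY).mdifferentiableAt hU hx
  simp only [bracketForm, g_smul_left, g_smul_right]
  rw [dirD_const_mul c (d hY hZ), dirD_const_mul c (d hX hY), dirD_smul_left,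
    mlieBracket_smul_left_of_smooth c hU hY hx, mlieBracket_smul_right_of_smooth c hU hY hx,
    g_smul_right, g_smul_right, (map_smul_three (𝓙.torsionForm x) c (Y x) (X x) (Z x)).1]
  ring

lemma bracketForm_smul_trd (ε δ γ : ℤˣ) (c : ℝ) (hU : IsOpen U) (hX : SmoothSectionOn V V X U)
    (hY : SmoothSectionOn V V Y U) (hZ : SmoothSectionOn V V Z U) (hx : x ∈ U) :
    𝓙.bracketForm ε δ γ X Y (fun y ↦ c • Z y) x = c * 𝓙.bracketForm ε δ γ X Y Z x := by
  have d := fun {X Y} (hX : SmoothSectionOn V V X U) (hY : SmoothSectionOn V V Y U) ↦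
    (𝓙.smooth_g hU hX hY).mdifferentiableAt hU hx
  simp only [bracketForm, g_smul_left, g_smul_right]
  rw [dirD_const_mul c (d hY hZ), dirD_const_mul c (d hX hZ), dirD_smul_left,
    mlieBracket_smul_right_of_smooth c hU hZ hx, mlieBracket_smul_right_of_smooth c hU hZ hx,
    g_smul_right, g_smul_right, (map_smul_three (𝓙.torsionForm x) c (Y x) (X x) (Z x)).2.2]
  ring

/-- This is the Courant identity `[a, b] + [b, a] = 2 ι d⟨a, b⟩`, with `⟨s_ε X, s_δ Y⟩ = (ε + δ)
g(X, Y) / 2`. -/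
lemma bracketForm_swap_left (ε δ γ : ℤˣ) (X Y Z : ∀ x : M, TangentSpace 𝓘(ℝ, V) x) (x : M) :
    𝓙.bracketForm δ ε γ Y X Z x = -𝓙.bracketForm ε δ γ X Y Z x
      + (((ε : ℤ) : ℝ) + ((δ : ℤ) : ℝ)) * dirD Z (fun y ↦ 𝓙.g y (X y) (Y y)) x := by
  simp only [bracketForm]
  rw [(map_swap_three (𝓙.torsionForm x) (Y x) (X x) (Z x)).1,
    VectorField.mlieBracket_swap_apply (V := Y) (W := X), g_neg_right]
  simp only [fun y ↦ 𝓙.g_symm y (Y y) (X y)]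
  ring

/-- This is the invariance of the pairing, `⟨[a, b], c⟩ + ⟨b, [a, c]⟩ = π(a)⟨b, c⟩`. -/
lemma bracketForm_swap_right (ε δ γ : ℤˣ) (X Y Z : ∀ x : M, TangentSpace 𝓘(ℝ, V) x) (x : M) :
    𝓙.bracketForm ε γ δ X Z Y x = -𝓙.bracketForm ε δ γ X Y Z x
      + (((δ : ℤ) : ℝ) + ((γ : ℤ) : ℝ)) * dirD X (fun y ↦ 𝓙.g y (Y y) (Z y)) x := by
  simp only [bracketForm]
  have e : 𝓙.torsionForm x ![Z x, X x, Y x] = -𝓙.torsionForm x ![Y x, X x, Z x] := by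
    rw [(map_swap_three (𝓙.torsionForm x) (X x) (Z x) (Y x)).1,
      (map_swap_three (𝓙.torsionForm x) (X x) (Y x) (Z x)).2,
      (map_swap_three (𝓙.torsionForm x) (Y x) (X x) (Z x)).1]
    ring
  rw [e, VectorField.mlieBracket_swap_apply (V := Z) (W := Y), g_neg_right]
  simp only [fun y ↦ 𝓙.g_symm y (Z y) (Y y)]
  ring

/-- The expression `2⟨N_J(s_ε X, s_δ Y), s_γ Z⟩` for the Nijenhuis operator `N_J` of the Courant
bracket, where `J s_ε = s_ε K_ε`. -/
def nijenhuisForm (K : ℤˣ → ∀ x : M, TangentSpace 𝓘(ℝ, V) x →L[ℝ] TangentSpace 𝓘(ℝ, V) x)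
    (ε δ γ : ℤˣ) (X Y Z : ∀ x : M, TangentSpace 𝓘(ℝ, V) x) (x : M) : ℝ :=
  𝓙.bracketForm ε δ γ X Y Z x
  - 𝓙.bracketForm ε δ γ (fun y ↦ K ε y (X y)) (fun y ↦ K δ y (Y y)) Z x
  - 𝓙.bracketForm ε δ γ X (fun y ↦ K δ y (Y y)) (fun y ↦ K γ y (Z y)) x
  - 𝓙.bracketForm ε δ γ (fun y ↦ K ε y (X y)) Y (fun y ↦ K γ y (Z y)) x

section Compatible

variable {𝓐 : AlmostGeneralizedComplex 𝓔}
  {K : ℤˣ → ∀ x : M, TangentSpace 𝓘(ℝ, V) x →L[ℝ] TangentSpace 𝓘(ℝ, V) x}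

lemma smooth_of_sC_eq (hK : ∀ ε x v, 𝓐.J x (𝓙.sC ε x v) = 𝓙.sC ε x (K ε x v)) (ε : ℤˣ)
    (hU : IsOpen U) (hX : SmoothSectionOn V V X U) :
    SmoothSectionOn V V (fun x ↦ K ε x (X x)) U := by
  refine SmoothSectionOn.congr_section
    (𝓔.smooth_anchor (𝓐.smooth_apply (𝓙.smooth_sC ε hU hX))) fun x _ ↦ ?_
  rw [hK, anchor_sC]

/-- Skewness of `J` moves the outer `J` of the Nijenhuis operator onto the third argument, which
accounts for the signs in `nijenhuisForm`. -/
lemma two_mul_pairing_nijenhuis (hK : ∀ ε x v, 𝓐.J x (𝓙.sC ε x v) = 𝓙.sC ε x (K ε x v))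
    (ε δ γ : ℤˣ) (hU : IsOpen U) (hX : SmoothSectionOn V V X U)
    (hY : SmoothSectionOn V V Y U) (hZ : SmoothSectionOn V V Z U) (hx : x ∈ U) :
    2 * 𝓔.pairing x (𝓐.courantNijenhuis (fun y ↦ 𝓙.sC ε y (X y)) (fun y ↦ 𝓙.sC δ y (Y y)) x)
      (𝓙.sC γ x (Z x)) = 𝓙.nijenhuisForm K ε δ γ X Y Z x := by
  have sX := 𝓙.smooth_of_sC_eq hK ε hU hX
  have sY := 𝓙.smooth_of_sC_eq hK δ hU hY
  have sZ := 𝓙.smooth_of_sC_eq hK γ hU hZ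
  rw [nijenhuisForm, ← 𝓙.two_mul_pairing_bracket ε δ γ hU hX hY hZ hx,
    ← 𝓙.two_mul_pairing_bracket ε δ γ hU sX sY hZ hx,
    ← 𝓙.two_mul_pairing_bracket ε δ γ hU hX sY sZ hx,
    ← 𝓙.two_mul_pairing_bracket ε δ γ hU sX hY sZ hx]
  simp only [AlmostGeneralizedComplex.courantNijenhuis, nijenhuis, ContinuousLinearMap.coe_coe, hK,
    map_add, map_sub, add_apply, sub_apply, pairing_J_left]
  ring

lemma g_of_sC_eq (hK : ∀ ε x v, 𝓐.J x (𝓙.sC ε x v) = 𝓙.sC ε x (K ε x v)) (ε : ℤˣ) (x : M) (v w) :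
    𝓙.g x (K ε x v) (K ε x w) = 𝓙.g x v w ∧ 𝓙.g x (K ε x v) w = -𝓙.g x v (K ε x w) := by
  rw [𝓙.g_eq ε, 𝓙.g_eq ε, 𝓙.g_eq ε, 𝓙.g_eq ε, ← hK, ← hK, 𝓐.orthogonal, pairing_J_left]
  exact ⟨rfl, by ring⟩

lemma unit_add_eq_zero {ε δ : ℤˣ} (h : ε ≠ δ) : ((ε : ℤ) : ℝ) + ((δ : ℤ) : ℝ) = 0 := by
  rcases Int.units_eq_one_or ε with rfl | rfl <;> rcases Int.units_eq_one_or δ with rfl | rfl <;>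
    simp_all

/-- For opposite signs the error terms of `bracketForm_swap_left` have coefficient `0`. For equal
signs they cancel in pairs, along `Z` because `K` is orthogonal for `g` and along `K Z` because it
is skew. -/
lemma nijenhuisForm_swap_left (hK : ∀ ε x v, 𝓐.J x (𝓙.sC ε x v) = 𝓙.sC ε x (K ε x v))
    (ε δ γ : ℤˣ) (X Y Z : ∀ x : M, TangentSpace 𝓘(ℝ, V) x) (x : M) :
    𝓙.nijenhuisForm K δ ε γ Y X Z x = -𝓙.nijenhuisForm K ε δ γ X Y Z x := by
  simp only [nijenhuisForm, 𝓙.bracketForm_swap_left ε δ γ]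
  rcases eq_or_ne ε δ with rfl | h
  · simp only [fun y v w ↦ (𝓙.g_of_sC_eq hK ε y v w).1, fun y ↦ (𝓙.g_of_sC_eq hK ε y (X y) (Y y)).2,
      dirD_neg]
    ring
  · rw [unit_add_eq_zero h]
    ring

lemma nijenhuisForm_swap_right (hK : ∀ ε x v, 𝓐.J x (𝓙.sC ε x v) = 𝓙.sC ε x (K ε x v))
    (ε δ γ : ℤˣ) (X Y Z : ∀ x : M, TangentSpace 𝓘(ℝ, V) x) (x : M) :
    𝓙.nijenhuisForm K ε γ δ X Z Y x = -𝓙.nijenhuisForm K ε δ γ X Y Z x := by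
  simp only [nijenhuisForm, 𝓙.bracketForm_swap_right ε δ γ]
  rcases eq_or_ne δ γ with rfl | h
  · simp only [fun y v w ↦ (𝓙.g_of_sC_eq hK δ y v w).1, fun y ↦ (𝓙.g_of_sC_eq hK δ y (Y y) (Z y)).2,
      dirD_neg]
    ring
  · rw [unit_add_eq_zero h]
    ring

/-- By skew-symmetry, only the components `(ε, ε, ±ε)` of the Nijenhuis form matter. -/
lemma isIntegrable_iff_nijenhuisForm
    (hK : ∀ ε x v, 𝓐.J x (𝓙.sC ε x v) = 𝓙.sC ε x (K ε x v)) : 𝓐.IsIntegrable ↔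
    ∀ (ε : ℤˣ) (U : Set M), IsOpen U → ∀ X Y Z : ∀ x : M, TangentSpace 𝓘(ℝ, V) x,
      SmoothSectionOn V V X U → SmoothSectionOn V V Y U → SmoothSectionOn V V Z U → ∀ x ∈ U,
      𝓙.nijenhuisForm K ε ε ε X Y Z x = 0 ∧ 𝓙.nijenhuisForm K ε ε (-ε) X Y Z x = 0 := by
  rw [𝓙.isIntegrable_iff_sC]
  constructor
  · intro h ε U hU X Y Z hX hY hZ x hx
    constructor
    · rw [← 𝓙.two_mul_pairing_nijenhuis hK ε ε _ hU hX hY hZ hx, h _ _ _ U hU X Y Z hX hY hZ x hx,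
        mul_zero]
    · rw [← 𝓙.two_mul_pairing_nijenhuis hK ε ε _ hU hX hY hZ hx, h _ _ _ U hU X Y Z hX hY hZ x hx,
        mul_zero]
  · intro h ε δ γ U hU X Y Z hX hY hZ x hx
    have h2 : 𝓙.nijenhuisForm K ε δ γ X Y Z x = 0 := by
      have n : ∀ {ε δ : ℤˣ}, ε ≠ δ → δ = -ε := by decide
      rcases eq_or_ne ε δ with rfl | h1
      · rcases eq_or_ne ε γ with rfl | h2
        · exact (h ε U hU X Y Z hX hY hZ x hx).1
        · rw [n h2]
          exact (h ε U hU X Y Z hX hY hZ x hx).2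
      · rcases eq_or_ne ε γ with rfl | h2
        · rw [𝓙.nijenhuisForm_swap_right hK, n h1, (h ε U hU X Z Y hX hZ hY x hx).2, neg_zero]
        -- Here `δ = γ = -ε`; two transpositions move the exceptional sign to the last slot.
        · rw [𝓙.nijenhuisForm_swap_left hK, 𝓙.nijenhuisForm_swap_right hK]
          obtain rfl : γ = δ := by rw [n h1, n h2]
          obtain rfl : ε = -γ := n h1.symm
          rw [(h γ U hU Y Z X hY hZ hX x hx).2]
          simp
    have h3 := 𝓙.two_mul_pairing_nijenhuis hK ε δ γ hU hX hY hZ hx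
    rw [h2] at h3
    linarith

end Compatible

end AlmostGeneralizedKahler

end Trilinear

/-! ### Reduction to `I_±` and the mixed components -/

section Integrability

variable {V : Type*} [NormedAddCommGroup V] [NormedSpace ℝ V] [FiniteDimensional ℝ V]
  {M : Type*} [TopologicalSpace M] [ChartedSpace V M] [IsManifold 𝓘(ℝ, V) ∞ M] {U : Set M}
  {F : Type*} [NormedAddCommGroup F] [NormedSpace ℝ F]
  {E : M → Type*} [TopologicalSpace (TotalSpace F E)] [∀ x, AddCommGroup (E x)]
  [∀ x, Module ℝ (E x)] [∀ x, TopologicalSpace (E x)]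
  [∀ x, IsTopologicalAddGroup (E x)] [∀ x, ContinuousSMul ℝ (E x)]
  [FiberBundle F E] [VectorBundle ℝ F E] [ContMDiffVectorBundle ∞ F E 𝓘(ℝ, V)]
  {𝓔 : CourantAlgebroid V M F E}
  {X Y Z : ∀ x : M, TangentSpace 𝓘(ℝ, V) x} {x : M}

namespace AlmostGeneralizedKahler

variable (𝓙 : AlmostGeneralizedKahler 𝓔)

/-- The Nijenhuis tensor of `I_±` on vector fields. -/
def lieNijenhuis (ε : ℤˣ) (X Y : ∀ x : M, TangentSpace 𝓘(ℝ, V) x) (x : M) :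
    TangentSpace 𝓘(ℝ, V) x :=
  nijenhuis (VectorField.mlieBracket 𝓘(ℝ, V)) (fun x ↦ (𝓙.I ε x).toLinearMap) X Y x

lemma isIntegrableComplexStructure_iff (ε : ℤˣ) : IsIntegrableComplexStructure (𝓙.I ε) ↔
    ∀ U : Set M, IsOpen U → ∀ X Y : ∀ x : M, TangentSpace 𝓘(ℝ, V) x,
    SmoothSectionOn V V X U → SmoothSectionOn V V Y U → ∀ x ∈ U, 𝓙.lieNijenhuis ε X Y x = 0 :=
  isInvolutive_eigenI_iff (V := V) (E := fun x : M ↦ TangentSpace 𝓘(ℝ, V) x) V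
    (br := VectorField.mlieBracket 𝓘(ℝ, V)) (J := fun x ↦ (𝓙.I ε x).toLinearMap)
    (fun _ _ _ _ _ h h' ↦ Filter.EventuallyEq.mlieBracket_vectorField_eq h h')
    (fun x a ↦ 𝓙.I_I ε x a) (fun _ hU _ ha ↦ 𝓙.smooth_I ε hU ha)

/-- The obstruction to integrability with mixed components. -/
def mixedForm (ε : ℤˣ) (X Y Z : ∀ x : M, TangentSpace 𝓘(ℝ, V) x) (x : M) : ℝ :=
  𝓙.bracketForm ε ε (-ε) X (fun y ↦ 𝓙.I ε y (Y y)) Z x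
  + 𝓙.bracketForm ε ε (-ε) (fun y ↦ 𝓙.I ε y (X y)) Y Z x

/-- For `J₋` one has `K_ε = ε I_ε`: the scalars in the first two slots multiply to `1`, and those in
one of these slots and the third to `ε γ`. -/
lemma nijenhuisForm_minus (ε γ : ℤˣ) (hU : IsOpen U) (hX : SmoothSectionOn V V X U)
    (hY : SmoothSectionOn V V Y U) (hZ : SmoothSectionOn V V Z U) (hx : x ∈ U) :
    𝓙.nijenhuisForm (fun ε x ↦ ((ε : ℤ) : ℝ) • 𝓙.I ε x) ε ε γ X Y Z x =
      𝓙.bracketForm ε ε γ X Y Z x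
      - 𝓙.bracketForm ε ε γ (fun y ↦ 𝓙.I ε y (X y)) (fun y ↦ 𝓙.I ε y (Y y)) Z x
      - ((ε : ℤ) : ℝ) * ((γ : ℤ) : ℝ) *
        (𝓙.bracketForm ε ε γ X (fun y ↦ 𝓙.I ε y (Y y)) (fun y ↦ 𝓙.I γ y (Z y)) x
        + 𝓙.bracketForm ε ε γ (fun y ↦ 𝓙.I ε y (X y)) Y (fun y ↦ 𝓙.I γ y (Z y)) x) := by
  have iX := 𝓙.smooth_I ε hU hX
  have iY := 𝓙.smooth_I ε hU hY
  have iZ := 𝓙.smooth_I γ hU hZ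
  simp only [nijenhuisForm, smul_apply]
  rw [𝓙.bracketForm_smul_fst ε ε γ _ hU iX (iY.const_smul _) hZ hx,
    𝓙.bracketForm_smul_snd ε ε γ _ hU iX iY hZ hx,
    𝓙.bracketForm_smul_snd ε ε γ _ hU hX iY (iZ.const_smul _) hx,
    𝓙.bracketForm_smul_trd ε ε γ _ hU hX iY iZ hx,
    𝓙.bracketForm_smul_fst ε ε γ _ hU iX hY (iZ.const_smul _) hx,
    𝓙.bracketForm_smul_trd ε ε γ _ hU iX hY iZ hx, ← mul_assoc, unit_sq]
  ring

lemma bracketForm_I_I_fst (ε δ δ' γ : ℤˣ) (hU : IsOpen U) (hX : SmoothSectionOn V V X U)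
    (hY : SmoothSectionOn V V Y U) (hZ : SmoothSectionOn V V Z U) (hx : x ∈ U) :
    𝓙.bracketForm ε δ γ (fun y ↦ 𝓙.I δ' y (𝓙.I δ' y (X y))) Y Z x =
      -𝓙.bracketForm ε δ γ X Y Z x := by
  have e : (fun y ↦ 𝓙.I δ' y (𝓙.I δ' y (X y))) = fun y ↦ (-1 : ℝ) • X y := by
    funext y
    rw [I_I, neg_one_smul]
  rw [e, 𝓙.bracketForm_smul_fst ε δ γ _ hU hX hY hZ hx, neg_one_mul]

lemma bracketForm_I_I_trd (ε δ δ' γ : ℤˣ) (hU : IsOpen U) (hX : SmoothSectionOn V V X U)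
    (hY : SmoothSectionOn V V Y U) (hZ : SmoothSectionOn V V Z U) (hx : x ∈ U) :
    𝓙.bracketForm ε δ γ X Y (fun y ↦ 𝓙.I δ' y (𝓙.I δ' y (Z y))) x =
      -𝓙.bracketForm ε δ γ X Y Z x := by
  have e : (fun y ↦ 𝓙.I δ' y (𝓙.I δ' y (Z y))) = fun y ↦ (-1 : ℝ) • Z y := by
    funext y
    rw [I_I, neg_one_smul]
  rw [e, 𝓙.bracketForm_smul_trd ε δ γ _ hU hX hY hZ hx, neg_one_mul]

/-- On `(ε, ε, ε)` the forms of `J₊` and `J₋` coincide. On `(ε, ε, -ε)`, evaluated at `I_{-ε} Z`,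
they are `A + mixedForm` and `A - mixedForm`, where `A` is the difference of bracket forms at `(X,
Y)` and `(I X, I Y)`. Both vanish iff `A` and `mixedForm` do, and `A = 0` already follows from
`mixedForm = 0`. -/
lemma isIntegrable_iff_mixedForm : 𝓙.IsIntegrable ↔
    ∀ (ε : ℤˣ) (U : Set M), IsOpen U → ∀ X Y Z : ∀ x : M, TangentSpace 𝓘(ℝ, V) x,
      SmoothSectionOn V V X U → SmoothSectionOn V V Y U → SmoothSectionOn V V Z U → ∀ x ∈ U,
      𝓙.nijenhuisForm 𝓙.I ε ε ε X Y Z x = 0 ∧ 𝓙.mixedForm ε X Y Z x = 0 := by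
  rw [IsIntegrable, 𝓙.isIntegrable_iff_nijenhuisForm (𝓐 := 𝓙.plus) (K := 𝓙.I)
      (fun ε x v ↦ (𝓙.sC_I ε x v).symm),
    𝓙.isIntegrable_iff_nijenhuisForm (𝓐 := 𝓙.minus) (K := fun ε x ↦ ((ε : ℤ) : ℝ) • 𝓙.I ε x)
      (fun ε x v ↦ (𝓙.sC_I_minus ε x v).symm)]
  have hneg : ∀ ε : ℤˣ, ((ε : ℤ) : ℝ) * (((-ε : ℤˣ) : ℤ) : ℝ) = -1 := by
    intro ε
    rw [Units.val_neg, Int.cast_neg, mul_neg, unit_sq]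
  constructor
  · rintro ⟨hp, hm⟩ ε U hU X Y Z hX hY hZ x hx
    refine ⟨(hp ε U hU X Y Z hX hY hZ x hx).1, ?_⟩
    have iX := 𝓙.smooth_I ε hU hX
    have iY := 𝓙.smooth_I ε hU hY
    have iZ := 𝓙.smooth_I (-ε) hU hZ
    have h1 := (hp ε U hU X Y _ hX hY iZ x hx).2
    have h2 := (hm ε U hU X Y _ hX hY iZ x hx).2
    rw [𝓙.nijenhuisForm_minus ε _ hU hX hY iZ hx, hneg,
      𝓙.bracketForm_I_I_trd _ _ _ _ hU hX iY hZ hx,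
      𝓙.bracketForm_I_I_trd _ _ _ _ hU iX hY hZ hx] at h2
    rw [nijenhuisForm, 𝓙.bracketForm_I_I_trd _ _ _ _ hU hX iY hZ hx,
      𝓙.bracketForm_I_I_trd _ _ _ _ hU iX hY hZ hx] at h1
    rw [mixedForm]
    linarith
  · intro h
    -- Replacing `X` by `I X` in `mixedForm = 0` gives `A = 0`, because `I² = -1`.
    have key : ∀ (ε : ℤˣ) (U : Set M), IsOpen U → ∀ X Y Z : ∀ x : M, TangentSpace 𝓘(ℝ, V) x,
        SmoothSectionOn V V X U → SmoothSectionOn V V Y U → SmoothSectionOn V V Z U → ∀ x ∈ U,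
        𝓙.bracketForm ε ε (-ε) X Y Z x = 𝓙.bracketForm ε ε (-ε) (fun y ↦ 𝓙.I ε y (X y))
          (fun y ↦ 𝓙.I ε y (Y y)) Z x := by
      intro ε U hU X Y Z hX hY hZ x hx
      have h1 := (h ε U hU _ Y Z (𝓙.smooth_I ε hU hX) hY hZ x hx).2
      rw [mixedForm, 𝓙.bracketForm_I_I_fst _ _ _ _ hU hX hY hZ hx] at h1
      linarith
    refine ⟨fun ε U hU X Y Z hX hY hZ x hx ↦ ⟨(h ε U hU X Y Z hX hY hZ x hx).1, ?_⟩,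
      fun ε U hU X Y Z hX hY hZ x hx ↦ ⟨?_, ?_⟩⟩
    · have h1 := (h ε U hU X Y _ hX hY (𝓙.smooth_I (-ε) hU hZ) x hx).2
      rw [mixedForm] at h1
      rw [nijenhuisForm, ← key ε U hU X Y Z hX hY hZ x hx]
      linarith
    · have h1 := (h ε U hU X Y Z hX hY hZ x hx).1
      rw [𝓙.nijenhuisForm_minus ε _ hU hX hY hZ hx, unit_sq]
      rw [nijenhuisForm] at h1
      linarith
    · have h1 := (h ε U hU X Y _ hX hY (𝓙.smooth_I (-ε) hU hZ) x hx).2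
      rw [mixedForm] at h1
      rw [𝓙.nijenhuisForm_minus ε _ hU hX hY hZ hx, ← key ε U hU X Y Z hX hY hZ x hx, h1]
      ring

lemma bracketForm_self (ε : ℤˣ) (X Y Z : ∀ x : M, TangentSpace 𝓘(ℝ, V) x) (x : M) :
    𝓙.bracketForm ε ε ε X Y Z x = 𝓙.bracketForm ε ε (-ε) X Y Z x +
      2 * ((ε : ℤ) : ℝ) * 𝓙.g x (Z x) (VectorField.mlieBracket 𝓘(ℝ, V) X Y x) := by
  rw [bracketForm, bracketForm, Units.val_neg, Int.cast_neg]
  ring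

lemma g_lieNijenhuis (ε : ℤˣ) (X Y : ∀ x : M, TangentSpace 𝓘(ℝ, V) x) (x : M) (w) :
    𝓙.g x w (𝓙.lieNijenhuis ε X Y x) = 𝓙.g x w (VectorField.mlieBracket 𝓘(ℝ, V) X Y x)
      - 𝓙.g x w (VectorField.mlieBracket 𝓘(ℝ, V) (fun y ↦ 𝓙.I ε y (X y))
        (fun y ↦ 𝓙.I ε y (Y y)) x)
      - 𝓙.g x (𝓙.I ε x w) (VectorField.mlieBracket 𝓘(ℝ, V) (fun y ↦ 𝓙.I ε y (X y)) Y x)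
      - 𝓙.g x (𝓙.I ε x w) (VectorField.mlieBracket 𝓘(ℝ, V) X (fun y ↦ 𝓙.I ε y (Y y)) x) := by
  rw [𝓙.g_I_left, 𝓙.g_I_left]
  simp only [lieNijenhuis, nijenhuis, g, map_add, map_sub, ContinuousLinearMap.coe_coe]
  ring

/-- Changing the last sign of `bracketForm` from `-ε` to `ε` adds only `2 ε g(Z, [X, Y])`. These
additions form the Nijenhuis tensor of `I_ε`; the rest groups into two mixed forms. -/
lemma nijenhuisForm_self (ε : ℤˣ) (hU : IsOpen U) (hX : SmoothSectionOn V V X U)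
    (hY : SmoothSectionOn V V Y U) (hZ : SmoothSectionOn V V Z U) (hx : x ∈ U) :
    𝓙.nijenhuisForm 𝓙.I ε ε ε X Y Z x =
      2 * ((ε : ℤ) : ℝ) * 𝓙.g x (Z x) (𝓙.lieNijenhuis ε X Y x)
      - 𝓙.mixedForm ε (fun y ↦ 𝓙.I ε y (X y)) Y Z x
      - 𝓙.mixedForm ε X Y (fun y ↦ 𝓙.I ε y (Z y)) x := by
  rw [nijenhuisForm, mixedForm, mixedForm, 𝓙.bracketForm_I_I_fst _ _ _ _ hU hX hY hZ hx,
    g_lieNijenhuis]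
  simp only [bracketForm_self]
  ring

lemma isIntegrable_iff_lieNijenhuis : 𝓙.IsIntegrable ↔
    ∀ ε : ℤˣ, IsIntegrableComplexStructure (𝓙.I ε) ∧
      ∀ U : Set M, IsOpen U → ∀ X Y Z : ∀ x : M, TangentSpace 𝓘(ℝ, V) x,
      SmoothSectionOn V V X U → SmoothSectionOn V V Y U → SmoothSectionOn V V Z U → ∀ x ∈ U,
      𝓙.mixedForm ε X Y Z x = 0 := by
  rw [isIntegrable_iff_mixedForm]
  refine forall_congr' fun ε ↦ ?_
  rw [isIntegrableComplexStructure_iff]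
  constructor
  · intro h
    refine ⟨fun U hU X Y hX hY x hx ↦ ?_, fun U hU X Y Z hX hY hZ x hx ↦
      (h U hU X Y Z hX hY hZ x hx).2⟩
    refine 𝓙.g_eq_zero fun w ↦ ?_
    obtain ⟨Z, hZ, rfl⟩ := exists_smoothSection_eq x w
    have hO := hU.inter (chartAt V x).open_source
    have hX' := hX.mono (inter_subset_left (t := (chartAt V x).source))
    have hY' := hY.mono (inter_subset_left (t := (chartAt V x).source))
    have hZ' := hZ.mono (inter_subset_right (s := U))
    have hx' : x ∈ U ∩ (chartAt V x).source := ⟨hx, mem_chart_source V x⟩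
    have h1 := (h _ hO X Y Z hX' hY' hZ' x hx').1
    rw [𝓙.nijenhuisForm_self ε hO hX' hY' hZ' hx',
      (h _ hO _ Y Z (𝓙.smooth_I ε hO hX') hY' hZ' x hx').2,
      (h _ hO X Y _ hX' hY' (𝓙.smooth_I ε hO hZ') x hx').2, sub_zero, sub_zero] at h1
    rw [g_symm]
    rcases Int.units_eq_one_or ε with rfl | rfl
    · simpa using h1
    · simpa using h1
  · rintro ⟨h1, h2⟩ U hU X Y Z hX hY hZ x hx
    refine ⟨?_, h2 U hU X Y Z hX hY hZ x hx⟩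
    rw [𝓙.nijenhuisForm_self ε hU hX hY hZ hx, h1 U hU X Y hX hY x hx,
      h2 U hU _ Y Z (𝓙.smooth_I ε hU hX) hY hZ x hx,
      h2 U hU X Y _ hX hY (𝓙.smooth_I ε hU hZ) x hx]
    simp [g]

/-! ### The exterior derivative of `ω_±` -/

lemma omega_apply (ε : ℤˣ) (x : M) (v w : TangentSpace 𝓘(ℝ, V) x) :
    𝓙.omega ε x ![v, w] = 𝓙.g x (𝓙.I ε x v) w := rfl

lemma smooth_omega (ε : ℤˣ) (U : Set M) : SmoothFormOn (𝓙.omega ε) U := fun _ _ hO _ hX ↦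
  𝓙.smooth_g hO (𝓙.smooth_I ε hO (hX 0)) (hX 1)

lemma extD_omega_apply (ε : ℤˣ) (hU : IsOpen U) (hX : SmoothSectionOn V V X U)
    (hY : SmoothSectionOn V V Y U) (hZ : SmoothSectionOn V V Z U) (hx : x ∈ U) :
    extD (𝓙.omega ε) x ![X x, Y x, Z x] =
      dirD X (fun y ↦ 𝓙.g y (𝓙.I ε y (Y y)) (Z y)) x
      - dirD Y (fun y ↦ 𝓙.g y (𝓙.I ε y (X y)) (Z y)) x
      + dirD Z (fun y ↦ 𝓙.g y (𝓙.I ε y (X y)) (Y y)) x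
      + 𝓙.g x (𝓙.I ε x (Z x)) (VectorField.mlieBracket 𝓘(ℝ, V) X Y x)
      - 𝓙.g x (𝓙.I ε x (Y x)) (VectorField.mlieBracket 𝓘(ℝ, V) X Z x)
      + 𝓙.g x (𝓙.I ε x (X x)) (VectorField.mlieBracket 𝓘(ℝ, V) Y Z x) := by
  rw [extD_two_apply hU (𝓙.smooth_omega ε U) hX hY hZ hx]
  simp only [omega_apply]
  rw [𝓙.g_I_left ε x (VectorField.mlieBracket 𝓘(ℝ, V) X Y x),
    𝓙.g_I_left ε x (VectorField.mlieBracket 𝓘(ℝ, V) X Z x),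
    𝓙.g_I_left ε x (VectorField.mlieBracket 𝓘(ℝ, V) Y Z x),
    𝓙.g_symm x _ (𝓙.I ε x (Z x)), 𝓙.g_symm x _ (𝓙.I ε x (Y x)), 𝓙.g_symm x _ (𝓙.I ε x (X x))]
  ring

lemma g_mlieBracket_of_lieNijenhuis_eq_zero {ε : ℤˣ} (h : 𝓙.lieNijenhuis ε X Y x = 0) (w) :
    𝓙.g x w (VectorField.mlieBracket 𝓘(ℝ, V) X Y x) =
      𝓙.g x w (VectorField.mlieBracket 𝓘(ℝ, V) (fun y ↦ 𝓙.I ε y (X y))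
        (fun y ↦ 𝓙.I ε y (Y y)) x)
      + 𝓙.g x (𝓙.I ε x w) (VectorField.mlieBracket 𝓘(ℝ, V) (fun y ↦ 𝓙.I ε y (X y)) Y x)
      + 𝓙.g x (𝓙.I ε x w) (VectorField.mlieBracket 𝓘(ℝ, V) X (fun y ↦ 𝓙.I ε y (Y y)) x) := by
  have h1 := 𝓙.g_lieNijenhuis ε X Y x w
  rw [h] at h1
  have h2 : 𝓙.g x w 0 = 0 := by simp [g]
  rw [h2] at h1
  linarith

/-- After expanding, all derivative terms match those of `dω_ε`, and the leftover Lie brackets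
amount to a multiple of `g(I Z, N(X, Y))`, with `N` the Nijenhuis tensor. -/
lemma mixedForm_eq (ε : ℤˣ) (hU : IsOpen U) (hX : SmoothSectionOn V V X U)
    (hY : SmoothSectionOn V V Y U) (hZ : SmoothSectionOn V V Z U) (hx : x ∈ U)
    (hN : 𝓙.lieNijenhuis ε X Y x = 0) :
    𝓙.mixedForm ε X Y Z x = ((ε : ℤ) : ℝ) * (extD (𝓙.omega ε) x ![X x, Y x, Z x]
        - extD (𝓙.omega ε) x ![𝓙.I ε x (X x), 𝓙.I ε x (Y x), Z x])
      - (𝓙.torsionForm x ![X x, 𝓙.I ε x (Y x), Z x]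
        + 𝓙.torsionForm x ![𝓙.I ε x (X x), Y x, Z x]) := by
  have iX := 𝓙.smooth_I ε hU hX
  have iY := 𝓙.smooth_I ε hU hY
  rw [𝓙.extD_omega_apply ε hU hX hY hZ hx, 𝓙.extD_omega_apply ε hU iX iY hZ hx, mixedForm,
    bracketForm, bracketForm, (map_swap_three (𝓙.torsionForm x) (X x) (𝓙.I ε x (Y x)) (Z x)).1,
    (map_swap_three (𝓙.torsionForm x) (𝓙.I ε x (X x)) (Y x) (Z x)).1, Units.val_neg, Int.cast_neg]
  have h := 𝓙.g_mlieBracket_of_lieNijenhuis_eq_zero hN (𝓙.I ε x (Z x))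
  simp only [I_I, g_neg_left, dirD_neg, 𝓙.g_I_left ε] at h ⊢
  linear_combination (-((ε : ℤ) : ℝ)) * h

/-- The identity says that `dω_ε` has no `(3,0)`- or `(0,3)`-part: the right side is `-3` times the
left on those types and equals it on the other two. By Cartan's formula the two sides differ by
terms `g(I Z, N(X, Y))` and their permutations. -/
lemma extD_omega_type {ε : ℤˣ} (hU : IsOpen U) (hX : SmoothSectionOn V V X U)
    (hY : SmoothSectionOn V V Y U) (hZ : SmoothSectionOn V V Z U) (hx : x ∈ U)
    (hXY : 𝓙.lieNijenhuis ε X Y x = 0) (hXZ : 𝓙.lieNijenhuis ε X Z x = 0)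
    (hYZ : 𝓙.lieNijenhuis ε Y Z x = 0) :
    extD (𝓙.omega ε) x ![X x, Y x, Z x] =
      extD (𝓙.omega ε) x ![𝓙.I ε x (X x), 𝓙.I ε x (Y x), Z x]
      + extD (𝓙.omega ε) x ![X x, 𝓙.I ε x (Y x), 𝓙.I ε x (Z x)]
      + extD (𝓙.omega ε) x ![𝓙.I ε x (X x), Y x, 𝓙.I ε x (Z x)] := by
  have iX := 𝓙.smooth_I ε hU hX
  have iY := 𝓙.smooth_I ε hU hY
  have iZ := 𝓙.smooth_I ε hU hZ
  rw [𝓙.extD_omega_apply ε hU hX hY hZ hx, 𝓙.extD_omega_apply ε hU iX iY hZ hx,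
    𝓙.extD_omega_apply ε hU hX iY iZ hx, 𝓙.extD_omega_apply ε hU iX hY iZ hx]
  have h1 := 𝓙.g_mlieBracket_of_lieNijenhuis_eq_zero hXY (𝓙.I ε x (Z x))
  have h2 := 𝓙.g_mlieBracket_of_lieNijenhuis_eq_zero hXZ (𝓙.I ε x (Y x))
  have h3 := 𝓙.g_mlieBracket_of_lieNijenhuis_eq_zero hYZ (𝓙.I ε x (X x))
  simp only [I_I, g_neg_left, dirD_neg, 𝓙.g_I_left ε, g_neg_right] at h1 h2 h3 ⊢
  linear_combination h1 - h2 + h3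

end AlmostGeneralizedKahler

end Integrability

/-! ### Types of 2- and 3-forms on a complex vector space -/

section LinearAlgebra

variable {W : Type*} [AddCommGroup W] [Module ℝ W] [TopologicalSpace W]
  [IsTopologicalAddGroup W] [ContinuousSMul ℝ W]

lemma typePart_apply {k : ℕ} (I : W →L[ℝ] W) (p : ℕ) (α : W [⋀^Fin k]→L[ℝ] ℂ) (v : Fin k → W) :
    typePart I p α v = ∑ S ∈ Finset.powersetCard p (Finset.univ : Finset (Fin k)),
      ∑ T : Finset (Fin k), Complex.I ^ T.card *
        ((∏ j, if j ∈ T then (if j ∈ S then -2⁻¹ else 2⁻¹) else (2⁻¹ : ℝ) : ℝ) *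
          α (fun j ↦ if j ∈ T then I (v j) else v j)) := by
  change typePartMul I p α v = _
  simp only [typePartMul, evalCplx, sum_apply, smul_apply,
    ContinuousMultilinearMap.compContinuousLinearMap_apply, smul_eq_mul]
  refine Finset.sum_congr rfl fun S _ ↦ Finset.sum_congr rfl fun T _ ↦ ?_
  rw [← Complex.real_smul]
  refine congrArg (fun z : ℂ ↦ Complex.I ^ T.card * z) ?_
  refine Eq.trans ?_ (α.toContinuousMultilinearMap.map_smul_univ
    (fun j ↦ if j ∈ T then (if j ∈ S then -2⁻¹ else 2⁻¹) else (2⁻¹ : ℝ))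
    (fun j ↦ if j ∈ T then I (v j) else v j))
  congr 1
  funext j
  split_ifs <;> simp

lemma typePart_zero_form {k : ℕ} (I : W →L[ℝ] W) (p : ℕ) :
    typePart I p (0 : W [⋀^Fin k]→L[ℝ] ℂ) = 0 := by
  ext v
  simp [typePart_apply]

lemma sum_finset_fin_two (f : Finset (Fin 2) → ℂ) :
    ∑ T, f T = f ∅ + f {0} + f {1} + f {0, 1} := by
  have h : (Finset.univ : Finset (Finset (Fin 2))) = {∅, {0}, {1}, {0, 1}} := by decide
  rw [h, Finset.sum_insert (by decide), Finset.sum_insert (by decide), Finset.sum_insert (by decide),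
    Finset.sum_singleton]
  ring

lemma sum_finset_fin_three (f : Finset (Fin 3) → ℂ) :
    ∑ T, f T = f ∅ + f {0} + f {1} + f {2} + f {0, 1} + f {0, 2} + f {1, 2} + f {0, 1, 2} := by
  have h : (Finset.univ : Finset (Finset (Fin 3))) =
    {∅, {0}, {1}, {2}, {0, 1}, {0, 2}, {1, 2}, {0, 1, 2}} := by decide
  rw [h, Finset.sum_insert (by decide), Finset.sum_insert (by decide), Finset.sum_insert (by decide),
    Finset.sum_insert (by decide), Finset.sum_insert (by decide), Finset.sum_insert (by decide),
    Finset.sum_insert (by decide), Finset.sum_singleton]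
  ring

/-- Invariance under `I` characterizes type `(1,1)`. It gives `α(u, I v) = -α(I u, v)`, which
reduces every projection to the values `α(u, v)` and `α(I u, v)`. -/
lemma typePart_two {I : W →L[ℝ] W} (hI : ∀ v, I (I v) = -v) {α : W [⋀^Fin 2]→L[ℝ] ℂ}
    (hα : ∀ u v, α ![I u, I v] = α ![u, v]) :
    typePart I 0 α = 0 ∧ typePart I 1 α = α ∧ typePart I 2 α = 0 := by
  have p0 : Finset.powersetCard 0 (Finset.univ : Finset (Fin 2)) = {∅} := by decide
  have p1 : Finset.powersetCard 1 (Finset.univ : Finset (Fin 2)) = {{0}, {1}} := by decide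
  have p2 : Finset.powersetCard 2 (Finset.univ : Finset (Fin 2)) = {{0, 1}} := by decide
  have hneg : ∀ u v, α ![u, -v] = -α ![u, v] := by
    intro u v
    have h := α.toAlternatingMap.map_update_smul ![u, v] 1 (-1 : ℝ) v
    have e1 : Function.update ![u, v] 1 ((-1 : ℝ) • v) = ![u, -v] := by
      funext i; fin_cases i <;> simp
    have e2 : Function.update ![u, v] 1 v = ![u, v] := by
      funext i; fin_cases i <;> simp
    rw [e1, e2, neg_one_smul] at h
    exact h
  have hsum : ∀ u v p, typePart I p α ![u, v] =
      ∑ S ∈ Finset.powersetCard p (Finset.univ : Finset (Fin 2)),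
        (2⁻¹ * 2⁻¹ * α ![u, v] + Complex.I * ((if 0 ∈ S then -2⁻¹ else 2⁻¹) * 2⁻¹ * α ![I u, v])
        + Complex.I * (2⁻¹ * (if 1 ∈ S then -2⁻¹ else 2⁻¹) * -α ![I u, v])
        - ((if 0 ∈ S then -2⁻¹ else 2⁻¹) * (if 1 ∈ S then -2⁻¹ else 2⁻¹) * α ![u, v])) := by
    intro u v p
    have h1 : α ![u, I v] = -α ![I u, v] := by
      rw [← hα u (I v), hI, hneg]
    rw [typePart_apply]
    refine Finset.sum_congr rfl fun S _ ↦ ?_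
    have e : ∀ T : Finset (Fin 2), (fun j ↦ if j ∈ T then I (![u, v] j) else ![u, v] j) =
        ![if 0 ∈ T then I u else u, if 1 ∈ T then I v else v] := by
      intro T; funext i; fin_cases i <;> rfl
    simp only [e]
    rw [sum_finset_fin_two]
    by_cases m0 : (0 : Fin 2) ∈ S <;> by_cases m1 : (1 : Fin 2) ∈ S <;>
      simp [Fin.prod_univ_two, hα, h1, m0, m1, -mul_eq_mul_right_iff] <;> ring
  have hv : ∀ v : Fin 2 → W, v = ![v 0, v 1] := by
    intro v; funext i; fin_cases i <;> rfl
  refine ⟨?_, ?_, ?_⟩ <;> ext v <;> rw [hv v, hsum]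
  · rw [p0]
    simp
  · rw [p1]
    simp
    ring
  · rw [p2]
    simp

/-- The difference of the `(1, 2)`- and `(2, 1)`-parts of a real `3`-form without `(3, 0)`-part. -/
lemma typePart_three_sub {I : W →L[ℝ] W} (hI : ∀ v, I (I v) = -v) {α : W [⋀^Fin 3]→L[ℝ] ℝ}
    (hα : ∀ u v w, α ![u, v, w] = α ![I u, I v, w] + α ![u, I v, I w] + α ![I u, v, I w])
    (u v w : W) :
    Complex.I * (typePart I 1 (Complex.ofRealCLM.compContinuousAlternatingMap α) ![u, v, w]
      - typePart I 2 (Complex.ofRealCLM.compContinuousAlternatingMap α) ![u, v, w]) =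
      ((-α ![I u, I v, I w] : ℝ) : ℂ) := by
  have p1 : Finset.powersetCard 1 (Finset.univ : Finset (Fin 3)) = {{0}, {1}, {2}} := by decide
  have p2 : Finset.powersetCard 2 (Finset.univ : Finset (Fin 3)) = {{0, 1}, {0, 2}, {1, 2}} := by
    decide
  -- Expansion of the three projections `(1 ∓ i I) / 2`: `8⁻¹` is the product of the halves, and a
  -- slot in `S` contributes the sign `-1` whenever `I` is inserted there.
  have hsum : ∀ p, typePart I p (Complex.ofRealCLM.compContinuousAlternatingMap α) ![u, v, w] =
      ∑ S ∈ Finset.powersetCard p (Finset.univ : Finset (Fin 3)),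
        8⁻¹ * ((α ![u, v, w] : ℂ) + Complex.I * ((if 0 ∈ S then -1 else 1) * α ![I u, v, w])
        + Complex.I * ((if 1 ∈ S then -1 else 1) * α ![u, I v, w])
        + Complex.I * ((if 2 ∈ S then -1 else 1) * α ![u, v, I w])
        - (if 0 ∈ S then -1 else 1) * (if 1 ∈ S then -1 else 1) * α ![I u, I v, w]
        - (if 0 ∈ S then -1 else 1) * (if 2 ∈ S then -1 else 1) * α ![I u, v, I w]
        - (if 1 ∈ S then -1 else 1) * (if 2 ∈ S then -1 else 1) * α ![u, I v, I w]
        - Complex.I * ((if 0 ∈ S then -1 else 1) * (if 1 ∈ S then -1 else 1) *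
          (if 2 ∈ S then -1 else 1) * α ![I u, I v, I w])) := by
    intro p
    rw [typePart_apply]
    refine Finset.sum_congr rfl fun S _ ↦ ?_
    have e : ∀ T : Finset (Fin 3), (fun j ↦ if j ∈ T then I (![u, v, w] j) else ![u, v, w] j) =
        ![if 0 ∈ T then I u else u, if 1 ∈ T then I v else v, if 2 ∈ T then I w else w] := by
      intro T; funext i; fin_cases i <;> rfl
    have hc : ∀ z, Complex.ofRealCLM.compContinuousAlternatingMap α z = (α z : ℂ) := fun _ ↦ rfl
    simp only [e, hc]
    rw [sum_finset_fin_three]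
    have i3 : Complex.I ^ 3 = -Complex.I := by
      rw [pow_succ, Complex.I_sq, neg_one_mul]
    by_cases m0 : (0 : Fin 3) ∈ S <;> by_cases m1 : (1 : Fin 3) ∈ S <;>
      by_cases m2 : (2 : Fin 3) ∈ S <;> simp [Fin.prod_univ_three, i3, m0, m1, m2] <;> ring
  -- The type condition applied to `(I u, I v, I w)`, where two of the `I`'s in each term square to
  -- `-1`.
  have h1 : α ![I u, I v, I w] = α ![u, v, I w] + α ![I u, v, w] + α ![u, I v, w] := by
    have n := fun a b c ↦ map_smul_three α (-1 : ℝ) a b c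
    simp only [neg_one_smul, neg_one_mul] at n
    rw [hα (I u) (I v) (I w), hI, hI, hI, (n u (-v) (I w)).1, (n u v (I w)).2.1,
      (n (I u) v (-w)).2.1, (n (I u) v w).2.2, (n u (I v) (-w)).1, (n u (I v) w).2.2]
    ring
  rw [hsum, hsum, p1, p2, h1]
  rw [Finset.sum_insert (by decide), Finset.sum_insert (by decide), Finset.sum_singleton,
    Finset.sum_insert (by decide), Finset.sum_insert (by decide), Finset.sum_singleton]
  simp
  have i2 := Complex.I_sq
  linear_combination (4⁻¹ : ℂ) * ((α ![I u, v, w] : ℂ) + α ![u, I v, w] + α ![u, v, I w] + 3 *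
    (α ![I u, v, w] + α ![u, I v, w] + α ![u, v, I w])) * i2

/-- The mixed components of the integrability condition as a formula for the torsion. -/
lemma forall_add_eq_iff {I : W →L[ℝ] W} (hI : ∀ v, I (I v) = -v) {α η : W [⋀^Fin 3]→L[ℝ] ℝ}
    (hα : ∀ u v w, α ![u, v, w] = α ![I u, I v, w] + α ![u, I v, I w] + α ![I u, v, I w]) (c : ℝ) :
    (∀ u v w, η ![u, I v, w] + η ![I u, v, w] = c * (α ![u, v, w] - α ![I u, I v, w])) ↔
      ∀ u v w, η ![u, v, w] = -c * α ![I u, I v, I w] := by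
  have n := fun (α : W [⋀^Fin 3]→L[ℝ] ℝ) a b c ↦ map_smul_three α (-1 : ℝ) a b c
  simp only [neg_one_smul, neg_one_mul] at n
  constructor
  · intro h u v w
    -- The hypothesis for the three pairs of slots is a linear system in the three values of `η`
    -- with one `I` inserted. Solving it and using the type condition on `α` isolates the value with
    -- `I` in the last slot.
    have key : ∀ u v w, η ![u, v, I w] = c * α ![I u, I v, w] := by
      intro u v w
      have h1 := h u v w
      have h2 := h v w u
      have h3 := h u w v
      have s := fun (α : W [⋀^Fin 3]→L[ℝ] ℝ) a b c ↦ map_swap_three α a b c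
      have r : ∀ (α : W [⋀^Fin 3]→L[ℝ] ℝ) a b c, α ![b, c, a] = α ![a, b, c] := by
        intro α a b c
        rw [(s α b a c).2, (s α a b c).1, neg_neg]
      rw [r η u v (I w), r η u (I v) w, r α u v w, r α u (I v) (I w)] at h2
      rw [(s η u v (I w)).2, (s η (I u) v w).2, (s α u v w).2, (s α (I u) v (I w)).2] at h3
      linear_combination (1 / 2 : ℝ) * (h2 - h3 - h1) + (c / 2) * hα u v w
    -- As `I (-I w) = w`, this substitution removes the `I` from `η`.
    have h1 := key u v (-I w)
    rw [map_neg, hI, neg_neg, (n α (I u) (I v) (I w)).2.2] at h1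
    rw [h1]
    ring
  · intro h u v w
    rw [h, h, hI, hI, (n α (I u) v (I w)).2.1, (n α u (I v) (I w)).1, hα u v w]
    ring

end LinearAlgebra

/-! ### The operator `d^c` on `ω_±` and the final equivalence -/

section Dolbeault

variable {V : Type*} [NormedAddCommGroup V] [NormedSpace ℝ V] [FiniteDimensional ℝ V]
  {M : Type*} [TopologicalSpace M] [ChartedSpace V M] [IsManifold 𝓘(ℝ, V) ∞ M]
  {F : Type*} [NormedAddCommGroup F] [NormedSpace ℝ F]
  {E : M → Type*} [TopologicalSpace (TotalSpace F E)] [∀ x, AddCommGroup (E x)]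
  [∀ x, Module ℝ (E x)] [∀ x, TopologicalSpace (E x)]
  [∀ x, IsTopologicalAddGroup (E x)] [∀ x, ContinuousSMul ℝ (E x)]
  [FiberBundle F E] [VectorBundle ℝ F E] [ContMDiffVectorBundle ∞ F E 𝓘(ℝ, V)]
  {𝓔 : CourantAlgebroid V M F E}

namespace AlmostGeneralizedKahler

variable (𝓙 : AlmostGeneralizedKahler 𝓔)

/-- Since `ω_ε` has type `(1,1)`, only `p = 1` survives in the sums defining `∂` and `∂̄`. No
integrability of `I_ε` is needed here. -/
lemma dc_omega (ε : ℤˣ) (x : M) : dc (𝓙.I ε) (𝓙.omega ε) x =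
    Complex.I • (typePart (𝓙.I ε x) 1 (toComplexForm (extD (𝓙.omega ε)) x)
      - typePart (𝓙.I ε x) 2 (toComplexForm (extD (𝓙.omega ε)) x)) := by
  have h : ∀ y, typePart (𝓙.I ε y) 0 (toComplexForm (𝓙.omega ε) y) = 0 ∧
      typePart (𝓙.I ε y) 1 (toComplexForm (𝓙.omega ε) y) = toComplexForm (𝓙.omega ε) y ∧
      typePart (𝓙.I ε y) 2 (toComplexForm (𝓙.omega ε) y) = 0 := fun y ↦
    typePart_two (𝓙.I_I ε y) fun u v ↦
      congrArg (fun r : ℝ ↦ (r : ℂ)) (𝓙.g_I_I ε y (𝓙.I ε y u) v)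
  have h0 : (fun y ↦ typePart (𝓙.I ε y) 0 (toComplexForm (𝓙.omega ε) y)) = fun _ ↦ 0 :=
    funext fun y ↦ (h y).1
  have h1 : (fun y ↦ typePart (𝓙.I ε y) 1 (toComplexForm (𝓙.omega ε) y)) =
      toComplexForm (𝓙.omega ε) := funext fun y ↦ (h y).2.1
  have h2 : (fun y ↦ typePart (𝓙.I ε y) 2 (toComplexForm (𝓙.omega ε) y)) = fun _ ↦ 0 :=
    funext fun y ↦ (h y).2.2
  rw [dc, delbar, del]
  simp only [Finset.sum_range_succ, Finset.sum_range_zero, h0, h1, h2, extD_zero,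
    typePart_zero_form, zero_add, add_zero,
    extD_toComplexForm isOpen_univ (𝓙.smooth_omega ε univ) (mem_univ x)]

lemma extD_omega_type_apply {ε : ℤˣ} (h : IsIntegrableComplexStructure (𝓙.I ε)) (x : M)
    (u v w : TangentSpace 𝓘(ℝ, V) x) :
    extD (𝓙.omega ε) x ![u, v, w] = extD (𝓙.omega ε) x ![𝓙.I ε x u, 𝓙.I ε x v, w]
      + extD (𝓙.omega ε) x ![u, 𝓙.I ε x v, 𝓙.I ε x w]
      + extD (𝓙.omega ε) x ![𝓙.I ε x u, v, 𝓙.I ε x w] := by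
  rw [isIntegrableComplexStructure_iff] at h
  obtain ⟨X, hX, rfl⟩ := exists_smoothSection_eq x u
  obtain ⟨Y, hY, rfl⟩ := exists_smoothSection_eq x v
  obtain ⟨Z, hZ, rfl⟩ := exists_smoothSection_eq x w
  have hU := (chartAt V x).open_source
  have hx := mem_chart_source V x
  exact 𝓙.extD_omega_type hU hX hY hZ hx (h _ hU _ _ hX hY x hx) (h _ hU _ _ hX hZ x hx)
    (h _ hU _ _ hY hZ x hx)

lemma dc_omega_apply {ε : ℤˣ} (h : IsIntegrableComplexStructure (𝓙.I ε)) (x : M)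
    (u v w : TangentSpace 𝓘(ℝ, V) x) : dc (𝓙.I ε) (𝓙.omega ε) x ![u, v, w] =
      ((-extD (𝓙.omega ε) x ![𝓙.I ε x u, 𝓙.I ε x v, 𝓙.I ε x w] : ℝ) : ℂ) := by
  rw [dc_omega]
  exact typePart_three_sub (𝓙.I_I ε x) (𝓙.extD_omega_type_apply h x) u v w

/-- By `mixedForm_eq` the vanishing is the linear relation solved in `forall_add_eq_iff`, with `η =
H`, `α = dω_ε` and `c = ε`. -/
lemma forall_mixedForm_eq_zero_iff {ε : ℤˣ} (h : IsIntegrableComplexStructure (𝓙.I ε)) :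
    (∀ U : Set M, IsOpen U → ∀ X Y Z : ∀ x : M, TangentSpace 𝓘(ℝ, V) x,
      SmoothSectionOn V V X U → SmoothSectionOn V V Y U → SmoothSectionOn V V Z U → ∀ x ∈ U,
      𝓙.mixedForm ε X Y Z x = 0) ↔ ∀ x u v w, 𝓙.torsionForm x ![u, v, w] =
        -((ε : ℤ) : ℝ) * extD (𝓙.omega ε) x ![𝓙.I ε x u, 𝓙.I ε x v, 𝓙.I ε x w] := by
  have hN := (𝓙.isIntegrableComplexStructure_iff ε).1 h
  have key := fun x ↦ forall_add_eq_iff (𝓙.I_I ε x) (η := 𝓙.torsionForm x)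
    (𝓙.extD_omega_type_apply h x) ((ε : ℤ) : ℝ)
  rw [← forall_congr' key]
  constructor
  · intro h x u v w
    obtain ⟨X, hX, rfl⟩ := exists_smoothSection_eq x u
    obtain ⟨Y, hY, rfl⟩ := exists_smoothSection_eq x v
    obtain ⟨Z, hZ, rfl⟩ := exists_smoothSection_eq x w
    have hU := (chartAt V x).open_source
    have hx := mem_chart_source V x
    have h1 := h _ hU X Y Z hX hY hZ x hx
    rw [𝓙.mixedForm_eq ε hU hX hY hZ hx (hN _ hU _ _ hX hY x hx)] at h1
    linarith
  · intro h U hU X Y Z hX hY hZ x hx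
    rw [𝓙.mixedForm_eq ε hU hX hY hZ hx (hN _ hU _ _ hX hY x hx), h]
    ring

lemma forall_mixedForm_eq_zero_iff_dc {ε : ℤˣ} (h : IsIntegrableComplexStructure (𝓙.I ε)) :
    (∀ U : Set M, IsOpen U → ∀ X Y Z : ∀ x : M, TangentSpace 𝓘(ℝ, V) x,
      SmoothSectionOn V V X U → SmoothSectionOn V V Y U → SmoothSectionOn V V Z U → ∀ x ∈ U,
      𝓙.mixedForm ε X Y Z x = 0) ↔
      ∀ x, ((ε : ℤ) : ℝ) • dc (𝓙.I ε) (𝓙.omega ε) x = toComplexForm 𝓙.torsionForm x := by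
  rw [𝓙.forall_mixedForm_eq_zero_iff h]
  refine forall_congr' fun x ↦ ?_
  have e : ∀ u v w, (((ε : ℤ) : ℝ) • dc (𝓙.I ε) (𝓙.omega ε) x) ![u, v, w] =
      ((-((ε : ℤ) : ℝ) * extD (𝓙.omega ε) x ![𝓙.I ε x u, 𝓙.I ε x v, 𝓙.I ε x w] : ℝ) : ℂ) := by
    intro u v w
    change ((ε : ℤ) : ℝ) • dc (𝓙.I ε) (𝓙.omega ε) x ![u, v, w] = _
    rw [𝓙.dc_omega_apply h, Complex.real_smul]
    push_cast
    ring
  constructor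
  · intro h1
    ext v
    have hv : v = ![v 0, v 1, v 2] := by funext i; fin_cases i <;> rfl
    rw [hv, e, ← h1]
    rfl
  · intro h1 u v w
    have h2 := congrArg (fun α : TangentSpace 𝓘(ℝ, V) x [⋀^Fin 3]→L[ℝ] ℂ ↦ α ![u, v, w]) h1
    exact (Complex.ofReal_injective ((e u v w).symm.trans h2)).symm

/-- Integrability of `(J₊, J₋)` in terms of the almost bi-Hermitian data. -/
theorem isIntegrable_iff : 𝓙.IsIntegrable ↔
    (IsIntegrableComplexStructure (𝓙.I 1) ∧ IsIntegrableComplexStructure (𝓙.I (-1))) ∧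
      (dc (𝓙.I 1) (𝓙.omega 1) = toComplexForm 𝓙.torsionForm ∧
        -dc (𝓙.I (-1)) (𝓙.omega (-1)) = toComplexForm 𝓙.torsionForm) := by
  have hall : ∀ p : ℤˣ → Prop, (∀ ε, p ε) ↔ p 1 ∧ p (-1) := by
    intro p
    refine ⟨fun h ↦ ⟨h 1, h (-1)⟩, fun h ε ↦ ?_⟩
    rcases Int.units_eq_one_or ε with rfl | rfl
    exacts [h.1, h.2]
  have h : 𝓙.IsIntegrable ↔ ∀ ε : ℤˣ, IsIntegrableComplexStructure (𝓙.I ε) ∧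
      ∀ x, ((ε : ℤ) : ℝ) • dc (𝓙.I ε) (𝓙.omega ε) x = toComplexForm 𝓙.torsionForm x := by
    rw [isIntegrable_iff_lieNijenhuis]
    exact forall_congr' fun ε ↦ and_congr_right fun hε ↦ 𝓙.forall_mixedForm_eq_zero_iff_dc hε
  have h1 : (∀ x, (((1 : ℤˣ) : ℤ) : ℝ) • dc (𝓙.I 1) (𝓙.omega 1) x =
      toComplexForm 𝓙.torsionForm x) ↔
      dc (𝓙.I 1) (𝓙.omega 1) = toComplexForm 𝓙.torsionForm := by
    rw [funext_iff]
    simp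
  have h2 : (∀ x, (((-1 : ℤˣ) : ℤ) : ℝ) • dc (𝓙.I (-1)) (𝓙.omega (-1)) x =
      toComplexForm 𝓙.torsionForm x) ↔
      -dc (𝓙.I (-1)) (𝓙.omega (-1)) = toComplexForm 𝓙.torsionForm := by
    have e : ∀ x, (((-1 : ℤˣ) : ℤ) : ℝ) • dc (𝓙.I (-1)) (𝓙.omega (-1)) x =
        (-dc (𝓙.I (-1)) (𝓙.omega (-1))) x := by
      intro x
      ext v
      change (((-1 : ℤˣ) : ℤ) : ℝ) • dc (𝓙.I (-1)) (𝓙.omega (-1)) x v =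
        -dc (𝓙.I (-1)) (𝓙.omega (-1)) x v
      simp
    rw [funext_iff]
    simp only [e]
  rw [h, hall, h1, h2]
  tauto

end AlmostGeneralizedKahler

end Dolbeault

end GenKahler

end

/-- Let `𝓙 = (J₊, J₋)` be an almost generalized Kähler structure on an exact real Courant algebroid
`E` over `M`, with associated almost bi-Hermitian data `(s, g, I₊, I₋)`. The splitting `s` has a
unique torsion `3`-form `H`, which is smooth and closed, and `(J₊, J₋)` is integrable if and only if
`I₊`, `I₋` are integrable and `d^c₊ ω₊ = H = -d^c₋ ω₋`. -/
theorem mainTheorem1 {V : Type*} [NormedAddCommGroup V] [NormedSpace ℝ V] [FiniteDimensional ℝ V]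
    {M : Type*} [TopologicalSpace M] [T2Space M] [SecondCountableTopology M]
    [ChartedSpace V M] [IsManifold 𝓘(ℝ, V) ∞ M]
    {F : Type*} [NormedAddCommGroup F] [NormedSpace ℝ F] [FiniteDimensional ℝ F]
    {E : M → Type*} [TopologicalSpace (TotalSpace F E)] [∀ x, AddCommGroup (E x)]
    [∀ x, Module ℝ (E x)] [∀ x, TopologicalSpace (E x)]
    [∀ x, IsTopologicalAddGroup (E x)] [∀ x, ContinuousSMul ℝ (E x)]
    [FiberBundle F E] [VectorBundle ℝ F E] [ContMDiffVectorBundle ∞ F E 𝓘(ℝ, V)]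
    (𝓔 : GenKahler.CourantAlgebroid V M F E) (𝓙 : GenKahler.AlmostGeneralizedKahler 𝓔) :
    ∃ H : ∀ x : M, TangentSpace 𝓘(ℝ, V) x [⋀^Fin 3]→L[ℝ] ℝ,
      GenKahler.IsSmoothForm H ∧ (∀ x, GenKahler.extD H x = 0) ∧
      𝓔.IsTorsionForm 𝓙.s H ∧ (∀ H', 𝓔.IsTorsionForm 𝓙.s H' → H' = H) ∧
      (𝓙.IsIntegrable ↔
        (GenKahler.IsIntegrableComplexStructure (𝓙.I 1) ∧
          GenKahler.IsIntegrableComplexStructure (𝓙.I (-1))) ∧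
        (GenKahler.dc (𝓙.I 1) (𝓙.omega 1) = GenKahler.toComplexForm H ∧
          -GenKahler.dc (𝓙.I (-1)) (𝓙.omega (-1)) = GenKahler.toComplexForm H)) := by
  exact ⟨𝓙.torsionForm, 𝓙.isSmoothForm_torsionForm, 𝓙.extD_torsionForm,
    𝓙.isTorsionForm_torsionForm, fun _ ↦ 𝓙.eq_torsionForm, 𝓙.isIntegrable_iff⟩
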